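/- **Conventions.** Groups are abelian, complexes are $\mathbb Z$-graded with $d$ of degree $-1$, and tensor products are over $\mathbb Z$ with the usual sign in the differential. A group or complex indexed by a set $\Lambda$ is a direct sum $A_*=\bigoplus_{\alpha\in\Lambda}A_*^\alpha$ of graded groups or complexes. Homomorphisms of indexed objects, their kernels, images, cokernels, homology, duals ($A^n_\alpha=\mathrm{Hom}(A_n^\alpha,\mathbb Z)$) and all statements below are taken summandwise. For objects indexed by the same set, the diagonal tensor product is $A_*\,\widehat\otimes\,B_*=\bigoplus_\alpha A_*^\alpha\otimes B_*^\alpha$. An indexed chain homomorphism $\vartheta\colon C_*\to D_*$ with induced homology homomorphism $\theta\colon U_*=H_*(C_*)\to V_*=H_*(D_*)$ is a *split inclusion* if $C_*$ is a subcomplex of the free complex $D_*$ with inclusion $\vartheta$, the quotient $D_*/C_*$ is free in each degree, and $\ker\theta$, $\operatorname{im}\theta$, $\operatorname{coker}\theta$ are free. Let $\theta^\circ\colon V^*\to U^*$ be the dual of $\theta$. Let $\mathscr X=\{(\emptyset,\emptyset),(\emptyset,\{1\}),(\{1\},\emptyset)\}$, $\mathscr R=\{(\emptyset,\emptyset),(\emptyset,\{1\})\}$,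 and let $\mathscr S$ be $\mathscr X$ or $\mathscr R$. The character groups $H_*^{\mathscr S}(\theta)$, $H^*_{\mathscr S}(\theta^\circ)$ and the character complex $C_*^{\mathscr S}(\theta)$ are the sums over $s\in\mathscr S$ of the following, for $s=(\emptyset,\emptyset),(\emptyset,\{1\}),(\{1\},\emptyset)$ respectively: - $H_*^s(\theta)=\operatorname{im}\theta,\ \ker\theta,\ \operatorname{coker}\theta$; - $H^*_s(\theta^\circ)=\operatorname{im}\theta^\circ,\ \operatorname{coker}\theta^\circ,\ \ker\theta^\circ$; - $C_*^s(\theta)=\operatorname{im}\theta,\ \ker\theta\oplus\Sigma\ker\theta,\ \operatorname{coker}\theta$, where $d$ is the desuspension $\Sigma\ker\theta\to\ker\theta$ on the second and zero on the other two. By $U_*\cong\ker\theta\oplus\operatorname{im}\theta$ regard $U_*$ as a subcomplex, with zero differential, of $C_*^{\mathscr S}(\theta)$. Likewise let $T_*^{\mathscr S}$ have the summands $\mathbb Z(\eta)$, $\mathbb Z(\beta,\gamma)$, $\mathbb Z(\alpha)$ with $|\alpha|=|\beta|-1=|\gamma|=|\eta|=0$, $d\beta=\gamma$, and let $S_*^{\mathscr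 S}=\mathbb Z(\gamma,\eta)\subset T_*^{\mathscr S}$. Let $K$ be a simplicial complex on $[m]$, i.e. a set of subsets of $[m]$ closed under taking subsets (possibly void, ghost vertices allowed), and for $k=1,\dots,m$ let $\vartheta_k\colon (C_k)_*\to(D_k)_*$ be a split inclusion with homology homomorphism $\theta_k\colon (U_k)_*\to(V_k)_*$. For pairs of complexes $A_k\subset B_k$, write $(B_\bullet,A_\bullet)^K=\sum_{\tau\in K}E_1(\tau)\otimes\dots\otimes E_m(\tau)\subset B_1\otimes\dots\otimes B_m$, where $E_k(\tau)=B_k$ if $k\in\tau$ and $E_k(\tau)=A_k$ if $k\notin\tau$. Define the polyhedral product inclusion complex $C_*(K;\underline\vartheta)$, the polyhedral product character complex $C_*^{\mathscr S_m}(K;\underline\theta)$ and the total chain complex $T_*^{\mathscr S_m}(K)$ as $(B_\bullet,A_\bullet)^K$ for the pairs $(C_k)_*\subset(D_k)_*$, $(U_k)_*\subset C_*^{\mathscr S}(\theta_k)$ and $S_*^{\mathscr S}\subset T_*^{\mathscr S}$ respectively. The last two are indexed by $\mathscr S_m=\mathscr S^m$. Denote by $C^*(K;\underline\vartheta^\circ)$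 and $T^*_{\mathscr S_m}(K)$ the dual cochain complexes, and put $H_*^{\mathscr S_m}(K)=H_*(T_*^{\mathscr S_m}(K))$, $H^*_{\mathscr S_m}(K)=H^*(T^*_{\mathscr S_m}(K))$, $H_*^{\mathscr S_m}(\underline\theta)=H_*^{\mathscr S}(\theta_1)\otimes\dots\otimes H_*^{\mathscr S}(\theta_m)$, $H^*_{\mathscr S_m}(\underline\theta^\circ)=H^*_{\mathscr S}(\theta_1^\circ)\otimes\dots\otimes H^*_{\mathscr S}(\theta_m^\circ)$. **Theorem 3.7.** For $\mathscr S=\mathscr X$, and also for $\mathscr S=\mathscr R$ if every $\theta_k$ is an epimorphism: 1. There is a quotient (i.e. surjective) chain homotopy equivalence $C_*(K;\underline\vartheta)\to C_*^{\mathscr S_m}(K;\underline\theta)$ (forgetting the index set $\mathscr S_m$). 2. There is an isomorphism of chain complexes indexed by $\mathscr S_m$: $C_*^{\mathscr S_m}(K;\underline\theta)\cong T_*^{\mathscr S_m}(K)\,\widehat\otimes\,H_*^{\mathscr S_m}(\underline\theta)$. 3. There is an isomorphism of graded groups $H_*(C_*(K;\underline\vartheta))\cong H_*^{\mathscr S_m}(K)\,\widehat\otimes\,H_*^{\mathscr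 S_m}(\underline\theta)$. 4. There is an isomorphism of graded groups $H^*(C^*(K;\underline\vartheta^\circ))\cong H^*_{\mathscr S_m}(K)\,\widehat\otimes\,\mathrm{Hom}(H_*^{\mathscr S_m}(\underline\theta),\mathbb Z)$. If moreover, for every $k$ and for every summand of the indexed groups, $(U_k)_*$ and $(V_k)_*$ are finitely generated in each degree and zero below some degree, then $H^*(C^*(K;\underline\vartheta^\circ))\cong H^*_{\mathscr S_m}(K)\,\widehat\otimes\,H^*_{\mathscr S_m}(\underline\theta^\circ)$. If every $\theta_k$ is an epimorphism, then moreover $H_*^{\mathscr X}(\theta_k)=H_*^{\mathscr R}(\theta_k)\cong(U_k)_*$ and $H^*_{\mathscr X}(\theta_k^\circ)=H^*_{\mathscr R}(\theta_k^\circ)\cong(U_k)^*$. That is, $\operatorname{coker}\theta_k=0$ and $\ker\theta_k^\circ=0$; there is an isomorphism $\ker\theta_k\oplus\operatorname{im}\theta_k\cong(U_k)_*$ that is the inclusion on $\ker\theta_k$ and whose composite with $\theta_k$ is the projection to $\operatorname{im}\theta_k$; and there is an isomorphism $(U_k)^*\cong\operatorname{coker}\theta_k^\circ\oplus\operatorname{im}\theta_k^\circ$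 whose first component is the projection and which is the identity on $\operatorname{im}\theta_k^\circ$. -/

import Mathlib

universe u v

open CategoryTheory
open scoped DirectSum TensorProduct

noncomputable section

namespace PolyProd

variable {R : Type} [CommRing R]

/-- Chain complexes of `R`-modules (abelian groups for `R = ℤ`), graded by `ℤ`, with differential of degree `-1`. A chain
complex (or graded group) indexed by a set `Λ`, usually written as a direct sum over `Λ`, is given
by the family of its summands; an indexed homomorphism is the family of its summands. -/
abbrev Cx (R : Type) [CommRing R] := ChainComplex (ModuleCat.{u} R) ℤ

/-- Graded `R`-modules. -/
abbrev Gr (R : Type) [CommRing R] := ℤ → ModuleCat.{u} R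

/-! ### Split inclusions -/

/-- The graded homology group `H_*(C)`. -/
def homologyGr (C : Cx.{u} R) : Gr.{u} R := fun n => C.homology n

/-- The homomorphism `H_*(C) → H_*(D)` induced by a chain homomorphism. -/
def homologyHom {C D : Cx.{u} R} (f : C ⟶ D) (n : ℤ) : homologyGr C n ⟶ homologyGr D n :=
  HomologicalComplex.homologyMap f n

/-- A homomorphism of indexed graded groups is split if its kernel, image and cokernel are free. -/
structure IsSplitHom {Λ : Type v} {U V : Λ → Gr.{u} R} (θ : ∀ a n, U a n ⟶ V a n) : Prop where
  ker_free : ∀ a n, Module.Free R (LinearMap.ker (θ a n).hom)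
  im_free : ∀ a n, Module.Free R (LinearMap.range (θ a n).hom)
  coker_free : ∀ a n, Module.Free R (V a n ⧸ LinearMap.range (θ a n).hom)

/-- A split inclusion: the inclusion of a subcomplex `C` of a free complex `D`, with free quotient
`D / C`, such that the induced homology homomorphism is split. -/
structure IsSplitInclusion {Λ : Type v} {C D : Λ → Cx.{u} R} (ϑ : ∀ a, C a ⟶ D a) : Prop where
  injective : ∀ a n, Function.Injective ((ϑ a).f n).hom
  free : ∀ a n, Module.Free R ((D a).X n)
  quotient_free : ∀ a n, Module.Free R ((D a).X n ⧸ LinearMap.range ((ϑ a).f n).hom)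
  split : IsSplitHom fun a => homologyHom (ϑ a)

/-! ### Character groups and character complexes -/

/-- The index set `𝒳`: `im`, `ker`, `coker` stand for `(∅, ∅)`, `(∅, {1})`, `({1}, ∅)`. A function
`s : Fin m → 𝒳` stands for the pair `(σ, ω)`, `σ = {k | s k = coker}`, `ω = {k | s k = ker}`. -/
inductive XIdx : Type
  | im
  | ker
  | coker
  deriving DecidableEq

/-- The index set `ℛ = {(∅, ∅), (∅, {1})}` as a subset of `𝒳`. -/
def rightIdx : Set XIdx := {XIdx.im, XIdx.ker}

/-- The character group `H_*^s(θ)` of a homomorphism `θ` of graded groups. -/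
def charGroup {U V : Gr.{u} R} (θ : ∀ n, U n ⟶ V n) : XIdx → Gr.{u} R
  | .im, n => ModuleCat.of R (LinearMap.range (θ n).hom)
  | .ker, n => ModuleCat.of R (LinearMap.ker (θ n).hom)
  | .coker, n => ModuleCat.of R (V n ⧸ LinearMap.range (θ n).hom)

/-- The character group `H^*_s(θ°)` of the dual homomorphism `θ° : V^* → U^*`. -/
def cocharGroup {U V : Gr.{u} R} (θ : ∀ n, U n ⟶ V n) : XIdx → Gr.{u} R
  | .im, n => ModuleCat.of R (LinearMap.range (θ n).hom.dualMap)
  | .ker, n => ModuleCat.of R (Module.Dual R (U n) ⧸ LinearMap.range (θ n).hom.dualMap)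
  | .coker, n => ModuleCat.of R (LinearMap.ker (θ n).hom.dualMap)

/-- A graded group as a chain complex with trivial differential. -/
def trivCx (G : Gr.{u} R) : Cx.{u} R where
  X := G
  d _ _ := 0

/-- The complex `G ⊕ ΣG`, where `d` is the desuspension isomorphism `ΣG → G`. -/
def coneCx (G : Gr.{u} R) : Cx.{u} R where
  X n := ModuleCat.of R (G n × G (n - 1))
  d i j :=
    if h : j + 1 = i then
      ModuleCat.ofHom (LinearMap.inl R (G j) (G (j - 1)) ∘ₗ
        (eqToHom (congrArg G (by omega : i - 1 = j))).hom ∘ₗ LinearMap.snd R (G i) (G (i - 1)))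
    else 0
  shape i j h := dif_neg h
  d_comp_d' i j k hij hjk := by
    have hij' : j + 1 = i := hij
    have hjk' : k + 1 = j := hjk
    rw [dif_pos hij', dif_pos hjk']
    ext x <;> simp

/-- The inclusion `G → G ⊕ ΣG`. -/
def coneIncl (G : Gr.{u} R) : trivCx G ⟶ coneCx G where
  f n := ModuleCat.ofHom (LinearMap.inl R (G n) (G (n - 1)))
  comm' i j hij := by
    have hij' : j + 1 = i := hij
    ext x; simp [trivCx, coneCx, hij', LinearMap.comp_assoc]

/-- From a graded group `G` indexed by `𝒳`, the indexed complex with summands `G^s` for `s = im` and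
`s = coker` (trivial differential) and `G^s ⊕ ΣG^s` for `s = ker`. -/
def modelCx (G : XIdx → Gr.{u} R) : XIdx → Cx.{u} R
  | .im => trivCx (G .im)
  | .ker => coneCx (G .ker)
  | .coker => trivCx (G .coker)

/-- The summands `G^im`, `G^ker`, `0` of the subcomplex `G^im ⊕ G^ker` of `modelCx G`. -/
def baseCx (G : XIdx → Gr.{u} R) : XIdx → Cx.{u} R
  | .im => trivCx (G .im)
  | .ker => trivCx (G .ker)
  | .coker => trivCx fun _ => ModuleCat.of R PUnit

/-- The inclusion of `G^im ⊕ G^ker` in `modelCx G`. -/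
def baseIncl (G : XIdx → Gr.{u} R) : ∀ s, baseCx G s ⟶ modelCx G s
  | .im => 𝟙 _
  | .ker => coneIncl (G .ker)
  | .coker => 0

/-- The inclusion, as complexes indexed by `𝒳`, of `U_* = ker θ ⊕ coim θ = ker θ ⊕ im θ` in the
character complex `C_*^𝒳(θ)`, which has the summands `im θ`, `ker θ ⊕ Σ ker θ`, `coker θ`. -/
abbrev charIncl {U V : Gr.{u} R} (θ : ∀ n, U n ⟶ V n) (s : XIdx) :
    baseCx (charGroup θ) s ⟶ modelCx (charGroup θ) s :=
  baseIncl (charGroup θ) s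

/-- The graded group with `R` in degree `0` and zero in all other degrees. -/
def unitGr (R : Type) [CommRing R] : Gr.{0} R := fun n => ModuleCat.of R ↥(if n = 0 then ⊤ else ⊥ : Submodule R R)

/-- The inclusion of `S_*^𝒳 = ℤ(γ, η)` in `T_*^𝒳`, which has the summands `ℤ(η)`, `ℤ(β, γ)`,
`ℤ(α)` at `im`, `ker`, `coker`, with `|α| = |β| - 1 = |γ| = |η| = 0` and `d β = γ`. -/
abbrev unitIncl (R : Type) [CommRing R] (s : XIdx) :
    baseCx (fun _ => unitGr R) s ⟶ modelCx (fun _ => unitGr R) s :=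
  baseIncl (fun _ => unitGr R) s

/-! ### Tensor products and polyhedral products of complexes -/

section Tot

variable {I : Type} [DecidableEq I]

/-- The underlying group of the total complex `⨁ i, X i` of an indexed complex. -/
abbrev Tot (X : I → Cx.{u} R) : Type u := ⨁ p : I × ℤ, ((X p.1).X p.2 : Type u)

/-- The inclusion of the summand of index `i` and degree `n`. -/
abbrev Tot.of (X : I → Cx.{u} R) (i : I) (n : ℤ) : (X i).X n →ₗ[R] Tot X :=
  DirectSum.lof R (I × ℤ) (fun p => ((X p.1).X p.2 : Type u)) (i, n)

/-- The differential of `⨁ i, X i`. -/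
def Tot.d (X : I → Cx.{u} R) : Tot X →ₗ[R] Tot X :=
  DirectSum.toModule R (I × ℤ) (Tot X) fun p =>
    Tot.of X p.1 (p.2 - 1) ∘ₗ ((X p.1).d p.2 (p.2 - 1)).hom

/-- The sign `x ↦ (-1) ^ |x| x`. -/
def Tot.sign (X : I → Cx.{u} R) : Tot X →ₗ[R] Tot X :=
  DirectSum.toModule R (I × ℤ) (Tot X) fun p => ((p.2.negOnePow : ℤ) : R) • Tot.of X p.1 p.2

/-- The homomorphism of total complexes given by an indexed chain homomorphism. -/
def Tot.map {Y X : I → Cx.{u} R} (f : ∀ i, Y i ⟶ X i) : Tot Y →ₗ[R] Tot X :=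
  DirectSum.lmap fun p => ((f p.1).f p.2).hom

lemma Tot.d_of (X : I → Cx.{u} R) (i : I) (n : ℤ) (x : (X i).X n) :
    Tot.d X (Tot.of X i n x) = Tot.of X i (n - 1) (((X i).d n (n - 1)).hom x) :=
  DirectSum.toModule_lof ..

lemma Tot.sign_of (X : I → Cx.{u} R) (i : I) (n : ℤ) (x : (X i).X n) :
    Tot.sign X (Tot.of X i n x) = ((n.negOnePow : ℤ) : R) • Tot.of X i n x :=
  DirectSum.toModule_lof ..

lemma Tot.map_of {Y X : I → Cx.{u} R} (f : ∀ i, Y i ⟶ X i) (i : I) (n : ℤ) (y : (Y i).X n) :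
    Tot.map f (Tot.of Y i n y) = Tot.of X i n (((f i).f n).hom y) :=
  DirectSum.lmap_lof ..

lemma Tot.ext {X : I → Cx.{u} R} {M : Type u} [AddCommGroup M] [Module R M] {f g : Tot X →ₗ[R] M}
    (h : ∀ i n x, f (Tot.of X i n x) = g (Tot.of X i n x)) : f = g :=
  DirectSum.linearMap_ext R fun p => LinearMap.ext fun x => h p.1 p.2 x

lemma Tot.d_comp_d (X : I → Cx.{u} R) : Tot.d X ∘ₗ Tot.d X = 0 := by
  refine Tot.ext fun i n x => ?_
  have h : ((X i).d (n - 1) (n - 1 - 1)).hom (((X i).d n (n - 1)).hom x) = 0 := by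
    rw [← LinearMap.comp_apply, ← ModuleCat.hom_comp, (X i).d_comp_d]
    rfl
  simp [Tot.d_of, h]

lemma Tot.sign_comp_d (X : I → Cx.{u} R) :
    Tot.sign X ∘ₗ Tot.d X = -(Tot.d X ∘ₗ Tot.sign X) := by
  refine Tot.ext fun i n x => ?_
  simp [Tot.d_of, Tot.sign_of, Int.negOnePow_sub]

lemma Tot.d_comp_map {Y X : I → Cx.{u} R} (f : ∀ i, Y i ⟶ X i) :
    Tot.d X ∘ₗ Tot.map f = Tot.map f ∘ₗ Tot.d Y := by
  refine Tot.ext fun i n y => ?_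
  have h := congrArg (fun g => g.hom y) ((f i).comm n (n - 1))
  simp only [ModuleCat.hom_comp, LinearMap.comp_apply] at h
  simp [Tot.d_of, Tot.map_of, h]

lemma Tot.sign_comp_map {Y X : I → Cx.{u} R} (f : ∀ i, Y i ⟶ X i) :
    Tot.sign X ∘ₗ Tot.map f = Tot.map f ∘ₗ Tot.sign Y := by
  refine Tot.ext fun i n y => ?_
  simp [Tot.sign_of, Tot.map_of]

end Tot

section Poly

variable {m : ℕ} {I : Fin m → Type} [∀ k, DecidableEq (I k)]

/-- The underlying group of the tensor product complex `X 0 ⊗ ⋯ ⊗ X (m - 1)`. -/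
abbrev Tens (X : ∀ k, I k → Cx.{u} R) : Type u := ⨂[R] k, Tot (X k)

/-- The `l`-th tensor factor of the `k`-th summand of the differential of a tensor product. -/
def tensFactor (X : ∀ k, I k → Cx.{u} R) (k l : Fin m) : Tot (X l) →ₗ[R] Tot (X l) :=
  if l < k then Tot.sign (X l) else if l = k then Tot.d (X l) else LinearMap.id

/-- The differential of a tensor product,
`d (x₁ ⊗ ⋯ ⊗ x_m) = ∑ k, (-1) ^ (|x₁| + ⋯ + |x_{k-1}|) x₁ ⊗ ⋯ ⊗ d x_k ⊗ ⋯ ⊗ x_m`. -/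
def tensD (X : ∀ k, I k → Cx.{u} R) : Tens X →ₗ[R] Tens X :=
  ∑ k, PiTensorProduct.map (tensFactor X k)

/-- The part of degree `n` and with multi-index in `P` of a tensor product of indexed complexes. -/
def tensGr (X : ∀ k, I k → Cx.{u} R) (P : Set (∀ k, I k)) (n : ℤ) : Submodule R (Tens X) :=
  Submodule.span R {z | ∃ i ∈ P, ∃ j : Fin m → ℤ, ∑ k, j k = n ∧
    ∃ x : ∀ k, (X k (i k)).X (j k), z = PiTensorProduct.tprod R fun k => Tot.of (X k) (i k) (j k) (x k)}

/-- For indexed subcomplexes `f k : Y k → X k`, the subgroup `E₁ ⊗ ⋯ ⊗ E_m` of `X₁ ⊗ ⋯ ⊗ X_m` with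
`E_k = X k` for `k ∈ τ` and `E_k = Y k` for `k ∉ τ`. -/
def faceSub {Y X : ∀ k, I k → Cx.{u} R} (f : ∀ k i, Y k i ⟶ X k i) (τ : Finset (Fin m)) :
    Submodule R (Tens X) :=
  Submodule.span R {z | ∃ x : ∀ k, Tot (X k),
    (∀ k, k ∉ τ → x k ∈ LinearMap.range (Tot.map (f k))) ∧ z = PiTensorProduct.tprod R x}

/-- The sum of the subgroups `E₁ ⊗ ⋯ ⊗ E_m` over all simplices `τ` of `K`. A simplicial complex on
`[m]` is a set of subsets of `[m]` that is closed under taking subsets: ghost vertices, the complex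
`{∅}` and the void complex are allowed. -/
def polySub (K : LowerSet (Finset (Fin m))) {Y X : ∀ k, I k → Cx.{u} R}
    (f : ∀ k i, Y k i ⟶ X k i) : Submodule R (Tens X) :=
  ⨆ τ ∈ K, faceSub f τ

lemma tensD_tprod (X : ∀ k, I k → Cx.{u} R) (x : ∀ k, Tot (X k)) :
    tensD X (PiTensorProduct.tprod R x) =
      ∑ k, PiTensorProduct.tprod R fun l => tensFactor X k l (x l) := by
  simp [tensD, LinearMap.sum_apply]

lemma tensFactor_comp (X : ∀ k, I k → Cx.{u} R) (k l : Fin m) (hkl : k < l) :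
    PiTensorProduct.map (tensFactor X k) ∘ₗ PiTensorProduct.map (tensFactor X l) =
      -(PiTensorProduct.map (tensFactor X l) ∘ₗ PiTensorProduct.map (tensFactor X k)) := by
  rw [← PiTensorProduct.map_comp, ← PiTensorProduct.map_comp]
  set g := fun i => tensFactor X l i ∘ₗ tensFactor X k i with hg
  have h : (fun i => tensFactor X k i ∘ₗ tensFactor X l i) =
      Function.update g k ((-1 : R) • g k) := by
    funext i
    by_cases hi : i = k
    · subst hi
      simp only [Function.update_self, hg, tensFactor, lt_irrefl, if_false, if_true, if_pos hkl]
      rw [Tot.sign_comp_d]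
      simp
    · rw [Function.update_of_ne hi]
      simp only [hg, tensFactor]
      rcases lt_or_gt_of_ne hi with h1 | h1
      · simp [h1, h1.trans hkl]
      · simp [hi, not_lt.2 h1.le]
  rw [h, PiTensorProduct.map_update_smul, Function.update_eq_self]
  exact neg_one_smul R (PiTensorProduct.map g)

lemma tensFactor_comp_self (X : ∀ k, I k → Cx.{u} R) (k : Fin m) :
    PiTensorProduct.map (tensFactor X k) ∘ₗ PiTensorProduct.map (tensFactor X k) = 0 := by
  rw [← PiTensorProduct.map_comp]
  refine PiTensorProduct.ext (MultilinearMap.ext fun x => ?_)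
  simp only [LinearMap.compMultilinearMap_apply, PiTensorProduct.map_tprod, LinearMap.zero_apply]
  refine (PiTensorProduct.tprod R).map_coord_zero k ?_
  simpa [tensFactor] using LinearMap.congr_fun (Tot.d_comp_d (X k)) (x k)

lemma tensD_tensD (X : ∀ k, I k → Cx.{u} R) (z : Tens X) : tensD X (tensD X z) = 0 := by
  have e : tensD X (tensD X z) = ∑ p : Fin m × Fin m,
      (PiTensorProduct.map (tensFactor X p.1) ∘ₗ PiTensorProduct.map (tensFactor X p.2)) z := by
    rw [Fintype.sum_prod_type]
    simp only [tensD, LinearMap.sum_apply, map_sum, LinearMap.comp_apply]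
    exact Finset.sum_comm
  rw [e]
  refine Finset.sum_involution (fun p _ => (p.2, p.1)) ?_ ?_ (by simp) (by simp)
  · rintro ⟨k, l⟩ -
    rcases lt_trichotomy k l with h | h | h
    · rw [tensFactor_comp X k l h]; simp
    · subst h; rw [tensFactor_comp_self]; simp
    · rw [tensFactor_comp X l k h]; simp
  · rintro ⟨k, l⟩ - hne heq
    obtain rfl : l = k := congrArg Prod.fst heq
    exact hne (by rw [tensFactor_comp_self]; rfl)

lemma tensD_mem_tensGr (X : ∀ k, I k → Cx.{u} R) (P : Set (∀ k, I k)) {n n' : ℤ} (h : n' + 1 = n)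
    {z : Tens X} (hz : z ∈ tensGr X P n) : tensD X z ∈ tensGr X P n' := by
  induction hz using Submodule.span_induction with
  | zero => simp
  | add x y _ _ hx hy => rw [map_add]; exact add_mem hx hy
  | smul c x _ hx => rw [map_smul]; exact Submodule.smul_mem _ _ hx
  | mem z hz =>
    obtain ⟨i, hi, j, hj, x, rfl⟩ := hz
    rw [tensD_tprod]
    refine Submodule.sum_mem _ fun k _ => Submodule.subset_span ⟨i, hi, Function.update j k (j k - 1), ?_, ?_⟩
    · rw [Finset.sum_update_of_mem (Finset.mem_univ k), ← Finset.erase_eq]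
      have := Finset.add_sum_erase Finset.univ j (Finset.mem_univ k)
      omega
    · have hx : ∀ l, ∃ y : (X l (i l)).X (Function.update j k (j k - 1) l),
          tensFactor X k l (Tot.of (X l) (i l) (j l) (x l)) = Tot.of (X l) (i l) _ y := by
        intro l
        by_cases hl : l = k
        · subst hl
          rw [Function.update_self]
          exact ⟨_, by simpa [tensFactor] using Tot.d_of (X l) (i l) (j l) (x l)⟩
        · rw [Function.update_of_ne hl]
          by_cases hlt : l < k
          · refine ⟨(((j l).negOnePow : ℤ) : R) • x l, ?_⟩
            rw [map_smul]
            simpa [tensFactor, hlt] using Tot.sign_of (X l) (i l) (j l) (x l)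
          · exact ⟨x l, by simp [tensFactor, hlt, hl]⟩
      choose y hy using hx
      exact ⟨y, congrArg _ (funext hy)⟩

lemma tensD_mem_faceSub {Y X : ∀ k, I k → Cx.{u} R} (f : ∀ k i, Y k i ⟶ X k i)
    (τ : Finset (Fin m)) {z : Tens X} (hz : z ∈ faceSub f τ) : tensD X z ∈ faceSub f τ := by
  induction hz using Submodule.span_induction with
  | zero => simp
  | add x y _ _ hx hy => rw [map_add]; exact add_mem hx hy
  | smul c x _ hx => rw [map_smul]; exact Submodule.smul_mem _ _ hx
  | mem z hz =>
    obtain ⟨x, hx, rfl⟩ := hz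
    rw [tensD_tprod]
    refine Submodule.sum_mem _ fun k _ => Submodule.subset_span ⟨_, fun l hl => ?_, rfl⟩
    obtain ⟨y, hy⟩ := hx l hl
    rw [← hy]
    unfold tensFactor
    split_ifs
    · exact ⟨Tot.sign _ y, (LinearMap.congr_fun (Tot.sign_comp_map (f l)) y).symm⟩
    · exact ⟨Tot.d _ y, (LinearMap.congr_fun (Tot.d_comp_map (f l)) y).symm⟩
    · exact ⟨y, rfl⟩

lemma tensD_mem_polySub (K : LowerSet (Finset (Fin m))) {Y X : ∀ k, I k → Cx.{u} R}
    (f : ∀ k i, Y k i ⟶ X k i) {z : Tens X} (hz : z ∈ polySub K f) : tensD X z ∈ polySub K f := by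
  have h : polySub K f ≤ (polySub K f).comap (tensD X) :=
    iSup₂_le fun τ hτ y hy =>
      (le_iSup₂_of_le (f := fun τ (_ : τ ∈ K) => faceSub f τ) τ hτ le_rfl)
        (tensD_mem_faceSub f τ hy)
  exact h hz

/-- The part with multi-indices in `P` of the polyhedral product complex of `f` over `K`, i.e. of the
subcomplex `polySub K f` of the tensor product. `P = univ` gives the whole complex and `P = {s}` the
summand of index `s`. -/
def polyCx (K : LowerSet (Finset (Fin m))) {Y X : ∀ k, I k → Cx.{u} R}
    (f : ∀ k i, Y k i ⟶ X k i) (P : Set (∀ k, I k)) : Cx.{u} R where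
  X n := ModuleCat.of R ↥(polySub K f ⊓ tensGr X P n)
  d n n' :=
    if h : n' + 1 = n then
      ModuleCat.ofHom ((tensD X).restrict (p := polySub K f ⊓ tensGr X P n)
        (q := polySub K f ⊓ tensGr X P n') fun _ hz =>
          ⟨tensD_mem_polySub K f hz.1, tensD_mem_tensGr X P h hz.2⟩)
    else 0
  shape n n' h := dif_neg h
  d_comp_d' a b c hab hbc := by
    have hab' : b + 1 = a := hab
    have hbc' : c + 1 = b := hbc
    rw [dif_pos hab', dif_pos hbc']
    ext z
    exact tensD_tensD X z.1

/-- The summand of index `s` in degree `n` of the whole polyhedral product complex. -/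
def polySummand (K : LowerSet (Finset (Fin m))) {Y X : ∀ k, I k → Cx.{u} R}
    (f : ∀ k i, Y k i ⟶ X k i) (s : ∀ k, I k) (n : ℤ) :
    Submodule R ((polyCx K f Set.univ).X n) :=
  (tensGr X {s} n).comap (polySub K f ⊓ tensGr X Set.univ n).subtype

end Poly

/-! ### Graded tensor products, direct sums and duals -/

/-- The tensor product of `m` graded groups. -/
abbrev multiGr {m : ℕ} (G : Fin m → Gr.{u} R) : Gr.{u} R := fun n =>
  ModuleCat.of R (⨁ i : {i : Fin m → ℤ // ∑ k, i k = n}, ⨂[R] k, G k (i.1 k))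

/-- The tensor product `G ⊗ H` of two graded groups: in degree `n`, the sum of all
`G_{n - j} ⊗ H_j`. -/
abbrev pairGr (G : Gr.{0} R) (H : Gr.{u} R) : Gr.{u} R := fun n =>
  ModuleCat.of R (⨁ j : ℤ, G (n - j) ⊗[R] H j)

/-- The tensor product of a chain complex and a graded group, with differential `d ⊗ 1`. -/
def pairCx (T : Cx.{0} R) (H : Gr.{u} R) : Cx.{u} R where
  X := pairGr T.X H
  d n n' := ModuleCat.ofHom (DirectSum.lmap fun j => (T.d (n - j) (n' - j)).hom.rTensor (H j))
  shape n n' h := by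
    have h0 : ∀ j, T.d (n - j) (n' - j) = 0 := fun j => T.shape _ _ fun e => h <| by
      have e' : n' - j + 1 = n - j := e
      show n' + 1 = n
      omega
    have h1 : ∀ j, (T.d (n - j) (n' - j)).hom.rTensor (H j) = 0 := fun j => by rw [h0 j]; simp
    refine ModuleCat.hom_ext (LinearMap.ext fun x => DFinsupp.ext fun j => ?_)
    exact LinearMap.congr_fun (h1 j) _
  d_comp_d' a b c _ _ := by
    have h0 : ∀ j, (T.d (b - j) (c - j)).hom.rTensor (H j) ∘ₗ
        (T.d (a - j) (b - j)).hom.rTensor (H j) = 0 := fun j => by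
      rw [← LinearMap.rTensor_comp, ← ModuleCat.hom_comp, T.d_comp_d]
      exact LinearMap.rTensor_zero _
    refine ModuleCat.hom_ext (LinearMap.ext fun x => DFinsupp.ext fun j => ?_)
    exact LinearMap.congr_fun (h0 j) _

section Sum

variable {J : Type}

/-- The direct sum of an indexed graded group. -/
abbrev sumGr (G : J → Gr.{u} R) : Gr.{u} R := fun n => ModuleCat.of R (⨁ s, G s n)

/-- The direct sum of an indexed chain complex. -/
def sumCx (X : J → Cx.{u} R) : Cx.{u} R where
  X := sumGr fun s => (X s).X
  d n n' := ModuleCat.ofHom (DirectSum.lmap fun s => ((X s).d n n').hom)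
  shape n n' h := by
    refine ModuleCat.hom_ext (LinearMap.ext fun x => DFinsupp.ext fun s => ?_)
    exact LinearMap.congr_fun (congrArg ModuleCat.Hom.hom ((X s).shape n n' h)) _
  d_comp_d' a b c _ _ := by
    refine ModuleCat.hom_ext (LinearMap.ext fun x => DFinsupp.ext fun s => ?_)
    exact LinearMap.congr_fun (congrArg ModuleCat.Hom.hom ((X s).d_comp_d a b c)) _

/-- The summand of index `s` in degree `n` of a direct sum of chain complexes. -/
def sumSummand [DecidableEq J] (X : J → Cx.{u} R) (s : J) (n : ℤ) : Submodule R ((sumCx X).X n) :=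
  LinearMap.range (DirectSum.lof R J (fun s => ((X s).X n : Type u)) s)

end Sum

/-- The dual graded group `Hom(G_n, R)`. -/
abbrev dualGr (G : Gr.{u} R) : Gr.{u} R := fun n => ModuleCat.of R (Module.Dual R (G n))

/-- The dual cochain complex `Hom(C_*, R)`. -/
def dualCx (C : Cx.{u} R) : CochainComplex (ModuleCat.{u} R) ℤ where
  X := dualGr C.X
  d i j := ModuleCat.ofHom (C.d j i).hom.dualMap
  shape i j h := by
    refine ModuleCat.hom_ext (LinearMap.ext fun x => LinearMap.ext fun y => ?_)
    exact (congrArg x (LinearMap.congr_fun (congrArg ModuleCat.Hom.hom (C.shape j i h)) y)).trans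
      (map_zero x)
  d_comp_d' i j k _ _ := by
    refine ModuleCat.hom_ext (LinearMap.ext fun x => LinearMap.ext fun y => ?_)
    exact (congrArg x (LinearMap.congr_fun (congrArg ModuleCat.Hom.hom (C.d_comp_d k j i)) y)).trans
      (map_zero x)

/-- The graded cohomology group of the dual cochain complex of `C`. -/
def cohomologyGr (C : Cx.{u} R) : Gr.{u} R := fun n => (dualCx C).homology n

/-! ### The complexes attached to a simplicial complex -/

section Main

variable {m : ℕ}

/-- The polyhedral product inclusion complex `C_*(K; ϑ)`. -/
def inclCx (K : LowerSet (Finset (Fin m))) {C D : Fin m → Cx.{u} R} (ϑ : ∀ k, C k ⟶ D k) :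
    Cx.{u} R :=
  polyCx (I := fun _ => PUnit) (Y := fun k _ => C k) (X := fun k _ => D k) K (fun k _ => ϑ k)
    Set.univ

/-- The summand of index `s` of the total chain complex `T_*^{𝒮_m}(K)`, where `S = 𝒳` or `ℛ`. -/
def totalCx (R : Type) [CommRing R] (S : Set XIdx) (K : LowerSet (Finset (Fin m)))
    (s : Fin m → S) : Cx.{0} R :=
  polyCx (I := fun _ => S) K (fun _ t => unitIncl R t.1) {s}

variable {U V : Fin m → Gr.{u} R}

/-- The polyhedral product character complex `C_*^{𝒮_m}(K; θ)`, where `S = 𝒳` or `ℛ`. -/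
def charCx (S : Set XIdx) (K : LowerSet (Finset (Fin m))) (θ : ∀ k n, U k n ⟶ V k n) : Cx.{u} R :=
  polyCx (I := fun _ => S) K (fun k t => charIncl (θ k) t.1) Set.univ

/-- The summand of index `s` in degree `n` of the polyhedral product character complex. -/
def charSummand (S : Set XIdx) (K : LowerSet (Finset (Fin m))) (θ : ∀ k n, U k n ⟶ V k n)
    (s : Fin m → S) (n : ℤ) : Submodule R ((charCx S K θ).X n) :=
  polySummand (I := fun _ => S) K (fun k t => charIncl (θ k) t.1) s n

/-- The summand `H_*^s(θ) = H_*^{s 0}(θ_0) ⊗ ⋯` of the character group of `θ`. -/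
def multiChar (θ : ∀ k n, U k n ⟶ V k n) (s : Fin m → XIdx) : Gr.{u} R :=
  multiGr fun k => charGroup (θ k) (s k)

/-- The summand `H^*_s(θ°) = H^*_{s 0}(θ_0°) ⊗ ⋯` of the character group of `θ°`. -/
def multiCochar (θ : ∀ k n, U k n ⟶ V k n) (s : Fin m → XIdx) : Gr.{u} R :=
  multiGr fun k => cocharGroup (θ k) (s k)

end Main

section Right

variable {U V : Gr.{u} R}

/-- The identification `H_*^𝒳(θ) = H_*^ℛ(θ) = U_*`: the summand `coker θ` is zero, and
`ker θ ⊕ im θ ≅ U_*` by an isomorphism that is the inclusion on `ker θ` and that identifies `im θ`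
with `coim θ`. -/
def CharIsSource (θ : ∀ n, U n ⟶ V n) : Prop :=
  ∀ n, Subsingleton (charGroup θ .coker n) ∧
    ∃ e : (LinearMap.ker (θ n).hom × LinearMap.range (θ n).hom) ≃ₗ[R] U n,
      (∀ x, e (x, 0) = x) ∧ ∀ x y, (θ n).hom (e (x, y)) = y

/-- The identification `H^*_𝒳(θ°) = H^*_ℛ(θ°) = U^*`: the summand `ker θ°` is zero, and
`U^* ≅ coker θ° ⊕ im θ°` by an isomorphism that has the projection to `coker θ°` as its first
component and that is the identity on `im θ°`. -/
def CocharIsSource (θ : ∀ n, U n ⟶ V n) : Prop :=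
  ∀ n, Subsingleton (cocharGroup θ .coker n) ∧
    ∃ e : Module.Dual R (U n) ≃ₗ[R]
        (Module.Dual R (U n) ⧸ LinearMap.range (θ n).hom.dualMap) ×
          LinearMap.range (θ n).hom.dualMap,
      (∀ f, (e f).1 = Submodule.Quotient.mk f) ∧
        ∀ y : LinearMap.range (θ n).hom.dualMap, e y = (0, y)

/-- A graded group that is zero below some degree and finitely generated in every degree. -/
def IsFiniteType (G : Gr.{u} R) : Prop :=
  (∀ n, Module.Finite R (G n)) ∧ ∃ b : ℤ, ∀ n < b, Subsingleton (G n)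

end Right

end PolyProd

end

/-! ### Submodules of free modules over a principal ideal domain -/

namespace PolyProd

/-! Every factor is first simplified separately, by a deformation that respects the pair of
complexes; the tensor product of these deformations then restricts to the polyhedral product.

For one factor `C ⊂ D`, the boundaries of `C` and of `D / C` are free, being submodules of free
modules over a principal ideal domain, and the kernel, image and cokernel of `θ` are free by
assumption. So all extensions relating chains, cycles, boundaries and homology split
(`exists_pieces`): `D` in degree `n` is the sum of `im θ`, `coker θ`, the boundaries of degree `n`,
and a copy of the boundaries of degree `n - 1`, which `d` carries onto the actual ones. The
boundaries split further into those of `C`, a copy of `ker θ`, and those of `D / C`. The two cones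
on the boundaries of `C` and of `D / C` contract without leaving `C`: the first lies in `C`, and the
second meets it only in zero. The cone on `ker θ` is acyclic too, but only its base lies in `C`, so
it cannot be contracted relative to `C` and must be kept. What remains is the character complex
(`IsSplitInclusion.nonempty_pairRetract`).

The usual telescoping homotopy on a tensor product (`tensor_homotopy`) is built from factors that
each preserve the subcomplexes, hence it preserves the polyhedral product
(`exists_polyCx_homotopyEquiv`). One composite is exactly the identity, which makes the equivalence
surjective.

In a product of character complexes, whether a summand lies over a simplex of `K` depends only on
which factors are outside the base, that is, on the cells `η`, `γ`, `β`, `α` and not on the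
coefficient groups. Both conditions defining the polyhedral product in a given degree cut out sums
of coordinate pieces (`polySub_inf_tensGr_eq_span`). Cells and coefficients can therefore be
separated, and with the Koszul sign of this reordering the differential becomes `d ⊗ 1`
(`tensD_mulTens`, `splitIso`).

Homology commutes with the tensor product because the coefficients are free, hence flat. For
cohomology, each total complex is finite free and bounded, so the dual of `T ⊗ H` is the tensor
product of the duals; the dual of `H` is torsion-free, hence flat. Under the finite type assumption,
the dual of a tensor product of character groups is compared with the tensor product of the dual
character groups by a choice of bases. -/

theorem free_submodule_finsupp {R : Type*} [CommRing R] [IsDomain R] [IsPrincipalIdealRing R]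
    {ι : Type*} (N : Submodule R (ι →₀ R)) : Module.Free R N := by
  classical
  let _ : LinearOrder ι := IsWellOrder.linearOrder WellOrderingRel
  have wf : WellFounded ((· < ·) : ι → ι → Prop) := IsWellFounded.wf (r := (WellOrderingRel : ι → ι → Prop))
  -- Leading coefficients with respect to a well-order: `L i` holds the elements of `N` without
  -- coordinates above `i`, and `A i` is the ideal of their `i`-th coordinates, generated by `a i`.
  -- A basis is formed by elements `e i` realizing the nonzero `a i`.
  let L : ι → Submodule R (ι →₀ R) := fun i =>
    N ⊓ ⨅ j, ⨅ _ : i < j, LinearMap.ker (Finsupp.lapply j : (ι →₀ R) →ₗ[R] R)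
  have mem_L : ∀ i x, x ∈ L i ↔ x ∈ N ∧ ∀ j, i < j → x j = 0 := fun i x => by
    simp [L, Submodule.mem_iInf]
  let A : ι → Submodule R R := fun i => (L i).map (Finsupp.lapply i)
  let a : ι → R := fun i => Submodule.IsPrincipal.generator (A i)
  have ha : ∀ i, ∃ x, x ∈ L i ∧ x i = a i := fun i =>
    Submodule.mem_map.1 (Submodule.IsPrincipal.generator_mem (A i))
  choose e he hea using ha
  let J := {i // a i ≠ 0}
  let v : J → N := fun i => ⟨e i.1, ((mem_L _ _).1 (he i.1)).1⟩
  have li : LinearIndependent R v := by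
    refine (injective_iff_map_eq_zero (Finsupp.linearCombination R v)).2 fun l hl => ?_
    by_contra hne
    have hs : l.support.Nonempty := Finsupp.support_nonempty_iff.2 hne
    obtain ⟨i, hi, hmax⟩ := l.support.exists_max_image (fun j : J => j.1) hs
    -- At the largest index of a relation only one basis vector has a nonzero coordinate, since the
    -- others involved have no coordinates above their own, smaller index.
    have h1 : ((Finsupp.linearCombination R v l : N) : ι →₀ R) i.1 = l i * a i.1 := by
      rw [Finsupp.linearCombination_apply, Finsupp.sum, Submodule.coe_sum, Finsupp.finsetSum_apply,
        Finset.sum_eq_single i]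
      · simp [v, hea]
      · intro j hj hji
        have hlt : j.1 < i.1 := lt_of_le_of_ne (hmax j hj) fun h => hji (Subtype.ext h)
        simp [v, ((mem_L _ _).1 (he j.1)).2 _ hlt]
      · intro h; exact absurd hi h
    rw [hl] at h1
    have h2 : l i * a i.1 = 0 := by simpa using h1.symm
    exact (mul_ne_zero (Finsupp.mem_support_iff.1 hi) i.2) h2
  have sp : ∀ i, ∀ x (hx : x ∈ N), (∀ j, i < j → x j = 0) →
      (⟨x, hx⟩ : N) ∈ Submodule.span R (Set.range v) := by
    intro i
    induction i using wf.induction with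
    | _ i ih =>
      intro x hx hxi
      -- An element without coordinates from `i` on is zero or has its largest support index below
      -- `i`, where the induction hypothesis applies. The general case is reduced to this one by
      -- subtracting a multiple of `e i`.
      have low : ∀ y (hy : y ∈ N), (∀ j, i ≤ j → y j = 0) →
          (⟨y, hy⟩ : N) ∈ Submodule.span R (Set.range v) := by
        intro y hyN hy
        rcases y.support.eq_empty_or_nonempty with h0 | h0
        · have : (⟨y, hyN⟩ : N) = 0 := Subtype.ext (Finsupp.support_eq_empty.1 h0)
          rw [this]; exact zero_mem _
        · have hm := Finset.max'_mem _ h0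
          refine ih (y.support.max' h0) ?_ _ _ fun j hj => ?_
          · by_contra hle
            exact Finsupp.mem_support_iff.1 hm (hy _ (not_lt.1 hle))
          · by_contra hne
            exact absurd (Finset.le_max' _ j (Finsupp.mem_support_iff.2 hne)) (not_le.2 hj)
      have hmem : x i ∈ A i := ⟨x, (mem_L _ _).2 ⟨hx, hxi⟩, rfl⟩
      obtain ⟨c, hc⟩ := (Submodule.IsPrincipal.mem_iff_eq_smul_generator (A i)).1 hmem
      have hc' : x i = c * a i := hc
      by_cases h0 : a i = 0
      · refine low x hx fun j hj => ?_
        rcases hj.eq_or_lt with rfl | h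
        · rw [hc', h0, mul_zero]
        · exact hxi j h
      · have hyN : x - c • e i ∈ N := sub_mem hx (N.smul_mem c ((mem_L _ _).1 (he i)).1)
        have h1 := low (x - c • e i) hyN fun j hj => by
          rcases hj.eq_or_lt with rfl | h
          · simp [hea, hc']
          · simp [hxi j h, ((mem_L _ _).1 (he i)).2 j h]
        have h2 := Submodule.smul_mem (Submodule.span R (Set.range v)) c
          (Submodule.subset_span ⟨⟨i, h0⟩, rfl⟩)
        convert add_mem h1 h2 using 1
        exact Subtype.ext (by simp [v])
  refine Module.Free.of_basis (Module.Basis.mk li fun (x : N) _ => ?_)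
  rcases (x : ι →₀ R).support.eq_empty_or_nonempty with h0 | h0
  · have : x = 0 := Subtype.ext (Finsupp.support_eq_empty.1 h0)
    rw [this]; exact zero_mem _
  · refine sp ((x : ι →₀ R).support.max' h0) x.1 x.2 fun j hj => ?_
    by_contra hne
    exact absurd (Finset.le_max' _ j (Finsupp.mem_support_iff.2 hne)) (not_le.2 hj)

/-- A submodule of a free module over a principal ideal domain is free. -/
theorem free_submodule {R : Type*} [CommRing R] [IsDomain R] [IsPrincipalIdealRing R]
    {M : Type*} [AddCommGroup M] [Module R M] [Module.Free R M] (N : Submodule R M) :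
    Module.Free R N := by
  let b := Module.Free.chooseBasis R M
  have := free_submodule_finsupp (N.map b.repr.toLinearMap)
  exact Module.Free.of_equiv (b.repr.submoduleMap N).symm

end PolyProd

noncomputable section

namespace PolyProd

variable {R : Type} [CommRing R]

/-! ### Homology classes of cycles -/

section Cls

variable {ι : Type*} {c : ComplexShape ι} (A : HomologicalComplex (ModuleCat.{u} R) c)

/-- The inclusion of the concrete kernel of the differential in the object of cycles. -/
def cycLift {j k : ι} (h : c.next j = k) :
    ModuleCat.of R (LinearMap.ker (A.d j k).hom) ⟶ A.cycles j :=
  A.liftCycles (ModuleCat.ofHom (LinearMap.ker (A.d j k).hom).subtype) k h (by ext x; exact x.2)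

/-- The homology class of a cycle. -/
def cls {j k : ι} (h : c.next j = k) : LinearMap.ker (A.d j k).hom →ₗ[R] A.homology j :=
  (cycLift A h ≫ A.homologyπ j).hom

variable {A}

lemma iCycles_cycLift {j k : ι} (h : c.next j = k) (z : LinearMap.ker (A.d j k).hom) :
    (A.iCycles j).hom ((cycLift A h).hom z) = z :=
  congrArg (fun g => g.hom z) (A.liftCycles_i (ModuleCat.ofHom
    (LinearMap.ker (A.d j k).hom).subtype) k h (by ext x; exact x.2))

lemma iCycles_injective (j : ι) : Function.Injective (A.iCycles j).hom :=
  (ModuleCat.mono_iff_injective (A.iCycles j)).1 inferInstance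

lemma cycLift_surjective {j k : ι} (h : c.next j = k) :
    Function.Surjective (cycLift A h).hom := by
  intro x
  have hx : (A.iCycles j ≫ A.d j k).hom x = 0 := by rw [A.iCycles_d]; rfl
  exact ⟨⟨(A.iCycles j).hom x, hx⟩, iCycles_injective j (iCycles_cycLift h _)⟩

lemma cls_surjective {j k : ι} (h : c.next j = k) : Function.Surjective (cls A h) :=
  ((ModuleCat.epi_iff_surjective (A.homologyπ j)).1 inferInstance).comp (cycLift_surjective h)

/-- Homology is the cokernel of the map from chains to cycles. With `cls_surjective`, this allows
all later arguments to use elements of the concrete kernel. -/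
lemma cls_eq_zero {i j k : ι} (h : c.next j = k) (h' : c.prev j = i)
    (z : LinearMap.ker (A.d j k).hom) : cls A h z = 0 ↔ ∃ y, (A.d i j).hom y = z := by
  have ex : (ShortComplex.mk (A.toCycles i j) (A.homologyπ j) (by simp)).Exact :=
    ShortComplex.exact_of_g_is_cokernel _ (A.homologyIsCokernel i j h')
  rw [ShortComplex.moduleCat_exact_iff] at ex
  have ht := fun y => congrArg (fun g => g.hom y) (A.toCycles_i i j)
  constructor
  · intro hz
    obtain ⟨y, hy⟩ := ex _ hz
    refine ⟨y, ?_⟩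
    rw [← ht y]
    exact (congrArg (A.iCycles j).hom hy).trans (iCycles_cycLift h z)
  · rintro ⟨y, hy⟩
    have : (cycLift A h).hom z = (A.toCycles i j).hom y :=
      iCycles_injective j ((iCycles_cycLift h z).trans (hy.symm.trans (ht y).symm))
    change (A.homologyπ j).hom ((cycLift A h).hom z) = 0
    rw [this]
    exact congrArg (fun g => g.hom y) (A.toCycles_comp_homologyπ i j)

lemma homologyMap_cls {A' : HomologicalComplex (ModuleCat.{u} R) c} (f : A ⟶ A') {j k : ι}
    (h : c.next j = k) (z : LinearMap.ker (A.d j k).hom)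
    (z' : LinearMap.ker (A'.d j k).hom) (hz : (f.f j).hom z = z') :
    (HomologicalComplex.homologyMap f j).hom (cls A h z) = cls A' h z' := by
  refine (congrArg (fun g => g.hom ((cycLift A h).hom z))
    (HomologicalComplex.homologyπ_naturality f j)).trans
      (congrArg (A'.homologyπ j).hom (iCycles_injective j ?_))
  refine (congrArg (fun g => g.hom ((cycLift A h).hom z))
    (HomologicalComplex.cyclesMap_i f j)).trans ?_
  exact (congrArg (f.f j).hom (iCycles_cycLift h z)).trans (hz.trans (iCycles_cycLift h z').symm)

end Cls

end PolyProd

end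

noncomputable section

namespace PolyProd

variable {R : Type} [CommRing R]

/-! ### Splitting a split inclusion of complexes -/

/-- Projectivity applied to the surjection of `M` onto the range of `g`, so that `g` itself need not
be surjective. Every splitting of a split inclusion below is chosen in this way. -/
lemma exists_lift_of_range_le {P N M : Type*} [AddCommGroup P] [AddCommGroup N] [AddCommGroup M]
    [Module R P] [Module R N] [Module R M] [Module.Projective R P] (f : P →ₗ[R] N) (g : M →ₗ[R] N)
    (h : ∀ x, ∃ y, g y = f x) : ∃ s : P →ₗ[R] M, ∀ x, g (s x) = f x := by
  obtain ⟨s, hs⟩ := Module.projective_lifting_property g.rangeRestrict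
    (f.codRestrict (LinearMap.range g) h) g.surjective_rangeRestrict
  exact ⟨s, fun x => congrArg Subtype.val (LinearMap.congr_fun hs x)⟩

lemma down_next {n k : ℤ} (h : k + 1 = n) : (ComplexShape.down ℤ).next n = k :=
  (ComplexShape.down ℤ).next_eq' h

lemma down_prev {n k : ℤ} (h : n + 1 = k) : (ComplexShape.down ℤ).prev n = k :=
  (ComplexShape.down ℤ).prev_eq' h

lemma d_d_apply (A : Cx.{u} R) (i j k : ℤ) (x : A.X i) : (A.d j k).hom ((A.d i j).hom x) = 0 :=
  congrArg (fun g => g.hom x) (A.d_comp_d i j k)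

lemma hom_comm_apply {A A' : Cx.{u} R} (f : A ⟶ A') (i j : ℤ) (x : A.X i) :
    (A'.d i j).hom ((f.f i).hom x) = (f.f j).hom ((A.d i j).hom x) :=
  congrArg (fun g => g.hom x) (f.comm i j)

section Split

variable {C D : Cx.{u} R} (ϑ : C ⟶ D)

/-- The boundaries of degree `n` of a complex. -/
abbrev bdry (A : Cx.{u} R) (n : ℤ) : Submodule R (A.X n) := LinearMap.range (A.d (n + 1) n).hom

/-- The boundaries of degree `n` of the quotient of `D` by the image of `C`. -/
abbrev quotBdry (n : ℤ) : Submodule R (D.X n ⧸ LinearMap.range (ϑ.f n).hom) :=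
  (bdry D n).map (Submodule.mkQ _)

/-- The pieces of the boundaries of degree `n` of `D`. -/
abbrev BdryPieces (n : ℤ) : Type u :=
  bdry C n × LinearMap.ker (homologyHom ϑ n).hom × quotBdry ϑ n

/-- The homology class of a cycle in a chain complex. -/
abbrev ccls (A : Cx.{u} R) (n : ℤ) : LinearMap.ker (A.d n (n - 1)).hom →ₗ[R] homologyGr A n :=
  cls A (down_next (by omega))

lemma ccls_surjective (A : Cx.{u} R) (n : ℤ) : Function.Surjective (ccls A n) :=
  cls_surjective _

lemma ccls_eq_zero (A : Cx.{u} R) (n : ℤ) (z : LinearMap.ker (A.d n (n - 1)).hom) :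
    ccls A n z = 0 ↔ ∃ y, (A.d (n + 1) n).hom y = z :=
  cls_eq_zero _ (down_prev rfl) z

/-- The action of a chain homomorphism on cycles. -/
def cycHom (n : ℤ) : LinearMap.ker (C.d n (n - 1)).hom →ₗ[R] LinearMap.ker (D.d n (n - 1)).hom :=
  (ϑ.f n).hom.restrict fun z hz => by
    rw [LinearMap.mem_ker, hom_comm_apply, LinearMap.mem_ker.1 hz, map_zero]

lemma homologyHom_ccls (n : ℤ) (z : LinearMap.ker (C.d n (n - 1)).hom) :
    (homologyHom ϑ n).hom (ccls C n z) = ccls D n (cycHom ϑ n z) :=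
  homologyMap_cls ϑ _ z _ rfl

variable {ϑ} (inj : ∀ n, Function.Injective (ϑ.f n).hom)
include inj

/-- The boundaries of `D` are filtered by the boundaries of `C` and by the boundaries of `D` that
lie in `C`. A boundary of `D` lying in `C` is a cycle of `C` whose class dies in `D`, so the middle
quotient is `ker θ`; the top quotient is the module of boundaries of `D / C`. Both are free, so the
filtration splits through `ζ` and `μ`. -/
lemma exists_bdrySplitting (n : ℤ) [Module.Free R (LinearMap.ker (homologyHom ϑ n).hom)]
    [Module.Free R (quotBdry ϑ n)] :
    ∃ (δ : BdryPieces ϑ n →ₗ[R] D.X n)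
      (ζ : LinearMap.ker (homologyHom ϑ n).hom →ₗ[R] LinearMap.ker (C.d n (n - 1)).hom),
      (∀ k, ccls C n (ζ k) = k) ∧ (∀ k, δ (0, k, 0) = (ϑ.f n).hom (ζ k)) ∧
      (∀ x, δ (x, 0, 0) = (ϑ.f n).hom x) ∧ (∀ q, ∃ y, (D.d (n + 1) n).hom y = δ q) ∧
      Function.Injective δ ∧ ∀ y, ∃ q, δ q = (D.d (n + 1) n).hom y := by
  obtain ⟨ζ, hζ⟩ := exists_lift_of_range_le
    (LinearMap.ker (homologyHom ϑ n).hom).subtype (ccls C n) fun k => ccls_surjective C n k.1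
  obtain ⟨μ, hμ⟩ := exists_lift_of_range_le (quotBdry ϑ n).subtype
    ((Submodule.mkQ (LinearMap.range (ϑ.f n).hom)) ∘ₗ (bdry D n).subtype) fun x => by
      obtain ⟨y, hy, e⟩ := x.2
      exact ⟨⟨y, hy⟩, e⟩
  have hζb : ∀ k, ∃ y, (D.d (n + 1) n).hom y = (ϑ.f n).hom (ζ k) := fun k =>
    (ccls_eq_zero D n (cycHom ϑ n (ζ k))).1 (by rw [← homologyHom_ccls, hζ]; exact k.2)
  let δ : BdryPieces ϑ n →ₗ[R] D.X n :=
    LinearMap.coprod ((ϑ.f n).hom ∘ₗ (bdry C n).subtype)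
      (LinearMap.coprod ((ϑ.f n).hom ∘ₗ (LinearMap.ker (C.d n (n - 1)).hom).subtype ∘ₗ ζ)
        ((bdry D n).subtype ∘ₗ μ))
  have hδ : ∀ x k m, δ (x, k, m) = (ϑ.f n).hom x + ((ϑ.f n).hom (ζ k) + μ m) := fun x k m => rfl
  refine ⟨δ, ζ, hζ, fun k => by simp [hδ], fun x => by simp [hδ], ?_, ?_, ?_⟩
  · rintro ⟨⟨x, w, rfl⟩, k, m⟩
    obtain ⟨y, hy⟩ := hζb k
    obtain ⟨y', hy'⟩ := (μ m).2
    refine ⟨(ϑ.f (n + 1)).hom w + (y + y'), ?_⟩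
    rw [map_add, map_add, hom_comm_apply, hy, hy', hδ]
  · refine (injective_iff_map_eq_zero _).2 ?_
    rintro ⟨⟨x, w, rfl⟩, k, m⟩ h
    rw [hδ] at h
    have hm : m = 0 := by
      apply Subtype.ext
      have := congrArg (Submodule.mkQ (LinearMap.range (ϑ.f n).hom)) h
      rw [← add_assoc, ← map_add, map_add, map_zero] at this
      rw [show (Submodule.mkQ (LinearMap.range (ϑ.f n).hom))
        ((ϑ.f n).hom ((C.d (n + 1) n).hom w + ζ k)) = 0 from
          (Submodule.Quotient.mk_eq_zero _).2 ⟨_, rfl⟩, zero_add] at this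
      exact (hμ m).symm.trans this
    subst hm
    rw [map_zero, ZeroMemClass.coe_zero, add_zero, ← map_add] at h
    have h1 := inj n (h.trans (map_zero _).symm)
    have hk : k = 0 := by
      apply Subtype.ext
      refine (hζ k).symm.trans ((ccls_eq_zero C n (ζ k)).2 ⟨-w, ?_⟩)
      rw [map_neg]
      exact neg_eq_of_add_eq_zero_right h1
    subst hk
    simp only [map_zero, ZeroMemClass.coe_zero, add_zero] at h1
    exact Prod.ext (Subtype.ext h1) rfl
  · intro y
    -- A boundary is stripped in three stages: its class in `D / C` gives `m`; the rest is a cycle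
    -- `z` of `C`, by injectivity of `ϑ`, and its homology class gives `k`; what is left bounds in
    -- `C`.
    let m : quotBdry ϑ n := ⟨_, Submodule.mem_map_of_mem ⟨y, rfl⟩⟩
    have hm : (Submodule.mkQ (LinearMap.range (ϑ.f n).hom)) ((D.d (n + 1) n).hom y - μ m) = 0 := by
      rw [map_sub, sub_eq_zero]; exact (hμ m).symm
    obtain ⟨z, hz⟩ := (Submodule.Quotient.mk_eq_zero _).1 hm
    obtain ⟨y', hy'⟩ := (μ m).2
    have hzc : z ∈ LinearMap.ker (C.d n (n - 1)).hom := by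
      apply inj
      rw [← hom_comm_apply, hz, ← hy', ← map_sub, d_d_apply, map_zero]
    let k : LinearMap.ker (homologyHom ϑ n).hom := ⟨ccls C n ⟨z, hzc⟩, by
      rw [LinearMap.mem_ker, homologyHom_ccls, ccls_eq_zero]
      exact ⟨y - y', by rw [map_sub, hy']; exact hz.symm⟩⟩
    obtain ⟨w, hw⟩ := (ccls_eq_zero C n (⟨z, hzc⟩ - ζ k)).1 (by rw [map_sub, hζ]; exact sub_self _)
    refine ⟨(⟨_, w, rfl⟩, k, m), ?_⟩
    rw [hδ]
    simp only [hw, AddSubgroupClass.coe_sub, map_sub, hz]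
    abel

omit inj in
lemma exists_bdryLift {n j : ℤ} (hj : n + 1 = j) [Module.Free R (BdryPieces ϑ n)]
    [Module.Free R (bdry C n)] [Module.Free R (LinearMap.ker (homologyHom ϑ n).hom)]
    [Module.Free R (quotBdry ϑ n)] (δ : BdryPieces ϑ n →ₗ[R] D.X n)
    (h1 : ∀ x, δ (x, 0, 0) = (ϑ.f n).hom x) (h2 : ∀ q, ∃ y, (D.d (n + 1) n).hom y = δ q) :
    ∃ σ : BdryPieces ϑ n →ₗ[R] D.X j, (∀ q, (D.d j n).hom (σ q) = δ q) ∧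
      ∀ x, ∃ y, σ (x, 0, 0) = (ϑ.f j).hom y ∧ (C.d j n).hom y = x := by
  subst hj
  obtain ⟨b, hb⟩ := exists_lift_of_range_le (bdry C n).subtype (C.d (n + 1) n).hom fun x => x.2
  obtain ⟨l, hl⟩ := exists_lift_of_range_le
    (δ ∘ₗ LinearMap.inr R (bdry C n) (LinearMap.ker (homologyHom ϑ n).hom × quotBdry ϑ n))
    (D.d (n + 1) n).hom fun x => h2 _
  refine ⟨LinearMap.coprod ((ϑ.f (n + 1)).hom ∘ₗ b) l, ?_, fun x => ⟨b x, ?_, hb x⟩⟩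
  · rintro ⟨x, y⟩
    have hxy : ((x, y) : BdryPieces ϑ n) = (x, 0, 0) + (0, y) := by ext <;> simp
    rw [LinearMap.coprod_apply, map_add, hl, LinearMap.comp_apply, hom_comm_apply, hb]
    conv_rhs => rw [hxy, map_add, h1]
    rfl
  · exact (congrArg _ (map_zero l)).trans (add_zero _)

/-- The pieces of the degree `n` part of `D`. -/
abbrev Pieces (ϑ : C ⟶ D) (n : ℤ) : Type u :=
  BdryPieces ϑ n × LinearMap.range (homologyHom ϑ n).hom ×
    (homologyGr D n ⧸ LinearMap.range (homologyHom ϑ n).hom) × BdryPieces ϑ (n - 1)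

/-- The map `d` from `D` onto its boundaries splits, and so does the passage from cycles to homology
with its quotient `coker θ`. The classes in `im θ` are represented by cycles of `C`. Hence `C`
consists of its boundaries, the kernel and image pieces, and the chosen chains that bound its
boundaries. -/
theorem exists_pieces
    (h0 : ∀ n, Module.Free R (bdry C n)) (h1 : ∀ n, Module.Free R (quotBdry ϑ n))
    (h2 : ∀ n, Module.Free R (LinearMap.ker (homologyHom ϑ n).hom))
    (h3 : ∀ n, Module.Free R (LinearMap.range (homologyHom ϑ n).hom))
    (h4 : ∀ n, Module.Free R (homologyGr D n ⧸ LinearMap.range (homologyHom ϑ n).hom)) :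
    ∃ E : ∀ n, Pieces ϑ n ≃ₗ[R] D.X n,
      (∀ n x, (D.d n (n - 1)).hom (E n x) = E (n - 1) (x.2.2.2, 0, 0, 0)) ∧
      (∀ n z, ∃ a k i a', (ϑ.f n).hom z = E n ((a, k, 0), i, 0, (a', 0, 0))) ∧
      ∀ n a k i a', ∃ z, E n ((a, k, 0), i, 0, (a', 0, 0)) = (ϑ.f n).hom z := by
  choose δ ζ hζ hδK hδa hδb hδi hδs using fun n => exists_bdrySplitting inj n
  choose σ hσ hσa using fun n =>
    exists_bdryLift (show n - 1 + 1 = n by omega) (δ (n - 1)) (hδa (n - 1)) (hδb (n - 1))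
  choose ι hι using fun n => exists_lift_of_range_le
    (LinearMap.range (homologyHom ϑ n).hom).subtype ((homologyHom ϑ n).hom ∘ₗ ccls C n) fun y => by
      obtain ⟨_, u, rfl⟩ := y
      obtain ⟨z, rfl⟩ := ccls_surjective C n u
      exact ⟨z, rfl⟩
  choose t ht using fun n => exists_lift_of_range_le
    (LinearMap.id (R := R) (M := homologyGr D n ⧸ LinearMap.range (homologyHom ϑ n).hom))
    (Submodule.mkQ (LinearMap.range (homologyHom ϑ n).hom) ∘ₗ ccls D n)
    ((Submodule.mkQ_surjective _).comp (ccls_surjective D n))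
  let F : ∀ n, Pieces ϑ n →ₗ[R] D.X n := fun n =>
    LinearMap.coprod (δ n) (LinearMap.coprod
      ((LinearMap.ker (D.d n (n - 1)).hom).subtype ∘ₗ cycHom ϑ n ∘ₗ ι n)
      (LinearMap.coprod ((LinearMap.ker (D.d n (n - 1)).hom).subtype ∘ₗ t n) (σ n)))
  have hF : ∀ n q i c q', F n (q, i, c, q') =
      δ n q + (cycHom ϑ n (ι n i) + (t n c + σ n q')) := fun n q i c q' => rfl
  have hδz : ∀ n q, δ n q ∈ LinearMap.ker (D.d n (n - 1)).hom := fun n q => by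
    obtain ⟨y, hy⟩ := hδb n q
    rw [← hy]; exact d_d_apply ..
  have hdF : ∀ n x, (D.d n (n - 1)).hom (F n x) = δ (n - 1) x.2.2.2 := by
    rintro n ⟨q, i, c, q'⟩
    rw [hF, map_add, map_add, map_add, hσ, LinearMap.mem_ker.1 (hδz n q),
      LinearMap.mem_ker.1 (cycHom ϑ n (ι n i)).2, LinearMap.mem_ker.1 (t n c).2]
    simp
  have hinj : ∀ n, Function.Injective (F n) := fun n => by
    refine (injective_iff_map_eq_zero _).2 ?_
    rintro ⟨q, i, c, q'⟩ h
    -- The components are recovered in turn: `q'` by the differential, `c` by the homology class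
    -- modulo `im θ`, `i` by the class itself, and finally `q` because `δ` is injective.
    -- Surjectivity subtracts them in the same order.
    have hq' : q' = 0 := by
      apply hδi (n - 1)
      have := hdF n (q, i, c, q')
      rw [h, map_zero] at this
      rw [map_zero]; exact this.symm
    subst hq'
    obtain ⟨y, hy⟩ := hδb n q
    have hs : ccls D n ⟨δ n q, hδz n q⟩ + (ccls D n (cycHom ϑ n (ι n i)) + ccls D n (t n c)) =
        0 := by
      rw [← map_add, ← map_add]
      convert map_zero (ccls D n) using 2
      apply Subtype.ext
      have := h
      rw [hF, map_zero, add_zero] at this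
      exact this
    rw [(ccls_eq_zero D n _).2 ⟨y, hy⟩, zero_add, ← homologyHom_ccls] at hs
    have hc : c = 0 := by
      have := congrArg (Submodule.mkQ (LinearMap.range (homologyHom ϑ n).hom)) hs
      rw [map_add, map_zero, show Submodule.mkQ (LinearMap.range (homologyHom ϑ n).hom)
        ((homologyHom ϑ n).hom (ccls C n (ι n i))) = 0 from
          (Submodule.Quotient.mk_eq_zero _).2 ⟨_, rfl⟩, zero_add] at this
      exact (ht n c).symm.trans this
    subst hc
    rw [map_zero, map_zero, add_zero] at hs
    have hi : i = 0 := Subtype.ext ((hι n i).symm.trans hs)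
    subst hi
    have hq : q = 0 := by
      apply hδi n
      have := h
      rw [hF] at this
      simpa using this
    subst hq
    rfl
  have hsurj : ∀ n, Function.Surjective (F n) := fun n x => by
    obtain ⟨q', hq'⟩ : ∃ q', δ (n - 1) q' = (D.d n (n - 1)).hom x := by
      -- The boundaries of degree `n - 1` come from degree `n - 1 + 1`, which is only
      -- propositionally `n`; generalizing the source degree avoids a cast.
      have key : ∀ j (h : n - 1 + 1 = j) (y : D.X j), ∃ q', δ (n - 1) q' = (D.d j (n - 1)).hom y := by
        rintro _ rfl y; exact hδs (n - 1) y
      exact key n (by omega) x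
    have hz : x - σ n q' ∈ LinearMap.ker (D.d n (n - 1)).hom := by
      rw [LinearMap.mem_ker, map_sub, hσ, hq', sub_self]
    let v := ccls D n ⟨_, hz⟩
    let c := Submodule.mkQ (LinearMap.range (homologyHom ϑ n).hom) v
    have hi : v - ccls D n (t n c) ∈ LinearMap.range (homologyHom ϑ n).hom := by
      rw [← Submodule.Quotient.mk_eq_zero]
      change Submodule.mkQ _ _ = 0
      rw [map_sub, sub_eq_zero]
      exact (ht n c).symm
    obtain ⟨y, hy⟩ := (ccls_eq_zero D n (⟨_, hz⟩ - t n c - cycHom ϑ n (ι n ⟨_, hi⟩))).1 (by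
      rw [map_sub, map_sub, ← homologyHom_ccls, sub_eq_zero]
      exact (hι n ⟨_, hi⟩).symm)
    obtain ⟨q, hq⟩ := hδs n y
    refine ⟨(q, ⟨_, hi⟩, c, q'), ?_⟩
    rw [hF, hq, hy]
    simp only [AddSubgroupClass.coe_sub]
    abel
  refine ⟨fun n => LinearEquiv.ofBijective (F n) ⟨hinj n, hsurj n⟩, fun n x => ?_, fun n z => ?_,
    fun n a k i a' => ?_⟩
  · refine (hdF n x).trans ?_
    change _ = F (n - 1) _
    rw [hF]
    simp
  · have key : ∀ j (h : n - 1 + 1 = j) (y : C.X j),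
        (C.d j (n - 1)).hom y ∈ bdry C (n - 1) := by
      rintro _ rfl y; exact ⟨y, rfl⟩
    let a' : bdry C (n - 1) := ⟨_, key n (by omega) z⟩
    -- For a chain of `C`, the chain with the same boundary is also taken in `C`, so the difference
    -- is a cycle of `C`. Its class differs from that of the representative of its image by an
    -- element of `ker θ`, which is `k`.
    obtain ⟨y, hy, hya⟩ := hσa n a'
    have hz : z - y ∈ LinearMap.ker (C.d n (n - 1)).hom := by
      rw [LinearMap.mem_ker, map_sub, hya, sub_self]
    let w := ccls C n ⟨_, hz⟩
    let i : LinearMap.range (homologyHom ϑ n).hom := ⟨(homologyHom ϑ n).hom w, w, rfl⟩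
    let k : LinearMap.ker (homologyHom ϑ n).hom := ⟨w - ccls C n (ι n i), by
      rw [LinearMap.mem_ker, map_sub, sub_eq_zero]
      exact (hι n i).symm⟩
    obtain ⟨b, hb⟩ : ∃ b : bdry C n, (b : C.X n) = (⟨_, hz⟩ - ι n i - ζ n k :
        LinearMap.ker (C.d n (n - 1)).hom) := by
      obtain ⟨b, hb⟩ := (ccls_eq_zero C n (⟨_, hz⟩ - ι n i - ζ n k)).1 (by
        rw [map_sub, map_sub, hζ, sub_eq_zero])
      exact ⟨⟨_, b, rfl⟩, hb⟩
    refine ⟨b, k, i, a', ?_⟩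
    change _ = F n _
    rw [hF, hy, map_zero, ZeroMemClass.coe_zero, zero_add,
      show ((b, k, 0) : BdryPieces ϑ n) = (b, 0, 0) + (0, k, 0) by ext <;> simp, map_add, hδK, hδa]
    change _ = (ϑ.f n).hom _ + (ϑ.f n).hom _ + ((ϑ.f n).hom _ + (ϑ.f n).hom _)
    rw [← map_add, ← map_add, ← map_add, hb]
    congr 1
    simp only [AddSubgroupClass.coe_sub, Submodule.subtype_apply]
    abel
  · obtain ⟨y, hy, -⟩ := hσa n a'
    refine ⟨a + ζ n k + (ι n i + y), ?_⟩
    change F n _ = _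
    rw [hF, hy, map_zero, ZeroMemClass.coe_zero, zero_add,
      show ((a, k, 0) : BdryPieces ϑ n) = (a, 0, 0) + (0, k, 0) by ext <;> simp, map_add, hδK, hδa,
      map_add, map_add, map_add]
    rfl

end Split

end PolyProd

end

/-! ### Deformation of a pair onto its character complex -/

noncomputable section

namespace PolyProd

variable {R : Type} [CommRing R]

section Builders

variable {D : Cx.{u} R} {G : Gr.{u} R}

lemma coneCx_d_apply (n : ℤ) (x : (coneCx G).X n) :
    ((coneCx G).d n (n - 1)).hom x = ((x.2, 0) : G (n - 1) × G (n - 1 - 1)) := by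
  have h : n - 1 + 1 = n := by omega
  simp [coneCx, h]
  rfl

/-- A chain homomorphism to a complex with trivial differential. -/
def toTriv (g : ∀ n, D.X n →ₗ[R] G n) (hg : ∀ n x, g (n - 1) ((D.d n (n - 1)).hom x) = 0) :
    D ⟶ trivCx G where
  f n := ModuleCat.ofHom (g n)
  comm' i j h := by
    obtain rfl : j = i - 1 := by have : j + 1 = i := h; omega
    ext x
    exact (hg i x).symm

/-- A chain homomorphism from a complex with trivial differential. -/
def ofTriv (g : ∀ n, G n →ₗ[R] D.X n) (hg : ∀ n x, (D.d n (n - 1)).hom (g n x) = 0) :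
    trivCx G ⟶ D where
  f n := ModuleCat.ofHom (g n)
  comm' i j h := by
    obtain rfl : j = i - 1 := by have : j + 1 = i := h; omega
    ext x
    exact (hg i x).trans (map_zero (g (i - 1))).symm

/-- A homomorphism of graded groups as a chain homomorphism to the cone. -/
def toCone (g : ∀ n, D.X n →ₗ[R] G n) : D ⟶ coneCx G where
  -- The component in the suspended summand is forced: the differential of the cone moves it to the
  -- unsuspended summand, where it must agree with `g` of the boundary.
  f n := ModuleCat.ofHom ((g n).prod (g (n - 1) ∘ₗ (D.d n (n - 1)).hom))
  comm' i j h := by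
    obtain rfl : j = i - 1 := by have : j + 1 = i := h; omega
    ext x
    refine (coneCx_d_apply (G := G) i _).trans ?_
    refine Prod.ext rfl ?_
    change 0 = g _ ((D.d _ _).hom ((D.d _ _).hom x))
    rw [d_d_apply, map_zero]

/-- A chain homomorphism from the cone. -/
def ofCone (g : ∀ n, G n →ₗ[R] D.X n) (g' : ∀ n, G (n - 1) →ₗ[R] D.X n)
    (h : ∀ n x, (D.d n (n - 1)).hom (g n x) = 0)
    (h' : ∀ n x, (D.d n (n - 1)).hom (g' n x) = g (n - 1) x) : coneCx G ⟶ D where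
  f n := ModuleCat.ofHom ((g n).coprod (g' n))
  comm' i j hij := by
    obtain rfl : j = i - 1 := by have : j + 1 = i := hij; omega
    apply ModuleCat.hom_ext
    refine LinearMap.ext fun x => ?_
    change (D.d i (i - 1)).hom (g i x.1 + g' i x.2) =
      (g (i - 1)).coprod (g' (i - 1)) (((coneCx G).d i (i - 1)).hom x)
    rw [coneCx_d_apply, map_add, h, h', LinearMap.coprod_apply, map_zero]
    exact (zero_add _).trans (add_zero _).symm

end Builders

/-- The data of a deformation of `D` to the sum of the complexes `X s`, with sections, relative to
the subcomplexes `C` and `B s`. -/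
structure PairRetract {C D : Cx.{u} R} (ϑ : C ⟶ D) {I : Type} [Fintype I] {B X : I → Cx.{u} R}
    (f : ∀ s, B s ⟶ X s) where
  φ : ∀ s, D ⟶ X s
  ψ : ∀ s, X s ⟶ D
  h : ∀ i j, D.X i →ₗ[R] D.X j
  ψφ_self : ∀ s n x, ((φ s).f n).hom (((ψ s).f n).hom x) = x
  ψφ_ne : ∀ s t n x, s ≠ t → ((φ t).f n).hom (((ψ s).f n).hom x) = 0
  homotopy : ∀ n x, (D.d (n + 1) n).hom (h n (n + 1) x) + h (n - 1) n ((D.d n (n - 1)).hom x) =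
    x - ∑ s, ((ψ s).f n).hom (((φ s).f n).hom x)
  φ_mem : ∀ s n z, ∃ y, ((φ s).f n).hom ((ϑ.f n).hom z) = ((f s).f n).hom y
  ψ_mem : ∀ s n y, ∃ z, ((ψ s).f n).hom (((f s).f n).hom y) = (ϑ.f n).hom z
  h_mem : ∀ i j z, ∃ z', h i j ((ϑ.f i).hom z) = (ϑ.f j).hom z'

instance : Fintype XIdx := ⟨{.im, .ker, .coker}, fun s => by cases s <;> simp⟩

lemma XIdx.sum_eq {M : Type*} [AddCommMonoid M] (g : XIdx → M) :
    ∑ s, g s = g .im + (g .ker + g .coker) := by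
  change ∑ s ∈ {XIdx.im, XIdx.ker, XIdx.coker}, g s = _
  simp

section Retract

/-- Boundary pieces, with `G .ker` in the middle. -/
abbrev BPc (A M : Gr.{u} R) (G : XIdx → Gr.{u} R) (n : ℤ) : Type u := A n × G .ker n × M n

/-- The pieces of one degree of a complex that deforms to the complexes `modelCx G s`. -/
abbrev Pc (A M : Gr.{u} R) (G : XIdx → Gr.{u} R) (n : ℤ) : Type u :=
  BPc A M G n × G .im n × G .coker n × BPc A M G (n - 1)

variable {C D : Cx.{u} R} {ϑ : C ⟶ D} {A M : Gr.{u} R} {G : XIdx → Gr.{u} R}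
    (E : ∀ n, Pc A M G n ≃ₗ[R] D.X n)
    (hd : ∀ n x, (D.d n (n - 1)).hom (E n x) = E (n - 1) (x.2.2.2, 0, 0, 0))

/-- The homomorphism that discards the kernel part of the boundary pieces. -/
def dropKer (A M : Gr.{u} R) (G : XIdx → Gr.{u} R) (n : ℤ) : BPc A M G n →ₗ[R] BPc A M G n :=
  LinearMap.prodMap LinearMap.id (LinearMap.prodMap 0 LinearMap.id)

/-- The contraction in one degree. -/
def contr (j : ℤ) : D.X (j - 1) →ₗ[R] D.X j :=
  (E j).toLinearMap ∘ₗ LinearMap.inr R _ _ ∘ₗ LinearMap.inr R _ _ ∘ₗ LinearMap.inr R _ _ ∘ₗ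
    dropKer A M G (j - 1) ∘ₗ LinearMap.fst R _ _ ∘ₗ (E (j - 1)).symm.toLinearMap

lemma contr_apply (j : ℤ) (x : Pc A M G (j - 1)) :
    contr E j (E (j - 1) x) = E j (0, 0, 0, (x.1.1, 0, x.1.2.2)) := by
  simp [contr, dropKer]

include hd in
lemma E_symm_d (n : ℤ) (x : D.X n) :
    (E (n - 1)).symm ((D.d n (n - 1)).hom x) = (((E n).symm x).2.2.2, 0, 0, 0) := by
  rw [LinearEquiv.symm_apply_eq, ← hd, LinearEquiv.apply_symm_apply]

/-- The contraction as a family indexed by pairs of degrees. -/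
def contrFam (i j : ℤ) : D.X i →ₗ[R] D.X j := if e : i = j - 1 then e ▸ contr E j else 0

lemma contrFam_eq (j : ℤ) : contrFam E (j - 1) j = contr E j := dif_pos rfl

/-- The projection to the summand of index `im`. -/
def prIm (n : ℤ) : D.X n →ₗ[R] G .im n :=
  LinearMap.fst R _ _ ∘ₗ LinearMap.snd R _ _ ∘ₗ (E n).symm.toLinearMap

/-- The projection to the summand of index `coker`. -/
def prCoker (n : ℤ) : D.X n →ₗ[R] G .coker n :=
  LinearMap.fst R _ _ ∘ₗ LinearMap.snd R _ _ ∘ₗ LinearMap.snd R _ _ ∘ₗ (E n).symm.toLinearMap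

/-- The projection to the summand of index `ker`. -/
def prKer (n : ℤ) : D.X n →ₗ[R] G .ker n :=
  LinearMap.fst R _ _ ∘ₗ LinearMap.snd R _ _ ∘ₗ LinearMap.fst R _ _ ∘ₗ (E n).symm.toLinearMap

/-- The section on the summand of index `im`. -/
def inIm (n : ℤ) : G .im n →ₗ[R] D.X n :=
  (E n).toLinearMap ∘ₗ LinearMap.inr R _ _ ∘ₗ LinearMap.inl R _ _

/-- The section on the summand of index `coker`. -/
def inCoker (n : ℤ) : (G .coker n) →ₗ[R] D.X n :=
  (E n).toLinearMap ∘ₗ LinearMap.inr R _ _ ∘ₗ LinearMap.inr R _ _ ∘ₗ LinearMap.inl R _ _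

/-- The section on the summand of index `ker`. -/
def inKer (n : ℤ) : G .ker n →ₗ[R] D.X n :=
  (E n).toLinearMap ∘ₗ LinearMap.inl R _ _ ∘ₗ LinearMap.inr R _ _ ∘ₗ LinearMap.inl R _ _

/-- The section on the suspended summand of index `ker`. -/
def inSuspKer (n : ℤ) : G .ker (n - 1) →ₗ[R] D.X n :=
  (E n).toLinearMap ∘ₗ LinearMap.inr R _ _ ∘ₗ LinearMap.inr R _ _ ∘ₗ
    LinearMap.inr R _ _ ∘ₗ LinearMap.inr R _ _ ∘ₗ LinearMap.inl R _ _

lemma prIm_apply (n : ℤ) (x : Pc A M G n) : prIm E n (E n x) = x.2.1 := by simp [prIm]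

lemma prCoker_apply (n : ℤ) (x : Pc A M G n) : prCoker E n (E n x) = x.2.2.1 := by simp [prCoker]

lemma prKer_apply (n : ℤ) (x : Pc A M G n) : prKer E n (E n x) = x.1.2.1 := by simp [prKer]

lemma inKer_apply (n : ℤ) (x) : inKer E n x = E n ((0, x, 0), 0, 0, 0) := rfl

lemma inSuspKer_apply (n : ℤ) (x) : inSuspKer E n x = E n (0, 0, 0, (0, x, 0)) := rfl

include hd

/-- The contraction sends a boundary piece to the chain that bounds it, except for the kernel
pieces. Thus `d h + h d` is the projection onto the cones on `A` and `M`, the part to be discarded.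
-/
lemma contrFam_homotopy (n : ℤ) (x : Pc A M G n) :
    (D.d (n + 1) n).hom (contrFam E n (n + 1) (E n x)) +
      contrFam E (n - 1) n ((D.d n (n - 1)).hom (E n x)) =
    E n ((x.1.1, 0, x.1.2.2), 0, 0, (x.2.2.2.1, 0, x.2.2.2.2.2)) := by
  have key : ∀ p n (_ : p - 1 = n) (x : Pc A M G n),
      (D.d p n).hom (contrFam E n p (E n x)) = E n ((x.1.1, 0, x.1.2.2), 0, 0, 0) := by
    rintro p _ rfl x
    rw [contrFam_eq, contr_apply, hd]
  rw [key (n + 1) n (by omega), hd, contrFam_eq, contr_apply, ← map_add]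
  congr 1
  ext <;> simp

omit hd in
lemma E_sub_summands (n : ℤ) (x : Pc A M G n) :
    E n ((x.1.1, 0, x.1.2.2), 0, 0, (x.2.2.2.1, 0, x.2.2.2.2.2)) =
      E n x - (E n (0, x.2.1, 0, 0) + (E n ((0, x.1.2.1, 0), 0, 0, (0, x.2.2.2.2.1, 0)) +
        E n (0, 0, x.2.2.1, 0))) := by
  rw [← map_add, ← map_add, ← map_sub]
  congr 1
  ext <;> simp

/-- The projection to a summand of the model complex. -/
def toChar : ∀ s, D ⟶ modelCx G s
  | .im => toTriv (prIm E) fun n x => congrArg (fun p => p.2.1) (E_symm_d E hd n x)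
  | .ker => toCone (prKer E)
  | .coker => toTriv (prCoker E) fun n x => congrArg (fun p => p.2.2.1) (E_symm_d E hd n x)

/-- The section on a summand of the model complex. -/
def ofChar : ∀ s, modelCx G s ⟶ D
  | .im => ofTriv (inIm E) fun n _ => (hd _ _).trans (map_zero (E (n - 1)))
  | .ker => ofCone (inKer E) (inSuspKer E) (fun n _ => (hd _ _).trans (map_zero (E (n - 1))))
      (fun _ _ => hd _ _)
  | .coker => ofTriv (inCoker E) fun n _ => (hd _ _).trans (map_zero (E (n - 1)))

lemma toChar_ker_apply (n : ℤ) (x : Pc A M G n) :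
    ((toChar E hd .ker).f n).hom (E n x) =
      ((x.1.2.1, x.2.2.2.2.1) : G .ker n ×
        G .ker (n - 1)) := by
  refine Prod.ext (prKer_apply E n x) ?_
  change prKer E _ ((D.d n (n - 1)).hom (E n x)) = _
  rw [hd, prKer_apply]

lemma toChar_im_apply (n : ℤ) (x : Pc A M G n) :
    ((toChar E hd .im).f n).hom (E n x) = x.2.1 := prIm_apply E n x

lemma toChar_coker_apply (n : ℤ) (x : Pc A M G n) :
    ((toChar E hd .coker).f n).hom (E n x) = x.2.2.1 := prCoker_apply E n x

lemma ofChar_im_apply (n : ℤ) (x) :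
    ((ofChar E hd .im).f n).hom x = E n (0, x, 0, 0) := rfl

lemma ofChar_coker_apply (n : ℤ) (x) :
    ((ofChar E hd .coker).f n).hom x = E n (0, 0, x, 0) := rfl

lemma ofChar_ker_apply (n : ℤ) (x : G .ker n ×
    G .ker (n - 1)) :
    ((ofChar E hd .ker).f n).hom x = E n ((0, x.1, 0), 0, 0, (0, x.2, 0)) := by
  change inKer E n x.1 + inSuspKer E n x.2 = _
  rw [inKer_apply, inSuspKer_apply, ← map_add]
  congr 1
  ext <;> simp

lemma ofChar_toChar_im (n : ℤ) (x : Pc A M G n) :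
    ((ofChar E hd .im).f n).hom (((toChar E hd .im).f n).hom (E n x)) = E n (0, x.2.1, 0, 0) :=
  (congrArg ((ofChar E hd .im).f n).hom (toChar_im_apply E hd n x)).trans
    (ofChar_im_apply E hd n _)

lemma ofChar_toChar_coker (n : ℤ) (x : Pc A M G n) :
    ((ofChar E hd .coker).f n).hom (((toChar E hd .coker).f n).hom (E n x)) =
      E n (0, 0, x.2.2.1, 0) :=
  (congrArg ((ofChar E hd .coker).f n).hom (toChar_coker_apply E hd n x)).trans
    (ofChar_coker_apply E hd n _)

lemma ofChar_toChar_ker (n : ℤ) (x : Pc A M G n) :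
    ((ofChar E hd .ker).f n).hom (((toChar E hd .ker).f n).hom (E n x)) =
      E n ((0, x.1.2.1, 0), 0, 0, (0, x.2.2.2.2.1, 0)) :=
  (congrArg ((ofChar E hd .ker).f n).hom (toChar_ker_apply E hd n x)).trans
    (ofChar_ker_apply E hd n _)

/-- The retraction given by a decomposition into pieces. -/
def pairRetract (hC : ∀ n z, ∃ a k i a', (ϑ.f n).hom z = E n ((a, k, 0), i, 0, (a', 0, 0)))
    (hC' : ∀ n a k i a', ∃ z, E n ((a, k, 0), i, 0, (a', 0, 0)) = (ϑ.f n).hom z) :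
    PairRetract ϑ (baseIncl G) where
  φ := toChar E hd
  ψ := ofChar E hd
  h := contrFam E
  ψφ_self s n x := by
    cases s
    · rw [ofChar_im_apply, toChar_im_apply]
    · exact (congrArg _ (ofChar_ker_apply E hd n x)).trans (toChar_ker_apply E hd n _)
    · rw [ofChar_coker_apply, toChar_coker_apply]
  ψφ_ne s t n x hst := by
    cases s <;> cases t
    · exact absurd rfl hst
    · exact (congrArg _ (ofChar_im_apply E hd n x)).trans (toChar_ker_apply E hd n _)
    · exact (congrArg _ (ofChar_im_apply E hd n x)).trans (toChar_coker_apply E hd n _)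
    · exact (congrArg _ (ofChar_ker_apply E hd n x)).trans (toChar_im_apply E hd n _)
    · exact absurd rfl hst
    · exact (congrArg _ (ofChar_ker_apply E hd n x)).trans (toChar_coker_apply E hd n _)
    · exact (congrArg _ (ofChar_coker_apply E hd n x)).trans (toChar_im_apply E hd n _)
    · exact (congrArg _ (ofChar_coker_apply E hd n x)).trans (toChar_ker_apply E hd n _)
    · exact absurd rfl hst
  homotopy n x := by
    obtain ⟨x, rfl⟩ := (E n).surjective x
    rw [contrFam_homotopy E hd, XIdx.sum_eq, ofChar_toChar_im E hd n x, ofChar_toChar_ker E hd n x,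
      ofChar_toChar_coker E hd n x]
    exact E_sub_summands E n x
  φ_mem s n z := by
    obtain ⟨a, k, i, a', hz⟩ := hC n z
    rw [hz]
    cases s
    · exact ⟨_, rfl⟩
    · exact ⟨k, toChar_ker_apply E hd n _⟩
    · exact ⟨0, (toChar_coker_apply E hd n _).trans (map_zero _).symm⟩
  ψ_mem s n y := by
    cases s
    · exact hC' n 0 0 y 0
    · obtain ⟨z, hz⟩ := hC' n 0 y 0 0
      exact ⟨z, (ofChar_ker_apply E hd n (y, 0)).trans hz⟩
    · exact ⟨0, (map_zero ((ofChar E hd .coker).f n).hom).trans (map_zero _).symm⟩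
  h_mem i j z := by
    by_cases e : i = j - 1
    · subst e
      -- Only `a` survives the contraction and becomes a suspended boundary of `C`. The kernel part
      -- `k` has to be dropped here: its suspension is not a piece of `C`.
      obtain ⟨a, k, i, a', hz⟩ := hC _ z
      obtain ⟨z', hz'⟩ := hC' j 0 0 0 a
      exact ⟨z', by rw [hz, contrFam_eq, contr_apply, ← hz']; rfl⟩
    · exact ⟨0, by simp [contrFam, e]⟩

end Retract

/-- The ring being a principal ideal domain enters here: `C` is isomorphic to a submodule of the
free `D`, and the boundaries of `C` and of `D / C` are again submodules of free modules. -/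
theorem IsSplitInclusion.nonempty_pairRetract [IsDomain R] [IsPrincipalIdealRing R]
    {Λ : Type v} {C D : Λ → Cx.{u} R}
    {ϑ : ∀ a, C a ⟶ D a} (h : IsSplitInclusion ϑ) (a : Λ) :
    Nonempty (PairRetract (ϑ a) (charIncl (homologyHom (ϑ a)))) := by
  have hD := h.free a
  have hQ := h.quotient_free a
  have hCf : ∀ n, Module.Free R ((C a).X n) := fun n =>
    have := free_submodule (LinearMap.range ((ϑ a).f n).hom)
    Module.Free.of_equiv (LinearEquiv.ofInjective _ (h.injective a n)).symm
  obtain ⟨E, hd, hC, hC'⟩ := exists_pieces (h.injective a) (fun n => free_submodule _)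
    (fun n => free_submodule _) (h.split.ker_free a) (h.split.im_free a) (h.split.coker_free a)
  exact ⟨pairRetract (A := fun n => ModuleCat.of R (bdry (C a) n))
    (M := fun n => ModuleCat.of R (quotBdry (ϑ a) n)) (G := charGroup (homologyHom (ϑ a)))
    E hd hC hC'⟩

end PolyProd

end

/-! ### The homotopy on a tensor product of deformations -/

noncomputable section

namespace PolyProd

variable {R : Type} [CommRing R]

section TensHomotopy

variable {m : ℕ} {M : Fin m → Type*} [∀ k, AddCommGroup (M k)] [∀ k, Module R (M k)]

lemma piMap_eq_neg (a b : ∀ k, M k →ₗ[R] M k) (k : Fin m) (h : ∀ l, l ≠ k → a l = b l)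
    (hk : a k = -b k) : PiTensorProduct.map a = -PiTensorProduct.map b := by
  have e : a = Function.update b k ((-1 : R) • b k) := by
    funext l
    by_cases hl : l = k
    · subst hl; simp [hk]
    · rw [Function.update_of_ne hl, h l hl]
  rw [e, PiTensorProduct.map_update_smul, Function.update_eq_self]
  exact neg_one_smul R (PiTensorProduct.map b)

lemma piMap_add (a b c : ∀ k, M k →ₗ[R] M k) (k : Fin m) (h : ∀ l, l ≠ k → a l = c l)
    (h' : ∀ l, l ≠ k → b l = c l) (hk : a k + b k = c k) :
    PiTensorProduct.map a + PiTensorProduct.map b = PiTensorProduct.map c := by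
  have ea : a = Function.update c k (a k) := by
    funext l
    by_cases hl : l = k
    · subst hl; simp
    · rw [Function.update_of_ne hl, h l hl]
  have eb : b = Function.update c k (b k) := by
    funext l
    by_cases hl : l = k
    · subst hl; simp
    · rw [Function.update_of_ne hl, h' l hl]
  rw [ea, eb, ← PiTensorProduct.map_update_add, hk, Function.update_eq_self]

/-- The factors of the terms of the differential of a tensor product. -/
def diffFactor (s d : ∀ k, M k →ₗ[R] M k) (k l : Fin m) : M l →ₗ[R] M l :=
  if l < k then s l else if l = k then d l else LinearMap.id

/-- The factors of the terms of the homotopy of a tensor product of deformations `p`. -/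
def htpyFactor (s p h : ∀ k, M k →ₗ[R] M k) (k l : Fin m) : M l →ₗ[R] M l :=
  if l < k then s l ∘ₗ p l else if l = k then h l else LinearMap.id

/-- The homotopy is the sum over `k` of `p ⊗ ⋯ ⊗ p ⊗ h ⊗ 1 ⊗ ⋯ ⊗ 1` with `h` in slot `k` and Koszul
signs. Terms with `d` and `h` in different slots cancel, because exactly one slot contributes a
sign. In the same slot `d h + h d = 1 - p`, and the resulting terms telescope from the identity to
the tensor power of `p`. -/
theorem tensor_homotopy (s d p h : ∀ k, M k →ₗ[R] M k)
    (hss : ∀ k, s k ∘ₗ s k = LinearMap.id) (hsd : ∀ k, s k ∘ₗ d k = -(d k ∘ₗ s k))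
    (hsh : ∀ k, s k ∘ₗ h k = -(h k ∘ₗ s k)) (hsp : ∀ k, s k ∘ₗ p k = p k ∘ₗ s k)
    (hdp : ∀ k, d k ∘ₗ p k = p k ∘ₗ d k)
    (hdh : ∀ k, d k ∘ₗ h k + h k ∘ₗ d k = LinearMap.id - p k) :
    (∑ k, PiTensorProduct.map (diffFactor s d k)) ∘ₗ (∑ k, PiTensorProduct.map (htpyFactor s p h k)) +
      (∑ k, PiTensorProduct.map (htpyFactor s p h k)) ∘ₗ (∑ k, PiTensorProduct.map (diffFactor s d k))
      = LinearMap.id - PiTensorProduct.map p := by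
  have off : ∀ k k', k ≠ k' → PiTensorProduct.map (diffFactor s d k) ∘ₗ
      PiTensorProduct.map (htpyFactor s p h k') = -(PiTensorProduct.map (htpyFactor s p h k') ∘ₗ
        PiTensorProduct.map (diffFactor s d k)) := by
    intro k k' hne
    rw [← PiTensorProduct.map_comp, ← PiTensorProduct.map_comp]
    rcases lt_or_gt_of_ne hne with hlt | hlt
    -- If `d` stands before `h`, the sign arises in the slot of `d`, where `d` passes the sign
    -- carried by the homotopy. In the other case it arises in the slot of `h`.
    · refine piMap_eq_neg _ _ k (fun l hl => ?_) ?_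
      · unfold diffFactor htpyFactor
        rcases lt_or_gt_of_ne hl with h1 | h1
        · rw [if_pos h1, if_pos (h1.trans hlt), LinearMap.comp_assoc, ← hsp]
        · rw [if_neg h1.not_gt, if_neg hl]; rfl
      · unfold diffFactor htpyFactor
        rw [if_neg (lt_irrefl k), if_pos rfl, if_pos hlt, LinearMap.comp_assoc, ← hdp,
          ← LinearMap.comp_assoc, ← LinearMap.comp_assoc, hsd, LinearMap.neg_comp, neg_neg]
    · refine piMap_eq_neg _ _ k' (fun l hl => ?_) ?_
      · unfold diffFactor htpyFactor
        rcases lt_or_gt_of_ne hl with h1 | h1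
        · rw [if_pos h1, if_pos (h1.trans hlt), LinearMap.comp_assoc, ← hsp]
        · rw [if_neg h1.not_gt, if_neg hl]; rfl
      · unfold diffFactor htpyFactor
        rw [if_neg (lt_irrefl k'), if_pos rfl, if_pos hlt, hsh]
  -- The telescoping terms: `p` in the first `q` slots and the identity in the rest.
  let A : ℕ → (PiTensorProduct R M →ₗ[R] PiTensorProduct R M) := fun q =>
    PiTensorProduct.map fun l => if l.1 < q then p l else LinearMap.id
  have diag : ∀ k, PiTensorProduct.map (diffFactor s d k) ∘ₗ
      PiTensorProduct.map (htpyFactor s p h k) + PiTensorProduct.map (htpyFactor s p h k) ∘ₗ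
        PiTensorProduct.map (diffFactor s d k) = A k - A (k + 1) := by
    intro k
    rw [← PiTensorProduct.map_comp, ← PiTensorProduct.map_comp, eq_sub_iff_add_eq]
    have h1 : ∀ l, l < k → s l ∘ₗ s l ∘ₗ p l = p l := fun l _ => by
      rw [← LinearMap.comp_assoc, hss, LinearMap.id_comp]
    have h2 : ∀ l, l < k → (s l ∘ₗ p l) ∘ₗ s l = p l := fun l hl => by
      rw [LinearMap.comp_assoc, ← hsp, h1 l hl]
    rw [piMap_add _ _ (fun l => if l.1 < k.1 then p l else if l = k then LinearMap.id - p l else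
      LinearMap.id) k, piMap_add _ _ (fun l => if l.1 < k.1 then p l else LinearMap.id) k]
    · intro l hl
      simp [hl]
    · intro l hl
      have : l.1 < k.1 + 1 ↔ l.1 < k.1 := by
        have := Fin.val_ne_of_ne hl; omega
      simp [this]
    · simp
    · intro l hl
      unfold diffFactor htpyFactor
      rcases lt_or_gt_of_ne hl with h3 | h3
      · simp [h3, h1 l h3]
      · simp [h3.not_gt, hl]
    · intro l hl
      unfold diffFactor htpyFactor
      rcases lt_or_gt_of_ne hl with h3 | h3
      · simp [h3, h2 l h3]
      · simp [h3.not_gt, hl]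
    · simp [diffFactor, htpyFactor, hdh]
  have e1 : (∑ k, PiTensorProduct.map (diffFactor s d k)) ∘ₗ
      (∑ k, PiTensorProduct.map (htpyFactor s p h k)) = ∑ k, ∑ k',
        PiTensorProduct.map (diffFactor s d k) ∘ₗ PiTensorProduct.map (htpyFactor s p h k') := by
    refine LinearMap.ext fun z => ?_
    simp only [LinearMap.sum_apply, LinearMap.comp_apply, map_sum]
    exact Finset.sum_comm
  have e2 : (∑ k, PiTensorProduct.map (htpyFactor s p h k)) ∘ₗ
      (∑ k, PiTensorProduct.map (diffFactor s d k)) = ∑ k, ∑ k',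
        PiTensorProduct.map (htpyFactor s p h k') ∘ₗ PiTensorProduct.map (diffFactor s d k) := by
    refine LinearMap.ext fun z => ?_
    simp only [LinearMap.sum_apply, LinearMap.comp_apply, map_sum]
  rw [e1, e2, ← Finset.sum_add_distrib]
  have e3 : ∀ k : Fin m, (∑ k', PiTensorProduct.map (diffFactor s d k) ∘ₗ
      PiTensorProduct.map (htpyFactor s p h k')) + ∑ k', PiTensorProduct.map (htpyFactor s p h k') ∘ₗ
        PiTensorProduct.map (diffFactor s d k) = A k - A (k + 1) := by
    intro k
    rw [← Finset.sum_add_distrib, Finset.sum_eq_single k, diag]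
    · intro k' _ hk
      rw [off k k' hk.symm, neg_add_cancel]
    · simp
  rw [Finset.sum_congr rfl fun k _ => e3 k, Fin.sum_univ_eq_sum_range (fun q => A q - A (q + 1)),
    Finset.sum_range_sub']
  congr 1
  · simp [A]
  · simp [A]

end TensHomotopy

end PolyProd

end

/-! ### Homotopy equivalences of polyhedral products -/

noncomputable section

namespace PolyProd

variable {R : Type} [CommRing R]

section Deg

variable {I : Type} [DecidableEq I] [Fintype I] (X : I → Cx.{u} R)

/-- The elements of degree `n` of a total complex. -/
def IsDeg (n : ℤ) (x : Tot X) : Prop := ∃ g : ∀ i, (X i).X n, x = ∑ i, Tot.of X i n (g i)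

variable {X}

lemma isDeg_of (i : I) (n : ℤ) (x : (X i).X n) : IsDeg X n (Tot.of X i n x) := by
  classical
  refine ⟨fun j => if h : i = j then h ▸ x else 0, ?_⟩
  rw [Finset.sum_eq_single i]
  · simp
  · intro j _ hj
    simp [hj.symm]
  · simp

lemma IsDeg.add {n : ℤ} {x y : Tot X} (hx : IsDeg X n x) (hy : IsDeg X n y) :
    IsDeg X n (x + y) := by
  obtain ⟨g, rfl⟩ := hx
  obtain ⟨g', rfl⟩ := hy
  exact ⟨g + g', by simp [Finset.sum_add_distrib]⟩

lemma isDeg_zero (n : ℤ) : IsDeg X n 0 := ⟨0, by simp⟩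

lemma isDeg_sum {α : Type*} (s : Finset α) {n : ℤ} (x : α → Tot X) (h : ∀ a, IsDeg X n (x a)) :
    IsDeg X n (∑ a ∈ s, x a) := by
  classical
  induction s using Finset.induction_on with
  | empty => simpa using isDeg_zero n
  | insert a s ha ih => rw [Finset.sum_insert ha]; exact (h a).add ih

lemma IsDeg.smul {n : ℤ} {x : Tot X} (c : R) (hx : IsDeg X n x) : IsDeg X n (c • x) := by
  obtain ⟨g, rfl⟩ := hx
  exact ⟨c • g, by simp [Finset.smul_sum]⟩

lemma IsDeg.sign {n : ℤ} {x : Tot X} (hx : IsDeg X n x) :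
    Tot.sign X x = ((n.negOnePow : ℤ) : R) • x := by
  obtain ⟨g, rfl⟩ := hx
  simp [map_sum, Tot.sign_of, Finset.smul_sum]

omit [Fintype I] in
lemma Tot.sign_sign : Tot.sign X ∘ₗ Tot.sign X = LinearMap.id := by
  refine Tot.ext fun i n x => ?_
  have : ((n.negOnePow : ℤ) : R) * ((n.negOnePow : ℤ) : R) = 1 := by
    rw [← Int.cast_mul, ← Units.val_mul, Int.units_mul_self]; simp
  rw [LinearMap.comp_apply, Tot.sign_of, map_smul, Tot.sign_of, smul_smul, this, one_smul]
  rfl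

variable {I' : Type} [DecidableEq I'] [Fintype I'] {X' : I' → Cx.{u} R}

/-- A homomorphism of total complexes is homogeneous of degree `e`. -/
def HasDeg (e : ℤ) (F : Tot X →ₗ[R] Tot X') : Prop :=
  ∀ i n x, IsDeg X' (n + e) (F (Tot.of X i n x))

lemma HasDeg.isDeg {e : ℤ} {F : Tot X →ₗ[R] Tot X'} (hF : HasDeg e F) {n : ℤ} {x : Tot X}
    (hx : IsDeg X n x) : IsDeg X' (n + e) (F x) := by
  obtain ⟨g, rfl⟩ := hx
  rw [map_sum]
  exact isDeg_sum _ _ fun i => hF i n _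

omit [Fintype I] in
-- Supplies the sign rules needed by `tensor_homotopy`: maps of degree `0` commute with the sign,
-- and the homotopy of degree `1` anticommutes with it.
lemma HasDeg.sign_comp {e : ℤ} {F : Tot X →ₗ[R] Tot X'} (hF : HasDeg e F) :
    Tot.sign X' ∘ₗ F = ((e.negOnePow : ℤ) : R) • (F ∘ₗ Tot.sign X) := by
  refine Tot.ext fun i n x => ?_
  simp [Tot.sign_of, (hF i n x).sign, Int.negOnePow_add, smul_smul, mul_comm]

end Deg

section PolyMaps

variable {m : ℕ} {I I' : Fin m → Type} [∀ k, DecidableEq (I k)] [∀ k, DecidableEq (I' k)]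
  {Y X : ∀ k, I k → Cx.{u} R} {Y' X' : ∀ k, I' k → Cx.{u} R}

lemma tprod_mem_tensGr [∀ k, Fintype (I k)] (j : Fin m → ℤ) {n : ℤ} (hj : ∑ k, j k = n)
    (x : ∀ k, Tot (X k)) (hx : ∀ k, IsDeg (X k) (j k) (x k)) :
    PiTensorProduct.tprod R x ∈ tensGr X Set.univ n := by
  classical
  choose g hg using hx
  rw [funext hg, MultilinearMap.map_sum]
  exact Submodule.sum_mem _ fun i _ => Submodule.subset_span ⟨i, trivial, j, hj, _, rfl⟩

omit [∀ k, DecidableEq (I k)] [∀ k, DecidableEq (I' k)] in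
-- A simplex only restricts the slots outside it to the subcomplex, and each `F k` respects that
-- restriction; hence the same simplex works for the image.
lemma piMap_mem_polySub (K : LowerSet (Finset (Fin m))) {f : ∀ k i, Y k i ⟶ X k i}
    {f' : ∀ k i, Y' k i ⟶ X' k i} (F : ∀ k, Tot (X k) →ₗ[R] Tot (X' k))
    (hF : ∀ k, ∀ x ∈ LinearMap.range (Tot.map (f k)), F k x ∈ LinearMap.range (Tot.map (f' k)))
    {z : Tens X} (hz : z ∈ polySub K f) : PiTensorProduct.map F z ∈ polySub K f' := by
  have h : polySub K f ≤ (polySub K f').comap (PiTensorProduct.map F) := by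
    refine iSup₂_le fun τ hτ => Submodule.span_le.2 ?_
    rintro _ ⟨x, hx, rfl⟩
    refine (le_iSup₂_of_le (f := fun τ (_ : τ ∈ K) => faceSub f' τ) τ hτ le_rfl) ?_
    rw [PiTensorProduct.map_tprod]
    exact Submodule.subset_span ⟨_, fun k hk => hF k _ (hx k hk), rfl⟩
  exact h hz

lemma piMap_mem_tensGr [∀ k, Fintype (I k)] [∀ k, Fintype (I' k)] (e : Fin m → ℤ)
    (F : ∀ k, Tot (X k) →ₗ[R] Tot (X' k)) (hF : ∀ k, HasDeg (e k) (F k)) {P : Set (∀ k, I k)}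
    {n n' : ℤ} (hn : n + ∑ k, e k = n') {z : Tens X} (hz : z ∈ tensGr X P n) :
    PiTensorProduct.map F z ∈ tensGr X' Set.univ n' := by
  have h : tensGr X P n ≤ (tensGr X' Set.univ n').comap (PiTensorProduct.map F) := by
    refine Submodule.span_le.2 ?_
    rintro _ ⟨i, -, j, hj, x, rfl⟩
    simp only [SetLike.mem_coe, Submodule.mem_comap]
    rw [PiTensorProduct.map_tprod]
    exact tprod_mem_tensGr (fun k => j k + e k) (by rw [Finset.sum_add_distrib, hj, hn]) _
      fun k => hF k _ _ _
  exact h hz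

lemma polyCx_d_coe (K : LowerSet (Finset (Fin m))) (f : ∀ k i, Y k i ⟶ X k i)
    (P : Set (∀ k, I k)) {n n' : ℤ} (h : n' + 1 = n) (z : (polyCx K f P).X n) :
    ((((polyCx K f P).d n n').hom z : (polyCx K f P).X n').1 : Tens X) = tensD X z.1 := by
  simp only [polyCx, dif_pos h]
  rfl

/-- The chain homomorphism of polyhedral products given by a homomorphism of tensor products. -/
def polyHom {K : LowerSet (Finset (Fin m))} {f : ∀ k i, Y k i ⟶ X k i}
    {f' : ∀ k i, Y' k i ⟶ X' k i} {P : Set (∀ k, I k)} {P' : Set (∀ k, I' k)}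
    (T : Tens X →ₗ[R] Tens X') (hd : ∀ z, tensD X' (T z) = T (tensD X z))
    (hK : ∀ z ∈ polySub K f, T z ∈ polySub K f')
    (hP : ∀ n, ∀ z ∈ tensGr X P n, T z ∈ tensGr X' P' n) : polyCx K f P ⟶ polyCx K f' P' where
  f n := ModuleCat.ofHom (T.restrict (p := polySub K f ⊓ tensGr X P n)
    (q := polySub K f' ⊓ tensGr X' P' n) fun z hz => ⟨hK z hz.1, hP n z hz.2⟩)
  comm' n n' h := by
    refine ModuleCat.hom_ext (LinearMap.ext fun z => Subtype.ext ?_)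
    refine (polyCx_d_coe K f' P' h _).trans ((hd z.1).trans ?_)
    exact congrArg T (polyCx_d_coe K f P h z).symm

/-- The family of homomorphisms of degree `1` of polyhedral products given by an endomorphism of
degree `1` of the tensor product. -/
def polyShift {K : LowerSet (Finset (Fin m))} {f : ∀ k i, Y k i ⟶ X k i} {P : Set (∀ k, I k)}
    (T : Tens X →ₗ[R] Tens X) (hK : ∀ z ∈ polySub K f, T z ∈ polySub K f)
    (hP : ∀ n, ∀ z ∈ tensGr X P n, T z ∈ tensGr X P (n + 1)) (n n' : ℤ) :
    (polyCx K f P).X n ⟶ (polyCx K f P).X n' :=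
  if h : n + 1 = n' then
    ModuleCat.ofHom (T.restrict (p := polySub K f ⊓ tensGr X P n)
      (q := polySub K f ⊓ tensGr X P n') fun z hz => ⟨hK z hz.1, h ▸ hP n z hz.2⟩)
  else 0

lemma polyShift_coe {K : LowerSet (Finset (Fin m))} {f : ∀ k i, Y k i ⟶ X k i}
    {P : Set (∀ k, I k)} (T : Tens X →ₗ[R] Tens X) (hK : ∀ z ∈ polySub K f, T z ∈ polySub K f)
    (hP : ∀ n, ∀ z ∈ tensGr X P n, T z ∈ tensGr X P (n + 1)) {n n' : ℤ} (h : n + 1 = n')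
    (z : (polyCx K f P).X n) :
    (((polyShift T hK hP n n').hom z : (polyCx K f P).X n').1 : Tens X) = T z.1 := by
  have e : polyShift (K := K) (f := f) T hK hP n n' = _ := dif_pos h
  exact congrArg (fun g => ((g.hom z : (polyCx K f P).X n').1 : Tens X)) e

/-- A homotopy of polyhedral products given by an endomorphism of the tensor product. -/
def polyHomotopy {K : LowerSet (Finset (Fin m))} {f : ∀ k i, Y k i ⟶ X k i} {P : Set (∀ k, I k)}
    (T : Tens X →ₗ[R] Tens X) (hK : ∀ z ∈ polySub K f, T z ∈ polySub K f)
    (hP : ∀ n, ∀ z ∈ tensGr X P n, T z ∈ tensGr X P (n + 1))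
    (g g' : polyCx K f P ⟶ polyCx K f P)
    (h : ∀ n z, (((g.f n).hom z : (polyCx K f P).X n).1 : Tens X) =
      tensD X (T z.1) + T (tensD X z.1) + ((g'.f n).hom z : (polyCx K f P).X n).1) :
    Homotopy g g' where
  hom := polyShift T hK hP
  zero i j hij := dif_neg hij
  comm n := by
    have h1 : n - 1 + 1 = n := by omega
    rw [dNext_eq _ (show (ComplexShape.down ℤ).Rel n (n - 1) from h1),
      prevD_eq _ (show (ComplexShape.down ℤ).Rel (n + 1) n from rfl)]
    refine ModuleCat.hom_ext (LinearMap.ext fun z => Subtype.ext ((h n z).trans ?_))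
    have e1 := (polyShift_coe T hK hP h1 (((polyCx K f P).d n (n - 1)).hom z)).trans
      (congrArg T (polyCx_d_coe K f P h1 z))
    have e2 := (polyCx_d_coe K f P rfl ((polyShift T hK hP n (n + 1)).hom z)).trans
      (congrArg (tensD X) (polyShift_coe T hK hP rfl z))
    rw [← e1, ← e2]
    exact congrArg₂ (· + ·) (add_comm _ _) rfl

section Deformation

variable [∀ k, Fintype (I k)] [∀ k, Fintype (I' k)]

/-- Homotopy inverse homomorphisms `F`, `G` of total complexes with `F G = 1`, and a homotopy from
`G F` to the identity, all compatible with subcomplexes. -/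
structure TotDeformation {I I' : Type} [DecidableEq I] [DecidableEq I'] [Fintype I] [Fintype I']
    {Y X : I → Cx.{u} R} {Y' X' : I' → Cx.{u} R} (f : ∀ i, Y i ⟶ X i) (f' : ∀ i, Y' i ⟶ X' i) where
  F : Tot X →ₗ[R] Tot X'
  G : Tot X' →ₗ[R] Tot X
  h : Tot X →ₗ[R] Tot X
  hasDeg_F : HasDeg 0 F
  hasDeg_G : HasDeg 0 G
  hasDeg_h : HasDeg 1 h
  d_comp_F : Tot.d X' ∘ₗ F = F ∘ₗ Tot.d X
  d_comp_G : Tot.d X ∘ₗ G = G ∘ₗ Tot.d X'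
  F_comp_G : F ∘ₗ G = LinearMap.id
  homotopy : Tot.d X ∘ₗ h + h ∘ₗ Tot.d X = LinearMap.id - G ∘ₗ F
  F_mem : ∀ x ∈ LinearMap.range (Tot.map f), F x ∈ LinearMap.range (Tot.map f')
  G_mem : ∀ x ∈ LinearMap.range (Tot.map f'), G x ∈ LinearMap.range (Tot.map f)
  h_mem : ∀ x ∈ LinearMap.range (Tot.map f), h x ∈ LinearMap.range (Tot.map f)

omit [∀ k, Fintype (I k)] in
lemma tensD_piMap (F : ∀ k, Tot (X k) →ₗ[R] Tot (X' k)) (hF : ∀ k, HasDeg 0 (F k))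
    (hd : ∀ k, Tot.d (X' k) ∘ₗ F k = F k ∘ₗ Tot.d (X k)) (z : Tens X) :
    tensD X' (PiTensorProduct.map F z) = PiTensorProduct.map F (tensD X z) := by
  simp only [tensD, LinearMap.sum_apply, map_sum]
  refine Finset.sum_congr rfl fun k _ => ?_
  rw [← LinearMap.comp_apply, ← LinearMap.comp_apply, ← PiTensorProduct.map_comp,
    ← PiTensorProduct.map_comp]
  congr 2
  funext l
  unfold tensFactor
  split_ifs
  · simpa using (hF l).sign_comp
  · exact hd l
  · rfl

/-- The tensor products of the maps `F` and `G`, and the homotopy of `tensor_homotopy`, have factors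
that all preserve the subcomplexes, so they restrict to the polyhedral products. Since `F G = 1`
holds strictly, `G` provides preimages and `F` is surjective. -/
theorem exists_polyCx_homotopyEquiv (K : LowerSet (Finset (Fin m))) {f : ∀ k i, Y k i ⟶ X k i}
    {f' : ∀ k i, Y' k i ⟶ X' k i} (E : ∀ k, TotDeformation (f k) (f' k)) :
    ∃ φ : HomotopyEquiv (polyCx K f Set.univ) (polyCx K f' Set.univ),
      ∀ n, Function.Surjective (φ.hom.f n).hom := by
  let F := polyHom (K := K) (f := f) (f' := f') (P := Set.univ) (P' := Set.univ)
    (PiTensorProduct.map fun k => (E k).F)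
    (tensD_piMap _ (fun k => (E k).hasDeg_F) fun k => (E k).d_comp_F)
    (fun z => piMap_mem_polySub K _ fun k => (E k).F_mem)
    fun n z => piMap_mem_tensGr 0 _ (fun k => (E k).hasDeg_F) (by simp)
  let G := polyHom (K := K) (f := f') (f' := f) (P := Set.univ) (P' := Set.univ)
    (PiTensorProduct.map fun k => (E k).G)
    (tensD_piMap _ (fun k => (E k).hasDeg_G) fun k => (E k).d_comp_G)
    (fun z => piMap_mem_polySub K _ fun k => (E k).G_mem)
    fun n z => piMap_mem_tensGr 0 _ (fun k => (E k).hasDeg_G) (by simp)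
  have hFG : G ≫ F = 𝟙 _ := by
    refine HomologicalComplex.hom_ext _ _ fun n => ModuleCat.hom_ext (LinearMap.ext fun z =>
      Subtype.ext ?_)
    change PiTensorProduct.map (fun k => (E k).F) (PiTensorProduct.map (fun k => (E k).G) z.1) = z.1
    rw [← LinearMap.comp_apply, ← PiTensorProduct.map_comp, funext fun k => (E k).F_comp_G,
      PiTensorProduct.map_id]
    rfl
  let s := fun k => Tot.sign (X k)
  let p := fun k => (E k).G ∘ₗ (E k).F
  let T : Tens X →ₗ[R] Tens X :=
    ∑ k, PiTensorProduct.map (htpyFactor s p (fun k => (E k).h) k)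
  have hp : ∀ k, HasDeg 0 (p k) := fun k i n x => by
    have := (E k).hasDeg_G.isDeg ((E k).hasDeg_F i n x)
    rw [add_zero] at this
    exact this
  have hsp : ∀ k, HasDeg 0 (s k ∘ₗ p k) := fun k i n x => by
    rw [LinearMap.comp_apply, (hp k i n x).sign]
    exact (hp k i n x).smul _
  have hT := tensor_homotopy s (fun k => Tot.d (X k)) p (fun k => (E k).h)
    (fun k => Tot.sign_sign) (fun k => Tot.sign_comp_d (X k))
    (fun k => by
      rw [(E k).hasDeg_h.sign_comp]
      simp only [Int.negOnePow_one, Units.val_neg, Units.val_one, Int.cast_neg, Int.cast_one]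
      exact neg_one_smul R ((E k).h ∘ₗ Tot.sign (X k)))
    (fun k => by simpa using (hp k).sign_comp)
    (fun k => by rw [← LinearMap.comp_assoc, (E k).d_comp_G, LinearMap.comp_assoc, (E k).d_comp_F,
      LinearMap.comp_assoc]) (fun k => (E k).homotopy)
  -- Each factor `s p`, `h` or `1` of the homotopy keeps the subcomplex, and exactly one slot raises
  -- the degree, by one.
  have hH : Homotopy (𝟙 _) (F ≫ G) := by
    refine polyHomotopy T (fun z hz => ?_) (fun n z hz => ?_) _ _ fun n z => ?_
    · rw [LinearMap.sum_apply]
      refine Submodule.sum_mem _ fun k _ => piMap_mem_polySub K _ (fun l x hx => ?_) hz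
      unfold htpyFactor
      split_ifs
      · obtain ⟨y, hy⟩ := (E l).G_mem _ ((E l).F_mem x hx)
        refine ⟨Tot.sign _ y, ?_⟩
        rw [← LinearMap.comp_apply, ← Tot.sign_comp_map, LinearMap.comp_apply, hy]
        rfl
      · exact (E l).h_mem x hx
      · exact hx
    · rw [LinearMap.sum_apply]
      refine Submodule.sum_mem _ fun k _ => piMap_mem_tensGr (fun l => if l = k then 1 else 0) _
        (fun l => ?_) (by simp) hz
      unfold htpyFactor
      split_ifs with h1 h2 h2
      · exact absurd h1 h2.ne
      · exact (E l).hasDeg_h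
      · exact hsp l
      · intro i n x
        rw [add_zero]
        exact isDeg_of i n x
    · have := LinearMap.congr_fun hT z.1
      rw [LinearMap.sub_apply, eq_sub_iff_add_eq] at this
      refine this.symm.trans (congrArg₂ (· + ·) rfl ?_)
      change PiTensorProduct.map (fun k => (E k).G ∘ₗ (E k).F) z.1 = _
      rw [PiTensorProduct.map_comp]
      rfl
  refine ⟨⟨F, G, hH.symm, Homotopy.ofEq hFG⟩, fun n z => ⟨(G.f n).hom z, ?_⟩⟩
  exact congrArg (fun g => (g.f n).hom z) hFG

end Deformation
end PolyMaps

end PolyProd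

end

/-! ### From retractions of pairs to deformations of total complexes -/

noncomputable section

namespace PolyProd

variable {R : Type} [CommRing R]

section FromRetract

variable {C D : Cx.{u} R} {ϑ : C ⟶ D} {I : Type} [Fintype I] {B X : I → Cx.{u} R}
  {f : ∀ s, B s ⟶ X s}

/-- A retraction restricts to the non-zero summands. -/
def PairRetract.restrict (P : PairRetract ϑ f) (S : Set I) [Fintype S]
    (hS : ∀ s ∉ S, ∀ n, Subsingleton ((X s).X n)) :
    PairRetract ϑ (fun s : S => f s.1) where
  φ s := P.φ s.1
  ψ s := P.ψ s.1
  h := P.h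
  ψφ_self s := P.ψφ_self s.1
  ψφ_ne s t n x hst := P.ψφ_ne s.1 t.1 n x fun h => hst (Subtype.ext h)
  homotopy n x := by
    classical
    rw [P.homotopy]
    congr 1
    rw [← Finset.sum_subset (Finset.subset_univ (Finset.univ.filter (· ∈ S)))]
    · exact (Finset.sum_subtype _ (by simp)
        fun s => ((P.ψ s).f n).hom (((P.φ s).f n).hom x))
    · intro s _ hs
      have := hS s (by simpa using hs) n
      rw [Subsingleton.elim (((P.φ s).f n).hom x) 0, map_zero]
  φ_mem s := P.φ_mem s.1
  ψ_mem s := P.ψ_mem s.1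
  h_mem := P.h_mem

variable [DecidableEq I]

/-- The projection of total complexes given by a retraction. -/
def PairRetract.totF (P : PairRetract ϑ f) : Tot (fun _ : PUnit => D) →ₗ[R] Tot X :=
  DirectSum.toModule R _ _ fun p => ∑ t, Tot.of X t p.2 ∘ₗ ((P.φ t).f p.2).hom

/-- The section of total complexes given by a retraction. -/
def PairRetract.totG (P : PairRetract ϑ f) : Tot X →ₗ[R] Tot (fun _ : PUnit => D) :=
  DirectSum.toModule R _ _ fun p =>
    Tot.of (fun _ : PUnit => D) PUnit.unit p.2 ∘ₗ ((P.ψ p.1).f p.2).hom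

/-- The homotopy of total complexes given by a retraction. -/
def PairRetract.totH (P : PairRetract ϑ f) :
    Tot (fun _ : PUnit => D) →ₗ[R] Tot (fun _ : PUnit => D) :=
  DirectSum.toModule R _ _ fun p =>
    Tot.of (fun _ : PUnit => D) PUnit.unit (p.2 + 1) ∘ₗ P.h p.2 (p.2 + 1)

lemma PairRetract.totF_of (P : PairRetract ϑ f) (i : PUnit) (n : ℤ) (x : D.X n) :
    P.totF (Tot.of (fun _ => D) i n x) = ∑ t, Tot.of X t n (((P.φ t).f n).hom x) := by
  refine (DirectSum.toModule_lof ..).trans ?_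
  rw [LinearMap.sum_apply]
  rfl

lemma PairRetract.totG_of (P : PairRetract ϑ f) (t : I) (n : ℤ) (x : (X t).X n) :
    P.totG (Tot.of X t n x) = Tot.of (fun _ => D) PUnit.unit n (((P.ψ t).f n).hom x) :=
  DirectSum.toModule_lof ..

omit [DecidableEq I] in
lemma PairRetract.totH_of (P : PairRetract ϑ f) (i : PUnit) (n : ℤ) (x : D.X n) :
    P.totH (Tot.of (fun _ => D) i n x) = Tot.of (fun _ => D) PUnit.unit (n + 1) (P.h n (n + 1) x) :=
  DirectSum.toModule_lof ..

omit [Fintype I] in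
lemma map_mem_range_of {I' : Type} [DecidableEq I'] {Y' X' : I' → Cx.{u} R} (g : ∀ i, B i ⟶ X i)
    (g' : ∀ i, Y' i ⟶ X' i) (F : Tot X →ₗ[R] Tot X')
    (h : ∀ i n y, F (Tot.of X i n (((g i).f n).hom y)) ∈ LinearMap.range (Tot.map g')) :
    ∀ x ∈ LinearMap.range (Tot.map g), F x ∈ LinearMap.range (Tot.map g') := by
  rintro _ ⟨y, rfl⟩
  induction y using DirectSum.induction_on with
  | zero => simp
  | of p y =>
    have := h p.1 p.2 y
    rw [← Tot.map_of] at this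
    exact this
  | add x y hx hy => rw [map_add, map_add]; exact add_mem hx hy

/-- A retraction as a deformation of total complexes. -/
def PairRetract.totDeformation (P : PairRetract ϑ f) :
    TotDeformation (I := PUnit) (X := fun _ => D) (fun _ => ϑ) f where
  F := P.totF
  G := P.totG
  h := P.totH
  hasDeg_F i n x := by
    rw [P.totF_of, add_zero]
    exact isDeg_sum _ _ fun t => isDeg_of t n _
  hasDeg_G t n x := by
    rw [P.totG_of, add_zero]
    exact isDeg_of _ n _
  hasDeg_h i n x := by
    rw [P.totH_of]
    exact isDeg_of _ (n + 1) _
  d_comp_F := by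
    refine Tot.ext fun i n x => ?_
    rw [LinearMap.comp_apply, LinearMap.comp_apply, P.totF_of, Tot.d_of, P.totF_of, map_sum]
    exact Finset.sum_congr rfl fun t _ => by rw [Tot.d_of, hom_comm_apply]
  d_comp_G := by
    refine Tot.ext fun t n x => ?_
    rw [LinearMap.comp_apply, LinearMap.comp_apply, P.totG_of, Tot.d_of, Tot.d_of, P.totG_of,
      hom_comm_apply]
  F_comp_G := by
    refine Tot.ext fun t n x => ?_
    rw [LinearMap.comp_apply, P.totG_of, P.totF_of, Finset.sum_eq_single t]
    · rw [P.ψφ_self]; rfl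
    · intro t' _ ht
      rw [P.ψφ_ne t t' n x ht.symm, map_zero]
    · simp
  homotopy := by
    refine Tot.ext fun i n x => ?_
    -- The two terms of the homotopy end in degrees `n + 1 - 1` and `n - 1 + 1`; these statements
    -- transport both to degree `n`.
    have h1 : ∀ p q (hq : q = n) (y : D.X p), Tot.of (fun _ : PUnit => D) PUnit.unit q
        ((D.d p q).hom y) = Tot.of (fun _ : PUnit => D) PUnit.unit n ((D.d p n).hom y) := by
      rintro p _ rfl y; rfl
    have h2 : ∀ p q (hq : q = n) (y : D.X p), Tot.of (fun _ : PUnit => D) PUnit.unit q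
        (P.h p q y) = Tot.of (fun _ : PUnit => D) PUnit.unit n (P.h p n y) := by
      rintro p _ rfl y; rfl
    simp only [LinearMap.add_apply, LinearMap.sub_apply, LinearMap.comp_apply, P.totF_of,
      Tot.d_of, P.totH_of, map_sum, P.totG_of, LinearMap.id_apply]
    rw [h1 _ _ (by omega), h2 _ _ (by omega), ← map_add, P.homotopy, map_sub, map_sum]
  F_mem := map_mem_range_of _ _ _ fun i n y => by
    rw [P.totF_of]
    refine Submodule.sum_mem _ fun t _ => ?_
    obtain ⟨z, hz⟩ := P.φ_mem t n y
    rw [hz, ← Tot.map_of]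
    exact ⟨_, rfl⟩
  G_mem := map_mem_range_of _ _ _ fun t n y => by
    obtain ⟨z, hz⟩ := P.ψ_mem t n y
    rw [P.totG_of, hz]
    exact ⟨_, Tot.map_of (fun _ : PUnit => ϑ) PUnit.unit n z⟩
  h_mem := map_mem_range_of _ _ _ fun t n y => by
    obtain ⟨z, hz⟩ := P.h_mem n (n + 1) y
    rw [P.totH_of, hz]
    exact ⟨_, Tot.map_of (fun _ : PUnit => ϑ) PUnit.unit (n + 1) z⟩

end FromRetract

/-- The factorwise retractions are tensored together. For the smaller index set, surjectivity makes
the cokernel summand zero, so the retraction restricts to the other two summands. -/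
theorem exists_inclCx_homotopyEquiv [IsDomain R] [IsPrincipalIdealRing R] {m : ℕ}
    (K : LowerSet (Finset (Fin m))) {Λ : Fin m → Type v} {C D : ∀ k, Λ k → Cx.{u} R}
    (ϑ : ∀ k a, C k a ⟶ D k a) (hϑ : ∀ k, IsSplitInclusion (ϑ k)) (S : Set XIdx)
    (hS : S = Set.univ ∨
        S = rightIdx ∧ ∀ k a n, Function.Surjective (homologyHom (ϑ k a) n).hom) (a : ∀ k, Λ k) :
    ∃ φ : HomotopyEquiv (inclCx K fun k => ϑ k (a k))
      (charCx S K fun k => homologyHom (ϑ k (a k))), ∀ n, Function.Surjective (φ.hom.f n).hom := by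
  classical
  let P := fun k => ((hϑ k).nonempty_pairRetract (a k)).some
  have : Fintype S := Fintype.ofFinite S
  have hS' : ∀ k, ∀ s ∉ S, ∀ n,
      Subsingleton ((modelCx (charGroup (homologyHom (ϑ k (a k)))) s).X n) := by
    intro k s hs n
    rcases hS with rfl | ⟨rfl, hsurj⟩
    · exact absurd trivial hs
    · cases s
      · exact absurd (Or.inl rfl) hs
      · exact absurd (Or.inr rfl) hs
      · exact Submodule.Quotient.subsingleton_iff.2 (LinearMap.range_eq_top.2 (hsurj k _ n))
  exact exists_polyCx_homotopyEquiv K fun k => ((P k).restrict S (hS' k)).totDeformation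

end PolyProd

end

noncomputable section

namespace PolyProd

variable {R : Type} [CommRing R]

/-! ### Cells of model complexes -/

section Cells

variable (S : Set XIdx)

/-- The cells `η`, `γ`, `β`, `α` with index in `S`: an index and a boolean that is `true` only for
`β`, where the index is `ker`. -/
abbrev Cell := {p : S × Bool // p.2 = true → p.1.1 = XIdx.ker}

variable {S}

/-- The dimension of a cell. -/
def bdeg (b : Bool) : ℤ := if b then 1 else 0

/-- A cell is outside of the base. -/
abbrev Cell.IsUpper (c : Cell S) : Prop := c.1.2 = true ∨ c.1.1.1 = XIdx.coker

variable (G : XIdx → Gr.{u} R)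

/-- The inclusion of the bottom cells. -/
def gen0 : ∀ (t : XIdx) (n : ℤ), G t n →ₗ[R] (modelCx G t).X n
  | .im, n => (LinearMap.id : G .im n →ₗ[R] G .im n)
  | .ker, n => LinearMap.inl R (G .ker n) (G .ker (n - 1))
  | .coker, n => (LinearMap.id : G .coker n →ₗ[R] G .coker n)

/-- The inclusion of the top cells. -/
def gen1 : ∀ (t : XIdx) (n : ℤ), G t n →ₗ[R] (modelCx G t).X (n + 1)
  | .im, _ => 0
  | .ker, n => LinearMap.inr R (G .ker (n + 1)) (G .ker (n + 1 - 1)) ∘ₗ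
      (eqToHom (congrArg (G .ker) (by omega : n = n + 1 - 1))).hom
  | .coker, _ => 0

/-- The inclusion of the summand of a cell. -/
def cellIn (t : S) : ∀ (_ : Bool) (n : ℤ), G t.1 n →ₗ[R] Tot (fun t : S => modelCx G t.1)
  | false, n => Tot.of (fun t : S => modelCx G t.1) t n ∘ₗ gen0 G t.1 n
  | true, n => Tot.of (fun t : S => modelCx G t.1) t (n + 1) ∘ₗ gen1 G t.1 n

/-- The complex `modelCx G` as a complex indexed by `S`. -/
abbrev modelS (S : Set XIdx) (G : XIdx → Gr.{u} R) (t : S) : Cx.{u} R := modelCx G t.1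

lemma of_cast_fst (h : XIdx.ker ∈ S) {n q : ℤ} (e : n = q) (g : G .ker n) :
    Tot.of (modelS S G) ⟨.ker, h⟩ q
      (((eqToHom (congrArg (G .ker) e)).hom g, 0) : G .ker q × G .ker (q - 1)) =
    Tot.of (modelS S G) ⟨.ker, h⟩ n ((g, 0) : G .ker n × G .ker (n - 1)) := by
  subst e; rfl

lemma of_cast_snd (h : XIdx.ker ∈ S) {n q : ℤ} (e : q = n) (e' : n - 1 = q - 1)
    (g : G .ker (n - 1)) :
    Tot.of (modelS S G) ⟨.ker, h⟩ q
      ((0, (eqToHom (congrArg (G .ker) e')).hom g) : G .ker q × G .ker (q - 1)) =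
    Tot.of (modelS S G) ⟨.ker, h⟩ n ((0, g) : G .ker n × G .ker (n - 1)) := by
  subst e; rfl

lemma d_cellIn_false (t : S) (n : ℤ) (g : G t.1 n) :
    Tot.d (modelS S G) (cellIn G t false n g) = 0 := by
  refine (Tot.d_of ..).trans ?_
  have : ((modelS S G t).d n (n - 1)).hom (gen0 G t.1 n g) = 0 := by
    obtain ⟨t, ht⟩ := t
    cases t
    · rfl
    · exact coneCx_d_apply n _
    · rfl
  rw [this, map_zero]

/-- The relation `d β = γ` with coefficients. The cast is due to the suspended group in degree `n +
1` being indexed by `n + 1 - 1`. -/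
lemma d_cellIn_true (h : XIdx.ker ∈ S) (n : ℤ) (g : G .ker n) :
    Tot.d (modelS S G) (cellIn G ⟨.ker, h⟩ true n g) = cellIn G ⟨.ker, h⟩ false n g := by
  refine (Tot.d_of ..).trans ?_
  rw [show ((modelS S G ⟨.ker, h⟩).d (n + 1) (n + 1 - 1)).hom (gen1 G .ker n g) = _ from
    coneCx_d_apply (G := G .ker) (n + 1) _]
  exact of_cast_fst G h (by omega) g

/-- The coordinates of an element of the complex `modelCx G t`. -/
def modelCoord : ∀ (t : S) (n : ℤ),
    (modelCx G t.1).X n →ₗ[R] ⨁ p : Cell S × ℤ, (G p.1.1.1.1 p.2 : Type u)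
  | ⟨.im, h⟩, n => DirectSum.lof R (Cell S × ℤ) (fun p => (G p.1.1.1.1 p.2 : Type u))
      (⟨(⟨.im, h⟩, false), by simp⟩, n)
  | ⟨.ker, h⟩, n =>
      DirectSum.lof R (Cell S × ℤ) (fun p => (G p.1.1.1.1 p.2 : Type u))
        (⟨(⟨.ker, h⟩, false), by simp⟩, n) ∘ₗ LinearMap.fst R (G .ker n) (G .ker (n - 1)) +
      DirectSum.lof R (Cell S × ℤ) (fun p => (G p.1.1.1.1 p.2 : Type u))
        (⟨(⟨.ker, h⟩, true), by simp⟩, n - 1) ∘ₗ LinearMap.snd R (G .ker n) (G .ker (n - 1))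
  | ⟨.coker, h⟩, n => DirectSum.lof R (Cell S × ℤ) (fun p => (G p.1.1.1.1 p.2 : Type u))
      (⟨(⟨.coker, h⟩, false), by simp⟩, n)

lemma modelCoord_ker (h : XIdx.ker ∈ S) (n : ℤ) (x : G .ker n) (y : G .ker (n - 1)) :
    modelCoord G ⟨.ker, h⟩ n ((x, y) : G .ker n × G .ker (n - 1)) =
      DirectSum.lof R (Cell S × ℤ) (fun p => (G p.1.1.1.1 p.2 : Type u))
        (⟨(⟨.ker, h⟩, false), by simp⟩, n) x +
      DirectSum.lof R (Cell S × ℤ) (fun p => (G p.1.1.1.1 p.2 : Type u))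
        (⟨(⟨.ker, h⟩, true), by simp⟩, n - 1) y := rfl

/-- The coordinates of an element of the total complex of `modelCx G`. -/
def totCoord : Tot (modelS S G) →ₗ[R] ⨁ p : Cell S × ℤ, (G p.1.1.1.1 p.2 : Type u) :=
  DirectSum.toModule R (S × ℤ) _ fun p => modelCoord G p.1 p.2

lemma totCoord_of (t : S) (n : ℤ) (x : (modelCx G t.1).X n) :
    totCoord G (Tot.of (modelS S G) t n x) = modelCoord G t n x :=
  DirectSum.toModule_lof ..

lemma lof_cast (h : XIdx.ker ∈ S) {n q : ℤ} (e : n = q) (g : G .ker n) :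
    DirectSum.lof R (Cell S × ℤ) (fun p => (G p.1.1.1.1 p.2 : Type u))
      (⟨(⟨.ker, h⟩, true), by simp⟩, q) ((eqToHom (congrArg (G .ker) e)).hom g) =
    DirectSum.lof R (Cell S × ℤ) (fun p => (G p.1.1.1.1 p.2 : Type u))
      (⟨(⟨.ker, h⟩, true), by simp⟩, n) g := by
  subst e; rfl

lemma totCoord_cellIn (c : Cell S) (n : ℤ) (g : G c.1.1.1 n) :
    totCoord G (cellIn G c.1.1 c.1.2 n g) =
      DirectSum.lof R (Cell S × ℤ) (fun p => (G p.1.1.1.1 p.2 : Type u)) (c, n) g := by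
  obtain ⟨⟨⟨t, ht⟩, b⟩, hb⟩ := c
  cases b
  · refine (totCoord_of ..).trans ?_
    cases t
    · rfl
    · refine (modelCoord_ker G ht n g 0).trans ?_
      rw [map_zero, add_zero]
    · rfl
  · obtain rfl : t = .ker := hb rfl
    refine (totCoord_of ..).trans ?_
    refine (modelCoord_ker G ht (n + 1) 0 _).trans ?_
    rw [map_zero, zero_add]
    exact lof_cast G ht (by omega) g

/-- The total complex of `modelCx G` as the sum of the groups of its cells. -/
def totCoordEquiv : Tot (modelS S G) ≃ₗ[R] ⨁ p : Cell S × ℤ, (G p.1.1.1.1 p.2 : Type u) :=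
  LinearEquiv.ofLinearMap (totCoord G)
    (DirectSum.toModule R (Cell S × ℤ) _ fun p => cellIn G p.1.1.1 p.1.1.2 p.2)
    (DirectSum.linearMap_ext R fun p => LinearMap.ext fun g => by
      simp only [LinearMap.comp_apply, DirectSum.toModule_lof, totCoord_cellIn, LinearMap.id_apply])
    (Tot.ext fun t n x => by
      rw [LinearMap.comp_apply, totCoord_of, LinearMap.id_apply]
      obtain ⟨t, ht⟩ := t
      cases t
      · exact DirectSum.toModule_lof ..
      · obtain ⟨x, y⟩ := x
        refine (congrArg _ (modelCoord_ker G ht n x y)).trans ?_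
        rw [map_add]
        refine (congrArg₂ (· + ·) (DirectSum.toModule_lof ..) (DirectSum.toModule_lof ..)).trans ?_
        refine (congrArg₂ (· + ·) rfl (of_cast_snd G ht (by omega) (by omega) y)).trans ?_
        refine (map_add (Tot.of (modelS S G) ⟨.ker, ht⟩ n) _ _).symm.trans ?_
        exact congrArg _ (Prod.ext (add_zero x) (zero_add y))
      · exact DirectSum.toModule_lof ..)

lemma totCoordEquiv_cellIn (c : Cell S) (n : ℤ) (g : G c.1.1.1 n) :
    totCoordEquiv G (cellIn G c.1.1 c.1.2 n g) =
      DirectSum.lof R (Cell S × ℤ) (fun p => (G p.1.1.1.1 p.2 : Type u)) (c, n) g :=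
  totCoord_cellIn G c n g

end Cells

end PolyProd

end

/-! ### Cells spanning a polyhedral product -/

noncomputable section

namespace PolyProd

variable {R : Type} [CommRing R]

section CellSupport

variable {S : Set XIdx} (G : XIdx → Gr.{u} R)

/-- The inclusions of the base complexes, indexed by `S`. -/
abbrev baseS (S : Set XIdx) (G : XIdx → Gr.{u} R) (t : S) : baseCx G t.1 ⟶ modelS S G t :=
  baseIncl G t.1

lemma lof_apply_ne {κ : Type*} [DecidableEq κ] {M : κ → Type*} [∀ i, AddCommGroup (M i)]
    [∀ i, Module R (M i)] {i j : κ} (h : i ≠ j) (x : M i) : DirectSum.lof R κ M i x j = 0 :=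
  DirectSum.of_eq_of_ne i j x h.symm

/-- An element of degree `n` has a `β`-coordinate only with coefficient degree `n - 1`; the other
cells have dimension `0` and coefficient degree `n`. -/
lemma totCoordEquiv_of_eq_zero (t : S) (n : ℤ) (x : (modelCx G t.1).X n) (p : Cell S × ℤ)
    (h : ¬(p.1.1.1 = t ∧ p.2 + bdeg p.1.1.2 = n)) :
    totCoordEquiv G (Tot.of (modelS S G) t n x) p = 0 := by
  change totCoord G (Tot.of (modelS S G) t n x) p = 0
  rw [totCoord_of]
  obtain ⟨t, ht⟩ := t
  cases t
  · refine lof_apply_ne ?_ _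
    rintro rfl
    exact h ⟨rfl, by simp [bdeg]⟩
  · obtain ⟨x, y⟩ := x
    rw [modelCoord_ker, DirectSum.add_apply, lof_apply_ne, lof_apply_ne, add_zero]
    · rintro rfl
      exact h ⟨rfl, by simp [bdeg]⟩
    · rintro rfl
      exact h ⟨rfl, by simp [bdeg]⟩
  · refine lof_apply_ne ?_ _
    rintro rfl
    exact h ⟨rfl, by simp [bdeg]⟩

/-- The base contains only `η` and `γ` coordinates. With the converse `cellIn_mem_base`, the
subcomplex is seen to be spanned by whole cell summands. -/
lemma totCoordEquiv_base_eq_zero (p : Cell S × ℤ) (hp : p.1.IsUpper)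
    (x : Tot (modelS S G)) (hx : x ∈ LinearMap.range (Tot.map (baseS S G))) :
    totCoordEquiv G x p = 0 := by
  obtain ⟨y, rfl⟩ := hx
  induction y using DirectSum.induction_on with
  | zero => rw [map_zero, map_zero]; rfl
  | add x y hx hy => rw [map_add, map_add, DirectSum.add_apply, hx, hy, add_zero]
  | of q y =>
    obtain ⟨⟨t, ht⟩, n⟩ := q
    refine (congrArg (fun z => totCoordEquiv G z p)
      (Tot.map_of (baseS S G) ⟨t, ht⟩ n y)).trans ?_
    change totCoord G (Tot.of (modelS S G) ⟨t, ht⟩ n _) p = 0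
    rw [totCoord_of]
    cases t
    · refine lof_apply_ne ?_ _
      rintro rfl
      simp [Cell.IsUpper] at hp
    · refine (congrArg (fun w => w p) (modelCoord_ker G ht n y 0)).trans ?_
      rw [map_zero, add_zero]
      refine lof_apply_ne ?_ _
      rintro rfl
      simp [Cell.IsUpper] at hp
    · change modelCoord G ⟨.coker, ht⟩ n 0 p = 0
      rw [map_zero]
      rfl

lemma cellIn_mem_base (c : Cell S) (hc : ¬c.IsUpper) (n : ℤ) (g : G c.1.1.1 n) :
    cellIn G c.1.1 c.1.2 n g ∈ LinearMap.range (Tot.map (baseS S G)) := by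
  obtain ⟨⟨⟨t, ht⟩, b⟩, hb⟩ := c
  cases b
  · cases t
    · exact ⟨Tot.of (fun t : S => baseCx G t.1) ⟨.im, ht⟩ n g,
        Tot.map_of (baseS S G) ⟨.im, ht⟩ n g⟩
    · exact ⟨Tot.of (fun t : S => baseCx G t.1) ⟨.ker, ht⟩ n g,
        Tot.map_of (baseS S G) ⟨.ker, ht⟩ n g⟩
    · exact absurd (Or.inr rfl) hc
  · exact absurd (Or.inl rfl) hc

lemma cellIn_eq_of (t : S) (b : Bool) (n : ℤ) (g : G t.1 n) :
    ∃ x : (modelS S G t).X (n + bdeg b), cellIn G t b n g = Tot.of (modelS S G) t _ x := by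
  cases b
  · have key : ∀ q, q = n → ∃ x : (modelS S G t).X q,
        cellIn G t false n g = Tot.of (modelS S G) t q x := by
      rintro _ rfl
      exact ⟨_, rfl⟩
    exact key _ (add_zero n)
  · exact ⟨_, rfl⟩

end CellSupport

section MultiCells

variable {m : ℕ} {S : Set XIdx} (G : Fin m → XIdx → Gr.{u} R)

/-- The complexes `modelCx (G k)` as a family of complexes indexed by `S`. -/
abbrev modelF (S : Set XIdx) (G : Fin m → XIdx → Gr.{u} R) (k : Fin m) (t : S) : Cx.{u} R :=
  modelCx (G k) t.1

/-- The inclusions of the base complexes, as a family. -/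
abbrev baseF (S : Set XIdx) (G : Fin m → XIdx → Gr.{u} R) (k : Fin m) (t : S) :
    baseCx (G k) t.1 ⟶ modelF S G k t :=
  baseIncl (G k) t.1

/-- The tensor product of the complexes `modelCx (G k)` as the sum of the groups of its cells. -/
def tensCoord : Tens (modelF S G) ≃ₗ[R]
    ⨁ p : Fin m → Cell S × ℤ, ⨂[R] k, (G k (p k).1.1.1.1 (p k).2 : Type u) :=
  (PiTensorProduct.congr fun k => totCoordEquiv (S := S) (G k)) ≪≫ₗ
    PiTensorProduct.ofDirectSumEquiv

lemma tensCoord_tprod (x : ∀ k, Tot (modelS S (G k))) (p : Fin m → Cell S × ℤ) :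
    tensCoord G (PiTensorProduct.tprod R x) p =
      PiTensorProduct.tprod R fun k => totCoordEquiv (G k) (x k) (p k) := by
  simp only [tensCoord, LinearEquiv.trans_apply, PiTensorProduct.congr_tprod]
  exact PiTensorProduct.ofDirectSumEquiv_tprod_apply _ _

/-- The tensor product of elements of cells. -/
def cellTens (p : Fin m → Cell S × ℤ) (y : ∀ k, G k (p k).1.1.1.1 (p k).2) :
    Tens (modelF S G) :=
  PiTensorProduct.tprod R fun k => cellIn (G k) (p k).1.1.1 (p k).1.1.2 (p k).2 (y k)

lemma tensCoord_cellTens (p : Fin m → Cell S × ℤ) (y : ∀ k, G k (p k).1.1.1.1 (p k).2) :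
    tensCoord G (cellTens G p y) =
      DirectSum.lof R (Fin m → Cell S × ℤ)
        (fun p => ⨂[R] k, (G k (p k).1.1.1.1 (p k).2 : Type u)) p (PiTensorProduct.tprod R y) := by
  simp only [tensCoord, LinearEquiv.trans_apply, cellTens, PiTensorProduct.congr_tprod,
    totCoordEquiv_cellIn]
  exact PiTensorProduct.ofDirectSumEquiv_tprod_lof _ _

/-- The positions of the upper cells. -/
def upperSet (p : Fin m → Cell S) : Finset (Fin m) := Finset.univ.filter fun k => (p k).IsUpper

/-- The dimension of a product of cells. -/
def cellDim (p : Fin m → Cell S) : ℤ := ∑ k, bdeg (p k).1.2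

/-- A product of cells, with given degrees, belongs to the part of degree `n` and index in `P` of
the polyhedral product over `K`. -/
def Admissible (K : LowerSet (Finset (Fin m))) (P : Set (Fin m → S)) (n : ℤ)
    (p : Fin m → Cell S × ℤ) : Prop :=
  upperSet (fun k => (p k).1) ∈ K ∧ (fun k => (p k).1.1.1) ∈ P ∧
    cellDim (fun k => (p k).1) + ∑ k, (p k).2 = n

lemma cellTens_mem (K : LowerSet (Finset (Fin m))) (P : Set (Fin m → S)) (n : ℤ)
    (p : Fin m → Cell S × ℤ) (hp : Admissible K P n p) (y : ∀ k, G k (p k).1.1.1.1 (p k).2) :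
    cellTens G p y ∈ polySub K (baseF S G) ⊓ tensGr (modelF S G) P n := by
  obtain ⟨h1, h2, h3⟩ := hp
  constructor
  · refine (le_iSup₂_of_le (f := fun τ (_ : τ ∈ K) => faceSub (baseF S G) τ) _ h1 le_rfl) ?_
    refine Submodule.subset_span ⟨_, fun k hk => ?_, rfl⟩
    exact cellIn_mem_base (G k) (p k).1 (by simpa [upperSet] using hk) _ _
  · have := fun k => cellIn_eq_of (G k) (p k).1.1.1 (p k).1.1.2 (p k).2 (y k)
    choose x hx using this
    refine Submodule.subset_span ⟨_, h2, _, ?_, x, congrArg _ (funext hx)⟩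
    rw [Finset.sum_add_distrib, add_comm]
    exact h3

/-- Let `τ` be a simplex of `K`. Since `K` is closed under subsets, the upper positions of `p` are
not all in `τ`, so some slot outside `τ` has an upper cell. There the factor lies in the base and
has coordinate zero. -/
lemma tensCoord_eq_zero_of_polySub (K : LowerSet (Finset (Fin m))) (p : Fin m → Cell S × ℤ)
    (hp : upperSet (fun k => (p k).1) ∉ K) {z : Tens (modelF S G)}
    (hz : z ∈ polySub K (baseF S G)) : tensCoord G z p = 0 := by
  have h : polySub K (baseF S G) ≤ LinearMap.ker
      (DirectSum.component R _ (fun p : Fin m → Cell S × ℤ =>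
        ⨂[R] k, (G k (p k).1.1.1.1 (p k).2 : Type u)) p ∘ₗ (tensCoord G).toLinearMap) := by
    refine iSup₂_le fun τ hτ => Submodule.span_le.2 ?_
    rintro _ ⟨x, hx, rfl⟩
    have hsub : ¬upperSet (fun k => (p k).1) ⊆ τ := fun h => hp (K.lower h hτ)
    obtain ⟨k, hk, hkτ⟩ := Finset.not_subset.1 hsub
    refine (tensCoord_tprod G x p).trans ((PiTensorProduct.tprod R).map_coord_zero k ?_)
    exact totCoordEquiv_base_eq_zero (G k) (p k) (by simpa [upperSet] using hk) _ (hx k hkτ)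
  exact h hz

lemma tensCoord_eq_zero_of_tensGr (P : Set (Fin m → S)) (n : ℤ) (p : Fin m → Cell S × ℤ)
    (hp : ¬((fun k => (p k).1.1.1) ∈ P ∧ cellDim (fun k => (p k).1) + ∑ k, (p k).2 = n))
    {z : Tens (modelF S G)} (hz : z ∈ tensGr (modelF S G) P n) : tensCoord G z p = 0 := by
  have h : tensGr (modelF S G) P n ≤ LinearMap.ker
      (DirectSum.component R _ (fun p : Fin m → Cell S × ℤ =>
        ⨂[R] k, (G k (p k).1.1.1.1 (p k).2 : Type u)) p ∘ₗ (tensCoord G).toLinearMap) := by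
    refine Submodule.span_le.2 ?_
    rintro _ ⟨i, hi, j, hj, x, rfl⟩
    obtain ⟨k, hk⟩ : ∃ k, ¬((p k).1.1.1 = i k ∧ (p k).2 + bdeg (p k).1.1.2 = j k) := by
      by_contra! hall
      refine hp ⟨?_, ?_⟩
      · rw [show (fun k => (p k).1.1.1) = i from funext fun k => (hall k).1]
        exact hi
      · rw [cellDim, ← Finset.sum_add_distrib, ← hj]
        exact Finset.sum_congr rfl fun k _ => by rw [← (hall k).2, add_comm]
    refine (tensCoord_tprod G _ p).trans ((PiTensorProduct.tprod R).map_coord_zero k ?_)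
    exact totCoordEquiv_of_eq_zero (G k) (i k) (j k) (x k) (p k) hk
  exact h hz

/-- A polyhedral product of model complexes is spanned by its cells. -/
theorem polySub_inf_tensGr_eq_span (K : LowerSet (Finset (Fin m))) (P : Set (Fin m → S)) (n : ℤ) :
    polySub K (baseF S G) ⊓ tensGr (modelF S G) P n =
      Submodule.span R {z | ∃ p, Admissible K P n p ∧ ∃ y, z = cellTens G p y} := by
  classical
  refine le_antisymm (fun z hz => ?_) (Submodule.span_le.2 ?_)
  · have hz0 : ∀ p, ¬Admissible K P n p → tensCoord G z p = 0 := by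
      intro p hp
      by_cases h1 : upperSet (fun k => (p k).1) ∈ K
      · exact tensCoord_eq_zero_of_tensGr G P n p (fun h => hp ⟨h1, h⟩) hz.2
      · exact tensCoord_eq_zero_of_polySub G K p h1 hz.1
    have hw : ∀ p, Admissible K P n p → ∀ w, (tensCoord G).symm (DirectSum.lof R
        (Fin m → Cell S × ℤ) (fun p => ⨂[R] k, (G k (p k).1.1.1.1 (p k).2 : Type u)) p w) ∈
        Submodule.span R {z | ∃ p, Admissible K P n p ∧ ∃ y, z = cellTens G p y} := by
      intro p hp w
      induction w using PiTensorProduct.induction_on with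
      | smul_tprod r y =>
        rw [map_smul, map_smul, ← tensCoord_cellTens, LinearEquiv.symm_apply_apply]
        exact Submodule.smul_mem _ _ (Submodule.subset_span ⟨p, hp, y, rfl⟩)
      | add x y hx hy => rw [map_add, map_add]; exact add_mem hx hy
    have e : z = (tensCoord G).symm (tensCoord G z) := ((tensCoord G).symm_apply_apply z).symm
    rw [e, ← DirectSum.sum_support_of (tensCoord G z), map_sum]
    refine Submodule.sum_mem _ fun p _ => ?_
    by_cases hp : Admissible K P n p
    · exact hw p hp _
    · rw [hz0 p hp, map_zero, map_zero]
      exact zero_mem _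
  · rintro _ ⟨p, hp, y, rfl⟩
    exact cellTens_mem G K P n p hp y

end MultiCells

end PolyProd

end

/-! ### Signs, and the cells with unit coefficients -/

noncomputable section

namespace PolyProd

variable {R : Type} [CommRing R]

section Sign

/-- The sign `(-1) ^ n` as an element of `R`. -/
def sg (R : Type) [CommRing R] (n : ℤ) : R := ((n.negOnePow : ℤ) : R)

lemma sg_add (a b : ℤ) : sg R (a + b) = sg R a * sg R b := by
  simp [sg, Int.negOnePow_add]

lemma sg_zero : sg R 0 = 1 := by simp [sg]

lemma sg_mul_self (a : ℤ) : sg R a * sg R a = 1 := by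
  rw [sg, ← Int.cast_mul, ← Units.val_mul, Int.units_mul_self]; simp

lemma sg_sum {α : Type*} (s : Finset α) (f : α → ℤ) : sg R (∑ a ∈ s, f a) = ∏ a ∈ s, sg R (f a) := by
  classical
  induction s using Finset.induction_on with
  | empty => simp [sg_zero]
  | insert a s ha ih => rw [Finset.sum_insert ha, Finset.prod_insert ha, sg_add, ih]

/-- The sum of the entries before `k`. -/
def preSum {m : ℕ} (i : Fin m → ℤ) (k : Fin m) : ℤ := ∑ l ∈ Finset.univ.filter (· < k), i l

/-- In the `k`-th term of the differential, the slots before `k` contribute the signs of the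
coefficient degrees, and slot `k` contributes the exchange sign, which is their product. Being
equal, they cancel. -/
lemma prod_factor_sign {m : ℕ} (i : Fin m → ℤ) (k : Fin m) :
    ∏ l, (if l < k then sg R (i l) else if l = k then sg R (preSum i k) else 1) = 1 := by
  rw [Finset.prod_ite, Finset.prod_ite_eq' , if_pos (by simp), preSum, sg_sum, ← sg_sum, sg_mul_self]

/-- The sign of an exchange of a cell and an element of degree `a`. -/
def exSign (R : Type) [CommRing R] (a : ℤ) (b : Bool) : R := if b then sg R a else 1

lemma exSign_mul_self (a : ℤ) (b : Bool) : exSign R a b * exSign R a b = 1 := by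
  cases b <;> simp [exSign, sg_mul_self]

end Sign

section UnitCells

variable {S : Set XIdx}

/-- The generator of the unit graded group. -/
def unitOne (R : Type) [CommRing R] : unitGr R 0 := ⟨1, by simp⟩

lemma unitGr_eq_zero {n : ℤ} (hn : n ≠ 0) (y : unitGr R n) : y = 0 := by
  obtain ⟨y, hy⟩ := y
  rw [if_neg hn] at hy
  exact Subtype.ext hy

/-- The coefficient of an element of the degree `0` part of the unit graded group. -/
def unitVal (R : Type) [CommRing R] : unitGr R 0 →ₗ[R] R :=
  Submodule.subtype (if (0 : ℤ) = 0 then ⊤ else ⊥ : Submodule R R)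

lemma unitVal_smul (y : unitGr R 0) : unitVal R y • unitOne R = y :=
  Subtype.ext (mul_one _)

lemma unitVal_one : unitVal R (unitOne R) = 1 := rfl

/-- The constant family of unit graded groups. -/
abbrev unitFam (R : Type) [CommRing R] : XIdx → Gr.{0} R := fun _ => unitGr R

/-- The generator of a cell of the unit complexes. -/
def ucell (R : Type) [CommRing R] (c : Cell S) : Tot (modelS S (unitFam R)) :=
  cellIn (unitFam R) c.1.1 c.1.2 0 (unitOne R)

/-- The coefficient of a cell. -/
def unitCoef (R : Type) [CommRing R] (t : S) (b : Bool) : Tot (modelS S (unitFam R)) →ₗ[R] R :=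
  if h : b = true → t.1 = XIdx.ker then
    unitVal R ∘ₗ DirectSum.component R (Cell S × ℤ) (fun p => (unitGr R p.2 : Type)) (⟨(t, b), h⟩, 0)
      ∘ₗ (totCoordEquiv (S := S) (unitFam R)).toLinearMap
  else 0

/-- Only the boolean has to be compared, since the coefficient is read at the index of the cell
itself. -/
lemma unitCoef_ucell (c : Cell S) (b : Bool) :
    unitCoef R c.1.1 b (ucell R c) = if b = c.1.2 then 1 else 0 := by
  obtain ⟨⟨t, b'⟩, hb'⟩ := c
  unfold unitCoef
  split_ifs with h1 h2 h2
  · have h2' : b = b' := h2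
    subst h2'
    refine (congrArg (fun w => unitVal R (w (⟨(t, b), h1⟩, 0)))
      (totCoordEquiv_cellIn (unitFam R) ⟨(t, b), hb'⟩ 0 (unitOne R))).trans ?_
    exact (congrArg (unitVal R) (DirectSum.lof_apply (ι := Cell S × ℤ)
      (M := fun p => (unitGr R p.2 : Type)) R (⟨(t, b), h1⟩, 0) (unitOne R))).trans unitVal_one
  · refine (congrArg (fun w => unitVal R (w (⟨(t, b), h1⟩, 0)))
      (totCoordEquiv_cellIn (unitFam R) ⟨(t, b'), hb'⟩ 0 (unitOne R))).trans ?_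
    refine (congrArg (unitVal R) (lof_apply_ne (κ := Cell S × ℤ)
      (M := fun p => (unitGr R p.2 : Type)) ?_ _)).trans (map_zero _)
    intro e
    apply h2
    simpa using (congrArg (fun q : Cell S × ℤ => q.1.1.2) e).symm
  · exact absurd (h2 ▸ hb') h1
  · rfl

variable (G : XIdx → Gr.{u} R)

/-- Multiplication of the cells of index `t` by an element of `G t i`, twisted by a sign. -/
def mulCell (a : ℤ) (t : S) (i : ℤ) :
    G t.1 i →ₗ[R] Tot (modelS S (unitFam R)) →ₗ[R] Tot (modelS S G) :=
  LinearMap.mk₂ R (fun g z => ∑ b : Bool, (exSign R a b * unitCoef R t b z) • cellIn G t b i g)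
    (fun g g' z => by simp only [map_add, smul_add, Finset.sum_add_distrib])
    (fun c g z => by simp only [map_smul, Finset.smul_sum, smul_comm c])
    (fun g z z' => by simp only [map_add, mul_add, add_smul, Finset.sum_add_distrib])
    (fun c g z => by
      simp only [map_smul, Finset.smul_sum, smul_smul, smul_eq_mul, mul_left_comm c])

lemma mulCell_ucell (a : ℤ) (c : Cell S) (i : ℤ) (g : G c.1.1.1 i) :
    mulCell G a c.1.1 i g (ucell R c) = exSign R a c.1.2 • cellIn G c.1.1 c.1.2 i g := by
  simp only [mulCell, LinearMap.mk₂_apply, unitCoef_ucell]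
  rw [Finset.sum_eq_single c.1.2]
  · rw [if_pos rfl, mul_one]
  · intro b _ hb
    rw [if_neg hb, mul_zero, zero_smul]
  · intro h
    exact absurd (Finset.mem_univ _) h

lemma sign_cellIn (t : S) (b : Bool) (n : ℤ) (g : G t.1 n) :
    Tot.sign (modelS S G) (cellIn G t b n g) = sg R (n + bdeg b) • cellIn G t b n g := by
  obtain ⟨x, hx⟩ := cellIn_eq_of G t b n g
  rw [hx, Tot.sign_of]
  rfl

/-- The coefficient adds `i` to the degree of the cell. -/
lemma sign_mulCell (a : ℤ) (c : Cell S) (i : ℤ) (g : G c.1.1.1 i) :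
    Tot.sign (modelS S G) (mulCell G a c.1.1 i g (ucell R c)) =
      sg R i • mulCell G a c.1.1 i g (Tot.sign (modelS S (unitFam R)) (ucell R c)) := by
  have h : Tot.sign (modelS S (unitFam R)) (ucell R c) = sg R (bdeg c.1.2) • ucell R c :=
    (sign_cellIn (unitFam R) c.1.1 c.1.2 0 (unitOne R)).trans (by rw [zero_add]; rfl)
  rw [h, map_smul, mulCell_ucell, map_smul, sign_cellIn, sg_add, smul_smul, smul_smul, smul_smul]
  congr 1
  ring

/-- The exchange sign is present for `β` but not for its boundary `γ`; this accounts for the factor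
`sg R a`. -/
lemma d_mulCell (a : ℤ) (c : Cell S) (i : ℤ) (g : G c.1.1.1 i) :
    Tot.d (modelS S G) (mulCell G a c.1.1 i g (ucell R c)) =
      sg R a • mulCell G a c.1.1 i g (Tot.d (modelS S (unitFam R)) (ucell R c)) := by
  rw [mulCell_ucell, map_smul]
  obtain ⟨⟨⟨t, ht⟩, b⟩, hb⟩ := c
  cases b
  · rw [d_cellIn_false]
    rw [show Tot.d (modelS S (unitFam R)) (ucell R ⟨(⟨t, ht⟩, false), hb⟩) = 0 from
      d_cellIn_false (unitFam R) ⟨t, ht⟩ 0 (unitOne R), map_zero, smul_zero, smul_zero]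
  · obtain rfl : t = .ker := hb rfl
    have h1 : Tot.d (modelS S (unitFam R)) (ucell R ⟨(⟨.ker, ht⟩, true), hb⟩) =
        ucell R ⟨(⟨.ker, ht⟩, false), by simp⟩ := d_cellIn_true (unitFam R) ht 0 (unitOne R)
    have h2 := mulCell_ucell G a ⟨(⟨.ker, ht⟩, false), by simp⟩ i g
    rw [h1]
    refine Eq.trans ?_ (congrArg (sg R a • ·) h2).symm
    rw [d_cellIn_true G ht i g]
    simp [exSign]

end UnitCells

end PolyProd

end

/-! ### Separation of cells and coefficients -/

noncomputable section

namespace PolyProd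

variable {R : Type} [CommRing R]

section Split

variable {m : ℕ} {S : Set XIdx}

/-- The generator of a product of cells. -/
def tcell (R : Type) [CommRing R] (c : Fin m → Cell S) :
    Tens (modelF S fun _ : Fin m => unitFam R) :=
  PiTensorProduct.tprod R fun k => ucell R (c k)

/-- A product of cells belongs to the part of degree `n` and index in `P` over `K`. -/
def CellAdmissible (K : LowerSet (Finset (Fin m))) (P : Set (Fin m → S)) (n : ℤ)
    (c : Fin m → Cell S) : Prop :=
  upperSet c ∈ K ∧ (fun k => (c k).1.1) ∈ P ∧ cellDim c = n

lemma tcell_mem (K : LowerSet (Finset (Fin m))) (P : Set (Fin m → S)) (n : ℤ)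
    (c : Fin m → Cell S) (hc : CellAdmissible K P n c) :
    tcell R c ∈ polySub K (baseF S fun _ => unitFam R) ⊓ tensGr (modelF S fun _ => unitFam R) P n :=
  cellTens_mem (fun _ => unitFam R) K P n (fun k => (c k, 0))
    ⟨hc.1, hc.2.1, by simpa using hc.2.2⟩ fun _ => unitOne R

/-- With unit coefficients, a product of cells vanishes unless all coefficient degrees are `0`, and
then it is a multiple of the generator. So only finitely many generators are left. -/
theorem polySub_unit_eq_span (K : LowerSet (Finset (Fin m))) (P : Set (Fin m → S)) (n : ℤ) :
    polySub K (baseF S fun _ => unitFam R) ⊓ tensGr (modelF S fun _ => unitFam R) P n =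
      Submodule.span R {z | ∃ c, CellAdmissible K P n c ∧ z = tcell R c} := by
  refine le_antisymm ?_ (Submodule.span_le.2 ?_)
  · rw [polySub_inf_tensGr_eq_span, Submodule.span_le]
    rintro _ ⟨p, hp, y, rfl⟩
    by_cases h0 : ∀ k, (p k).2 = 0
    · obtain ⟨c, rfl⟩ : ∃ c : Fin m → Cell S, p = fun k => (c k, 0) :=
        ⟨fun k => (p k).1, funext fun k => Prod.ext rfl (h0 k)⟩
      have e : cellTens (fun _ => unitFam R) (fun k => (c k, 0)) y =
          (∏ k, unitVal R (y k)) • tcell R c := by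
        rw [tcell, ← MultilinearMap.map_smul_univ]
        refine congrArg (PiTensorProduct.tprod R) (funext fun k => ?_)
        refine Eq.trans ?_ (map_smul (cellIn (unitFam R) (c k).1.1 (c k).1.2 0) _ _)
        exact congrArg _ (unitVal_smul (y k)).symm
      rw [e]
      exact Submodule.smul_mem _ _ (Submodule.subset_span
        ⟨c, ⟨hp.1, hp.2.1, by simpa using hp.2.2⟩, rfl⟩)
    · push Not at h0
      obtain ⟨k, hk⟩ := h0
      have e : cellTens (fun _ => unitFam R) p y = 0 := by
        refine (PiTensorProduct.tprod R).map_coord_zero k ?_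
        rw [unitGr_eq_zero hk (y k), map_zero]
      rw [e]
      exact zero_mem _
  · rintro _ ⟨c, hc, rfl⟩
    exact tcell_mem K P n c hc

/-- The generator of a product of cells, in the total complex. -/
def totalCell (R : Type) [CommRing R] (K : LowerSet (Finset (Fin m))) {s : Fin m → S} {n : ℤ}
    (c : Fin m → Cell S) (hc : CellAdmissible K {s} n c) : (totalCx R S K s).X n :=
  ⟨tcell R c, tcell_mem K {s} n c hc⟩

lemma totalCx_ext (K : LowerSet (Finset (Fin m))) {s : Fin m → S} {n : ℤ} {M : Type*}
    [AddCommGroup M] [Module R M] {f g : (totalCx R S K s).X n →ₗ[R] M}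
    (h : ∀ c hc, f (totalCell R K c hc) = g (totalCell R K c hc)) : f = g := by
  refine LinearMap.ext fun ⟨z, hz⟩ => ?_
  have hz' := hz
  rw [show (polySub K (fun k (t : S) => unitIncl R t.1) ⊓ tensGr
    (modelF S fun _ : Fin m => unitFam R) {s} n) = _ from polySub_unit_eq_span K {s} n] at hz'
  induction hz' using Submodule.span_induction with
  | mem z hz₁ =>
    obtain ⟨c, hc, rfl⟩ := hz₁
    exact h c hc
  | zero => exact (map_zero f).trans (map_zero g).symm
  | add x y hx hy ihx ihy =>
    rw [← polySub_unit_eq_span] at hx hy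
    exact (map_add f ⟨x, hx⟩ ⟨y, hy⟩).trans
      ((congrArg₂ (· + ·) (ihx hx) (ihy hy)).trans (map_add g ⟨x, hx⟩ ⟨y, hy⟩).symm)
  | smul r x hx ih =>
    rw [← polySub_unit_eq_span] at hx
    exact (map_smul f r ⟨x, hx⟩).trans
      ((congrArg (r • ·) (ih hx)).trans (map_smul g r ⟨x, hx⟩).symm)

variable (G : Fin m → XIdx → Gr.{u} R)

/-- Multiplication of products of cells of index `s` by elements of `⨂ G k (s k)`. -/
def mulTens (s : Fin m → S) (i : Fin m → ℤ) : (⨂[R] k, (G k (s k).1 (i k) : Type u)) →ₗ[R]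
    Tens (modelF S fun _ : Fin m => unitFam R) →ₗ[R] Tens (modelF S G) :=
  PiTensorProduct.map₂ fun k => mulCell (G k) (preSum i k) (s k) (i k)

/-- The sign of the exchange of a product of cells and elements of degrees `i`. -/
def cellSign (R : Type) [CommRing R] (p : Fin m → Cell S × ℤ) : R :=
  ∏ k, exSign R (preSum (fun k => (p k).2) k) (p k).1.1.2

lemma cellSign_mul_self (p : Fin m → Cell S × ℤ) : cellSign R p * cellSign R p = 1 := by
  rw [cellSign, ← Finset.prod_mul_distrib]
  exact Finset.prod_eq_one fun k _ => exSign_mul_self _ _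

lemma mulTens_tcell (p : Fin m → Cell S × ℤ) (y : ∀ k, G k (p k).1.1.1.1 (p k).2) :
    mulTens G (fun k => (p k).1.1.1) (fun k => (p k).2) (PiTensorProduct.tprod R y)
      (tcell R fun k => (p k).1) = cellSign R p • cellTens G p y := by
  refine (PiTensorProduct.map₂_tprod_tprod ..).trans ?_
  rw [cellSign, cellTens, ← MultilinearMap.map_smul_univ]
  exact congrArg _ (funext fun k => mulCell_ucell (G k) _ (p k).1 (p k).2 (y k))

/-- This is what the exchange signs are for: multiplication by coefficients commutes with the
differential with no sign left. Slot by slot, `sign_mulCell` and `d_mulCell` give signs whose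
product is `1` by `prod_factor_sign`. -/
lemma tensD_mulTens (p : Fin m → Cell S × ℤ) (y : ∀ k, G k (p k).1.1.1.1 (p k).2) :
    tensD (modelF S G) (mulTens G (fun k => (p k).1.1.1) (fun k => (p k).2)
      (PiTensorProduct.tprod R y) (tcell R fun k => (p k).1)) =
    mulTens G (fun k => (p k).1.1.1) (fun k => (p k).2) (PiTensorProduct.tprod R y)
      (tensD (modelF S fun _ => unitFam R) (tcell R fun k => (p k).1)) := by
  rw [tcell, tensD_tprod, map_sum]
  refine (congrArg (tensD (modelF S G)) (PiTensorProduct.map₂_tprod_tprod ..)).trans ?_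
  rw [tensD_tprod]
  refine Finset.sum_congr rfl fun k _ => ?_
  refine Eq.trans ?_ (PiTensorProduct.map₂_tprod_tprod ..).symm
  refine Eq.trans (congrArg (PiTensorProduct.tprod R) (funext fun l => ?_))
    ((MultilinearMap.map_smul_univ (PiTensorProduct.tprod R) (fun l =>
      if l < k then sg R (p l).2 else if l = k then sg R (preSum (fun k => (p k).2) k) else 1)
      _).trans ((congrArg (· • _) (prod_factor_sign (fun k => (p k).2) k)).trans (one_smul R _)))
  unfold tensFactor
  split_ifs with h1 h2
  · exact sign_mulCell (G l) _ (p l).1 (p l).2 (y l)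
  · subst h2
    exact d_mulCell (G l) _ (p l).1 (p l).2 (y l)
  · exact (one_smul R _).symm

/-- The sum of the complexes `T^s ⊗ (⨂ G k (s k))`. -/
abbrev splitCx (S : Set XIdx) (K : LowerSet (Finset (Fin m))) (G : Fin m → XIdx → Gr.{u} R) :
    Cx.{u} R :=
  sumCx fun s : Fin m → S => pairCx (totalCx R S K s) (multiGr fun k => G k (s k).1)

variable (K : LowerSet (Finset (Fin m)))

/-- Multiplication of cells by elements, on a summand. -/
def mulSummand (s : Fin m → S) (n j : ℤ) :
    ((totalCx R S K s).X (n - j) ⊗[R] multiGr (fun k => G k (s k).1) j) →ₗ[R]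
      Tens (modelF S G) :=
  TensorProduct.lift (LinearMap.flip (DirectSum.toModule R {i : Fin m → ℤ // ∑ k, i k = j} _
    fun i => LinearMap.lcomp R (Tens (modelF S G)) (Submodule.subtype
      (polySub K (baseF S fun _ => unitFam R) ⊓
        tensGr (modelF S fun _ => unitFam R) {s} (n - j))) ∘ₗ mulTens G s i.1))

/-- Multiplication of cells by elements. -/
def mulSum (n : ℤ) : (splitCx S K G).X n →ₗ[R] Tens (modelF S G) :=
  DirectSum.toModule R (Fin m → S) _ fun s => DirectSum.toModule R ℤ _ fun j =>
    mulSummand G K s n j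

variable {K} in
lemma Admissible.cellAdmissible {P : Set (Fin m → S)} {n : ℤ} {p : Fin m → Cell S × ℤ}
    (hp : Admissible K P n p) :
    CellAdmissible K {fun k => (p k).1.1.1} (n - ∑ k, (p k).2) fun k => (p k).1 :=
  ⟨hp.1, rfl, by have := hp.2.2; omega⟩

/-- The inclusion of the summand of a product of cells. -/
def splitIn (s : Fin m → S) (n : ℤ) (i : Fin m → ℤ) (z : (totalCx R S K s).X (n - ∑ k, i k)) :
    (⨂[R] k, (G k (s k).1 (i k) : Type u)) →ₗ[R] (splitCx S K G).X n :=
  DirectSum.lof R (Fin m → S)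
      (fun s => ((pairCx (totalCx R S K s) (multiGr fun k => G k (s k).1)).X n : Type u)) s ∘ₗ
    DirectSum.lof R ℤ (fun j => (totalCx R S K s).X (n - j) ⊗[R]
      (multiGr (fun k => G k (s k).1) j : Type u)) (∑ k, i k) ∘ₗ
    TensorProduct.mk R _ (multiGr (fun k => G k (s k).1) (∑ k, i k)) z ∘ₗ
    DirectSum.lof R {i' : Fin m → ℤ // ∑ k, i' k = ∑ k, i k}
      (fun i' => ⨂[R] k, (G k (s k).1 (i'.1 k) : Type u)) ⟨i, rfl⟩

/-- The total complex is spanned by cells and the coefficient group by pure tensors, and a cell with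
its coefficient degrees is exactly an admissible `p`. The version for a single summand is needed to
compare the index sets. -/
lemma splitCx_ext_lof (n : ℤ) {M : Type*} [AddCommGroup M] [Module R M]
    {f g : (splitCx S K G).X n →ₗ[R] M} (s : Fin m → S)
    (h : ∀ p (hp : Admissible K {s} n p) y,
      f (splitIn G K _ n _ (totalCell R K _ hp.cellAdmissible) (PiTensorProduct.tprod R y)) =
      g (splitIn G K _ n _ (totalCell R K _ hp.cellAdmissible) (PiTensorProduct.tprod R y))) :
    f ∘ₗ DirectSum.lof R (Fin m → S)
      (fun s => ((pairCx (totalCx R S K s) (multiGr fun k => G k (s k).1)).X n : Type u)) s =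
    g ∘ₗ DirectSum.lof R (Fin m → S)
      (fun s => ((pairCx (totalCx R S K s) (multiGr fun k => G k (s k).1)).X n : Type u)) s := by
  refine DirectSum.linearMap_ext R fun j => TensorProduct.ext ?_
  refine totalCx_ext K fun c hc => ?_
  refine DirectSum.linearMap_ext R fun ⟨i, hi⟩ => ?_
  refine PiTensorProduct.ext (MultilinearMap.ext fun y => ?_)
  subst hi
  obtain ⟨h1, h2, h3⟩ := hc
  -- The multi-index can be read off from the cells, so it is replaced by the indices of `c`.
  obtain rfl : (fun k => (c k).1.1) = s := h2
  exact h (fun k => (c k, i k)) ⟨h1, rfl, show cellDim c + ∑ k, i k = n by omega⟩ y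

lemma splitCx_ext (n : ℤ) {M : Type*} [AddCommGroup M] [Module R M]
    {f g : (splitCx S K G).X n →ₗ[R] M}
    (h : ∀ p (hp : Admissible K Set.univ n p) y,
      f (splitIn G K _ n _ (totalCell R K _ hp.cellAdmissible) (PiTensorProduct.tprod R y)) =
      g (splitIn G K _ n _ (totalCell R K _ hp.cellAdmissible) (PiTensorProduct.tprod R y))) :
    f = g :=
  DirectSum.linearMap_ext R fun s => splitCx_ext_lof G K n s fun p hp y =>
    h p ⟨hp.1, Set.mem_univ _, hp.2.2⟩ y

lemma mulSum_splitIn (s : Fin m → S) (n : ℤ) (i : Fin m → ℤ)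
    (z : (totalCx R S K s).X (n - ∑ k, i k)) (y : ⨂[R] k, (G k (s k).1 (i k) : Type u)) :
    mulSum G K n (splitIn G K s n i z y) = mulTens G s i y z.1 := by
  refine (DirectSum.toModule_lof ..).trans ((DirectSum.toModule_lof ..).trans ?_)
  refine (TensorProduct.lift.tmul ..).trans ?_
  rw [LinearMap.flip_apply]
  exact congrArg (fun w : (totalCx R S K s).X (n - ∑ k, i k) →ₗ[R] Tens (modelF S G) => w z)
    (DirectSum.toModule_lof ..)

end Split

end PolyProd

end

/-! ### The splitting isomorphism of a polyhedral product -/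

noncomputable section

namespace PolyProd

variable {R : Type} [CommRing R]

section SplitIso

variable {m : ℕ} {S : Set XIdx} (G : Fin m → XIdx → Gr.{u} R) (K : LowerSet (Finset (Fin m)))

/-- The polyhedral product of model complexes. -/
abbrev modelPoly (S : Set XIdx) (G : Fin m → XIdx → Gr.{u} R) (K : LowerSet (Finset (Fin m))) :
    Cx.{u} R :=
  polyCx (I := fun _ => S) K (baseF S G) Set.univ

lemma mulSum_cell {P : Set (Fin m → S)} (n : ℤ) (p : Fin m → Cell S × ℤ) (hp : Admissible K P n p)
    (y : ∀ k, G k (p k).1.1.1.1 (p k).2) :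
    mulSum G K n (splitIn G K _ n _ (totalCell R K _ hp.cellAdmissible)
      (PiTensorProduct.tprod R y)) = cellSign R p • cellTens G p y :=
  (mulSum_splitIn ..).trans (mulTens_tcell G p y)

lemma mulSum_mem (n : ℤ) (x : (splitCx S K G).X n) :
    mulSum G K n x ∈ polySub K (baseF S G) ⊓ tensGr (modelF S G) Set.univ n := by
  -- Membership is restated as vanishing in the quotient, so that it may be checked on the
  -- generators of `splitCx`.
  have h : (polySub K (baseF S G) ⊓ tensGr (modelF S G) Set.univ n).mkQ ∘ₗ mulSum G K n = 0 := by
    refine splitCx_ext G K n fun p hp y => ?_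
    rw [LinearMap.comp_apply, mulSum_cell G K n p hp, LinearMap.zero_apply, Submodule.mkQ_apply,
      Submodule.Quotient.mk_eq_zero]
    exact Submodule.smul_mem _ _ (cellTens_mem G K Set.univ n p hp y)
  exact (Submodule.Quotient.mk_eq_zero _).1 (LinearMap.congr_fun h x)

open Classical in
/-- The coordinates of an element of a polyhedral product of model complexes. -/
def splitCoord (n : ℤ) : Tens (modelF S G) →ₗ[R] (splitCx S K G).X n :=
  (DirectSum.toModule R (Fin m → Cell S × ℤ) _ fun p =>
    if hp : Admissible K Set.univ n p then
      cellSign R p • splitIn G K _ n _ (totalCell R K _ hp.cellAdmissible)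
    else 0) ∘ₗ (tensCoord G).toLinearMap

lemma splitCoord_cellTens (n : ℤ) (p : Fin m → Cell S × ℤ) (hp : Admissible K Set.univ n p)
    (y : ∀ k, G k (p k).1.1.1.1 (p k).2) :
    splitCoord G K n (cellTens G p y) = cellSign R p •
      splitIn G K _ n _ (totalCell R K _ hp.cellAdmissible) (PiTensorProduct.tprod R y) := by
  refine (congrArg _ (tensCoord_cellTens G p y)).trans ((DirectSum.toModule_lof ..).trans ?_)
  rw [dif_pos hp]
  rfl

/-- Multiplication of cells by elements, as an equivalence. -/
def splitEquiv (n : ℤ) : (splitCx S K G).X n ≃ₗ[R] (modelPoly S G K).X n :=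
  LinearEquiv.ofLinearMap
    (LinearMap.codRestrict (polySub K (baseF S G) ⊓ tensGr (modelF S G) Set.univ n) (mulSum G K n)
      (mulSum_mem G K n))
    (splitCoord G K n ∘ₗ
      (polySub K (baseF S G) ⊓ tensGr (modelF S G) Set.univ n).subtype)
    (by
      refine LinearMap.ext fun ⟨z, hz⟩ => Subtype.ext ?_
      change mulSum G K n (splitCoord G K n z) = z
      rw [polySub_inf_tensGr_eq_span] at hz
      induction hz using Submodule.span_induction with
      | mem z hz₁ =>
        obtain ⟨p, hp, y, rfl⟩ := hz₁
        -- Both directions multiply by the same sign, whose square is `1`; hence the sign itself can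
        -- serve in the inverse.
        rw [splitCoord_cellTens G K n p hp, map_smul, mulSum_cell G K n p hp, smul_smul, cellSign_mul_self,
          one_smul]
      | zero => rw [map_zero, map_zero]
      | add x y hx hy ihx ihy => rw [map_add, map_add, ihx, ihy]
      | smul r x hx ih => rw [map_smul, map_smul, ih])
    (by
      refine splitCx_ext G K n fun p hp y => ?_
      change splitCoord G K n (mulSum G K n (splitIn G K _ n _ (totalCell R K _ hp.cellAdmissible)
        (PiTensorProduct.tprod R y))) = _
      rw [mulSum_cell G K n p hp, map_smul, splitCoord_cellTens G K n p hp, smul_smul, cellSign_mul_self,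
          one_smul]
      rfl)

lemma splitCx_d_splitIn (s : Fin m → S) (n n' : ℤ) (i : Fin m → ℤ)
    (z : (totalCx R S K s).X (n - ∑ k, i k)) (y : ⨂[R] k, (G k (s k).1 (i k) : Type u)) :
    ((splitCx S K G).d n n').hom (splitIn G K s n i z y) =
      splitIn G K s n' i (((totalCx R S K s).d _ _).hom z) y := by
  refine (DirectSum.lmap_lof ..).trans (congrArg _ ?_)
  refine (DirectSum.lmap_lof ..).trans (congrArg _ ?_)
  exact LinearMap.rTensor_tmul ..

lemma mulSum_d {n n' : ℤ} (hn : n' + 1 = n) (x : (splitCx S K G).X n) :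
    mulSum G K n' (((splitCx S K G).d n n').hom x) = tensD (modelF S G) (mulSum G K n x) := by
  have h : mulSum G K n' ∘ₗ ((splitCx S K G).d n n').hom = tensD (modelF S G) ∘ₗ mulSum G K n := by
    refine splitCx_ext G K n fun p hp y => ?_
    rw [LinearMap.comp_apply, LinearMap.comp_apply, splitCx_d_splitIn, mulSum_splitIn,
      mulSum_splitIn]
    refine Eq.trans ?_ (tensD_mulTens G p y).symm
    refine congrArg _ ?_
    exact polyCx_d_coe K (fun k (t : S) => unitIncl R t.1) {fun k => (p k).1.1.1}
      (by omega : n' - ∑ k, (p k).2 + 1 = n - ∑ k, (p k).2) _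
  exact LinearMap.congr_fun h x

/-- A polyhedral product of model complexes is the sum of the complexes `T^s ⊗ (⨂ G k (s k))`. -/
def splitIso : modelPoly S G K ≅ splitCx S K G :=
  (HomologicalComplex.Hom.isoOfComponents (fun n => (splitEquiv G K n).toModuleIso)
    fun i j hij => by
      have hij' : j + 1 = i := hij
      refine ModuleCat.hom_ext (LinearMap.ext fun x => Subtype.ext ?_)
      exact (polyCx_d_coe K (baseF S G) Set.univ hij' _).trans (mulSum_d G K hij' x).symm).symm

lemma map_splitIso_summand (s : Fin m → S) (n : ℤ) :
    Submodule.map ((splitIso G K).hom.f n).hom (polySummand (I := fun _ => S) K (baseF S G) s n) =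
      sumSummand (fun s : Fin m → S => pairCx (totalCx R S K s) (multiGr fun k => G k (s k).1))
        s n := by
  refine le_antisymm ?_ ?_
  · rintro _ ⟨⟨z, hz⟩, hzs, rfl⟩
    have hz' : z ∈ polySub K (baseF S G) ⊓ tensGr (modelF S G) {s} n := ⟨hz.1, hzs⟩
    change splitCoord G K n z ∈ _
    rw [polySub_inf_tensGr_eq_span] at hz'
    clear hz hzs
    induction hz' using Submodule.span_induction with
    | mem z hz₁ =>
      obtain ⟨p, hp, y, rfl⟩ := hz₁
      have hp' : Admissible K Set.univ n p := ⟨hp.1, Set.mem_univ _, hp.2.2⟩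
      rw [splitCoord_cellTens G K n p hp']
      obtain ⟨-, h2, -⟩ := hp
      obtain rfl : (fun k => (p k).1.1.1) = s := h2
      exact Submodule.smul_mem _ _ ⟨_, rfl⟩
    | zero => rw [map_zero]; exact zero_mem _
    | add x y hx hy ihx ihy => rw [map_add]; exact add_mem ihx ihy
    | smul r x hx ih => rw [map_smul]; exact Submodule.smul_mem _ _ ih
  · rintro _ ⟨x, rfl⟩
    refine ⟨splitEquiv G K n (DirectSum.lof R _ _ s x), ?_, (splitEquiv G K n).symm_apply_apply _⟩
    -- Modulo the part of multi-index `s`, multiplication vanishes on the generators of summand `s`,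
    -- hence on the whole summand.
    have h : ((tensGr (modelF S G) {s} n).mkQ ∘ₗ mulSum G K n) ∘ₗ _ = _ :=
      splitCx_ext_lof G K n (g := 0) s fun p hp y => by
        rw [LinearMap.comp_apply, mulSum_cell G K n p hp, LinearMap.zero_apply, Submodule.mkQ_apply,
          Submodule.Quotient.mk_eq_zero]
        exact Submodule.smul_mem _ _ (cellTens_mem G K {s} n p hp y).2
    exact (Submodule.Quotient.mk_eq_zero (tensGr (modelF S G) {s} n)).1 (LinearMap.congr_fun h x)

end SplitIso

end PolyProd

end

/-! ### Homology of sums of tensor products with flat modules -/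

noncomputable section

namespace PolyProd

variable {R : Type} [CommRing R]

section IsHomologyOf

variable {A B C H A' B' C' H' : Type*} [AddCommGroup A] [AddCommGroup B] [AddCommGroup C]
  [AddCommGroup H] [AddCommGroup A'] [AddCommGroup B'] [AddCommGroup C'] [AddCommGroup H']
  [Module R A] [Module R B] [Module R C] [Module R H] [Module R A'] [Module R B'] [Module R C']
  [Module R H']

/-- The module `H` is isomorphic to the homology `ker g / im f`. -/
def IsHomologyOf (f : A →ₗ[R] B) (g : B →ₗ[R] C) (H : Type*) [AddCommGroup H] [Module R H] : Prop :=
  ∃ π : LinearMap.ker g →ₗ[R] H, Function.Surjective π ∧ ∀ z, π z = 0 ↔ ∃ y, f y = z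

/-- Permits any module `Z` that maps isomorphically onto the kernel, such as a tensor product or a
sum of kernels. -/
lemma IsHomologyOf.of_exact {f : A →ₗ[R] B} {g : B →ₗ[R] C} {Z : Type*} [AddCommGroup Z]
    [Module R Z] (i : Z →ₗ[R] B) (hi : Function.Injective i) (hig : ∀ b, g b = 0 ↔ ∃ z, i z = b)
    (π : Z →ₗ[R] H) (hπ : Function.Surjective π) (h : ∀ z, π z = 0 ↔ ∃ y, f y = i z) :
    IsHomologyOf f g H := by
  let e : Z ≃ₗ[R] LinearMap.ker g := LinearEquiv.ofBijective
    (i.codRestrict (LinearMap.ker g) fun z => (hig _).2 ⟨z, rfl⟩)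
    ⟨fun a b hab => hi (congrArg Subtype.val hab), fun b => by
      obtain ⟨z, hz⟩ := (hig b.1).1 b.2
      exact ⟨z, Subtype.ext hz⟩⟩
  refine ⟨π ∘ₗ e.symm.toLinearMap, hπ.comp e.symm.surjective, fun z => ?_⟩
  obtain ⟨z, rfl⟩ := e.surjective z
  rw [LinearMap.comp_apply, LinearEquiv.coe_coe, e.symm_apply_apply]
  exact h z

lemma IsHomologyOf.unique {f : A →ₗ[R] B} {g : B →ₗ[R] C} (h : IsHomologyOf f g H)
    (h' : IsHomologyOf f g H') : Nonempty (H ≃ₗ[R] H') := by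
  obtain ⟨π, hπ, hπ0⟩ := h
  obtain ⟨π', hπ', hπ0'⟩ := h'
  have e : LinearMap.ker π = LinearMap.ker π' :=
    Submodule.ext fun z => (hπ0 z).trans (hπ0' z).symm
  exact ⟨(π.quotKerEquivOfSurjective hπ).symm ≪≫ₗ Submodule.quotEquivOfEq _ _ e ≪≫ₗ
    π'.quotKerEquivOfSurjective hπ'⟩

lemma IsHomologyOf.congr {f : A →ₗ[R] B} {g : B →ₗ[R] C} (h : IsHomologyOf f g H)
    {f' : A' →ₗ[R] B'} {g' : B' →ₗ[R] C'} (eA : A ≃ₗ[R] A') (eB : B ≃ₗ[R] B') (eC : C ≃ₗ[R] C')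
    (hf : ∀ a, f' (eA a) = eB (f a)) (hg : ∀ b, g' (eB b) = eC (g b)) : IsHomologyOf f' g' H := by
  obtain ⟨π, hπ, h0⟩ := h
  refine IsHomologyOf.of_exact (eB.toLinearMap ∘ₗ (LinearMap.ker g).subtype)
    (eB.injective.comp Subtype.val_injective) (fun b => ?_) π hπ fun z => (h0 z).trans ?_
  · obtain ⟨b, rfl⟩ := eB.surjective b
    rw [hg, LinearEquiv.map_eq_zero_iff]
    exact ⟨fun h => ⟨⟨b, h⟩, rfl⟩, by rintro ⟨z, hz⟩; rw [← eB.injective hz]; exact z.2⟩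
  · constructor
    · rintro ⟨y, hy⟩
      exact ⟨eA y, (hf y).trans (congrArg eB hy)⟩
    · rintro ⟨y, hy⟩
      obtain ⟨y, rfl⟩ := eA.surjective y
      exact ⟨y, eB.injective ((hf y).symm.trans hy)⟩

/-- Tensoring preserves the cokernel that defines homology, and flatness makes it preserve the
kernel and its embedding as well. -/
lemma IsHomologyOf.rTensor {f : A →ₗ[R] B} {g : B →ₗ[R] C} (h : IsHomologyOf f g H)
    (hgf : g ∘ₗ f = 0) (N : Type*) [AddCommGroup N] [Module R N] [Module.Flat R N] :
    IsHomologyOf (f.rTensor N) (g.rTensor N) (H ⊗[R] N) := by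
  obtain ⟨π, hπ, h0⟩ := h
  let f' : A →ₗ[R] LinearMap.ker g := f.codRestrict _ fun a => LinearMap.congr_fun hgf a
  have hf' : Function.Exact f' π := fun z => (h0 z).trans
    ⟨fun ⟨y, hy⟩ => ⟨y, Subtype.ext hy⟩, fun ⟨y, hy⟩ => ⟨y, congrArg Subtype.val hy⟩⟩
  have hg : Function.Exact (LinearMap.ker g).subtype g := fun z =>
    ⟨fun h => ⟨⟨z, h⟩, rfl⟩, by rintro ⟨z, rfl⟩; exact z.2⟩
  refine IsHomologyOf.of_exact ((LinearMap.ker g).subtype.rTensor N)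
    (Module.Flat.rTensor_preserves_injective_linearMap _ Subtype.val_injective)
    (Module.Flat.rTensor_exact N hg) (π.rTensor N) (LinearMap.rTensor_surjective N hπ) fun z => ?_
  refine (_root_.rTensor_exact N hf' hπ z).trans ?_
  have e : f.rTensor N = (LinearMap.ker g).subtype.rTensor N ∘ₗ f'.rTensor N :=
    LinearMap.rTensor_comp N (LinearMap.ker g).subtype f'
  rw [e]
  exact exists_congr fun y => ⟨fun h => congrArg _ h, fun h =>
    Module.Flat.rTensor_preserves_injective_linearMap _ Subtype.val_injective h⟩

end IsHomologyOf

lemma exists_lmap_eq_iff {κ : Type*} {M N : κ → Type*} [∀ s, AddCommGroup (M s)]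
    [∀ s, AddCommGroup (N s)] [∀ s, Module R (M s)] [∀ s, Module R (N s)] (u : ∀ s, M s →ₗ[R] N s)
    (x : ⨁ s, N s) : (∃ y, DirectSum.lmap u y = x) ↔ ∀ s, ∃ y, u s y = x s := by
  simpa using SetLike.ext_iff.1 (DirectSum.range_lmap u) x

lemma IsHomologyOf.directSum {κ : Type*} {A B C H : κ → Type*} [∀ s, AddCommGroup (A s)]
    [∀ s, AddCommGroup (B s)] [∀ s, AddCommGroup (C s)] [∀ s, AddCommGroup (H s)]
    [∀ s, Module R (A s)] [∀ s, Module R (B s)] [∀ s, Module R (C s)] [∀ s, Module R (H s)]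
    {f : ∀ s, A s →ₗ[R] B s} {g : ∀ s, B s →ₗ[R] C s} (h : ∀ s, IsHomologyOf (f s) (g s) (H s)) :
    IsHomologyOf (DirectSum.lmap f) (DirectSum.lmap g) (⨁ s, H s) := by
  choose π hπ h0 using h
  refine IsHomologyOf.of_exact (DirectSum.lmap fun s => (LinearMap.ker (g s)).subtype)
    ((DirectSum.lmap_injective _).2 fun s => Subtype.val_injective) (fun b => ?_)
    (DirectSum.lmap π) ((DirectSum.lmap_surjective _).2 hπ) fun z => ?_
  · rw [exists_lmap_eq_iff, DFinsupp.ext_iff]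
    exact forall_congr' fun s => ⟨fun h => ⟨⟨b s, h⟩, rfl⟩, by
      rintro ⟨z, hz⟩; rw [DirectSum.lmap_apply, ← hz]; exact z.2⟩
  · rw [exists_lmap_eq_iff, DFinsupp.ext_iff]
    exact forall_congr' fun s => h0 s (z s)

lemma isHomologyOf_homology {ι : Type*} {c : ComplexShape ι}
    (A : HomologicalComplex (ModuleCat.{u} R) c) {i j k : ι} (h : c.next j = k)
    (h' : c.prev j = i) : IsHomologyOf (A.d i j).hom (A.d j k).hom (A.homology j) :=
  ⟨cls A h, cls_surjective h, cls_eq_zero h h'⟩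

section Flat

lemma free_multiGr [IsDomain R] {m : ℕ} {G : Fin m → Gr.{u} R} (hG : ∀ k n, Module.Free R (G k n))
    (n : ℤ) : Module.Free R (multiGr G n) := by
  have : ∀ i : Fin m → ℤ, Module.Free R (⨂[R] k, (G k (i k) : Type u)) := fun i =>
    .of_basis (_root_.Basis.piTensorProduct fun k => (hG k (i k)).chooseBasis)
  infer_instance

/-- The differential does not change the coefficient degree `j`, so the complex is a sum over `j` of
shifted copies of `T`, each tensored with a flat module. -/
lemma isHomologyOf_pairCx (T : Cx.{0} R) (H : Gr.{u} R) (hH : ∀ n, Module.Flat R (H n)) (n : ℤ) :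
    IsHomologyOf ((pairCx T H).d (n + 1) n).hom ((pairCx T H).d n (n - 1)).hom
      (pairGr (homologyGr T) H n) := by
  refine IsHomologyOf.directSum (κ := ℤ) fun j => ?_
  refine IsHomologyOf.rTensor (isHomologyOf_homology T (j := n - j) ?_ ?_) ?_ (H j)
  · exact down_next (by omega)
  · exact down_prev (by omega)
  · rw [← ModuleCat.hom_comp, T.d_comp_d]
    rfl

lemma isHomologyOf_sumCx {J : Type} (X : J → Cx.{u} R) (M : J → Type u)
    [∀ s, AddCommGroup (M s)] [∀ s, Module R (M s)] (i j k : ℤ)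
    (h : ∀ s, IsHomologyOf ((X s).d i j).hom ((X s).d j k).hom (M s)) :
    IsHomologyOf ((sumCx X).d i j).hom ((sumCx X).d j k).hom (⨁ s, M s) :=
  IsHomologyOf.directSum h

/-- The homology of the sum of the complexes `T^s ⊗ H^s`, for flat `H^s`. -/
theorem nonempty_homologyGr_sum_pairCx {J : Type} (T : J → Cx.{0} R) (H : J → Gr.{u} R)
    (hH : ∀ s n, Module.Flat R (H s n)) (n : ℤ) :
    Nonempty (homologyGr (sumCx fun s => pairCx (T s) (H s)) n ≃ₗ[R]
      sumGr (fun s => pairGr (homologyGr (T s)) (H s)) n) :=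
  (isHomologyOf_homology _ (down_next (by omega)) (down_prev rfl)).unique
    (isHomologyOf_sumCx _ _ _ _ _ fun s => isHomologyOf_pairCx (T s) (H s) (hH s) n)

end Flat

end PolyProd

end

/-! ### Cohomology of the split complex -/

noncomputable section

namespace PolyProd

variable {R : Type} [CommRing R]

section DualHomotopy

/-- The dual of a chain homomorphism. -/
def dualCxMap {C D : Cx.{u} R} (f : C ⟶ D) : dualCx D ⟶ dualCx C where
  f n := ModuleCat.ofHom (f.f n).hom.dualMap
  comm' i j _ := by
    refine ModuleCat.hom_ext (LinearMap.ext fun x => LinearMap.ext fun y => ?_)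
    exact congrArg (fun z => (show Module.Dual R (D.X i) from x) z)
      (LinearMap.congr_fun (congrArg ModuleCat.Hom.hom (f.comm j i)) y).symm

/-- The dual of a family of homomorphisms. -/
def dualFam {C D : Cx.{u} R} (h : ∀ i j, C.X i ⟶ D.X j) (i j : ℤ) :
    (dualCx D).X i ⟶ (dualCx C).X j :=
  ModuleCat.ofHom (h j i).hom.dualMap

/-- The dual of a chain homotopy. -/
def dualHomotopy {C D : Cx.{u} R} {f g : C ⟶ D} (h : Homotopy f g) :
    Homotopy (dualCxMap f) (dualCxMap g) where
  hom := dualFam h.hom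
  zero i j hij := by
    have h0 : h.hom j i = 0 := h.zero j i fun e => hij e
    rw [dualFam, h0]
    refine ModuleCat.hom_ext (LinearMap.ext fun x => LinearMap.ext fun y => ?_)
    exact map_zero x
  comm n := by
    rw [dNext_eq _ (show (ComplexShape.up ℤ).Rel n (n + 1) from rfl),
      prevD_eq _ (show (ComplexShape.up ℤ).Rel (n - 1) n from sub_add_cancel n 1)]
    have hc := h.comm n
    rw [dNext_eq _ (show (ComplexShape.down ℤ).Rel n (n - 1) from sub_add_cancel n 1),
      prevD_eq _ (show (ComplexShape.down ℤ).Rel (n + 1) n from rfl)] at hc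
    refine ModuleCat.hom_ext (LinearMap.ext fun x => LinearMap.ext fun y => ?_)
    change Module.Dual R (D.X n) at x
    refine (congrArg (fun z => x z)
      (LinearMap.congr_fun (congrArg ModuleCat.Hom.hom hc) y)).trans ?_
    refine (map_add x _ _).trans (congrArg₂ (· + ·) ((map_add x _ _).trans ?_) rfl)
    exact add_comm _ _

/-- The dual of a chain homotopy equivalence. -/
def dualHomotopyEquiv {C D : Cx.{u} R} (e : HomotopyEquiv C D) :
    HomotopyEquiv (dualCx D) (dualCx C) where
  hom := dualCxMap e.hom
  inv := dualCxMap e.inv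
  homotopyHomInvId := dualHomotopy e.homotopyInvHomId
  homotopyInvHomId := dualHomotopy e.homotopyHomInvId

/-- A chain homotopy equivalence induces isomorphisms of the cohomology groups. -/
def cohomologyIso {C D : Cx.{u} R} (e : HomotopyEquiv C D) (n : ℤ) :
    cohomologyGr C n ≅ cohomologyGr D n :=
  ((dualHomotopyEquiv e).toHomologyIso n).symm

end DualHomotopy

section DualSum

variable {κ : Type*} {M N : κ → Type*} [∀ s, AddCommGroup (M s)] [∀ s, Module R (M s)]
  [∀ s, AddCommGroup (N s)] [∀ s, Module R (N s)] [DecidableEq κ]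

/-- The homomorphism from the sum of the duals to the dual of the sum. -/
def dualSum (M : κ → Type*) [∀ s, AddCommGroup (M s)] [∀ s, Module R (M s)] :
    (⨁ s, Module.Dual R (M s)) →ₗ[R] Module.Dual R (⨁ s, M s) :=
  DirectSum.toModule R κ _ fun s => (DirectSum.component R κ M s).dualMap

lemma dualSum_lof (x : ⨁ s, Module.Dual R (M s)) (s : κ) (y : M s) :
    dualSum M x (DirectSum.lof R κ M s y) = x s y := by
  induction x using DirectSum.induction_on with
  | zero => rw [map_zero]; rfl
  | add x x' h h' => rw [map_add, LinearMap.add_apply, h, h']; rfl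
  | of t f =>
    refine (LinearMap.congr_fun (DirectSum.toModule_lof R (M := fun s => Module.Dual R (M s)) t f)
      _).trans ?_
    change f (DirectSum.lof R κ M s y t) = DirectSum.of (fun s => Module.Dual R (M s)) t f s y
    by_cases h : s = t
    · subst h
      rw [DirectSum.of_eq_same]
      exact congrArg f (DirectSum.of_eq_same s y)
    · rw [lof_apply_ne h, map_zero, DirectSum.of_eq_of_ne _ _ _ h]
      rfl

lemma dualSum_injective : Function.Injective (dualSum (R := R) M) := fun x x' h =>
  DFinsupp.ext fun s => LinearMap.ext fun y => by
    rw [← dualSum_lof x, h, dualSum_lof]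

/-- A functional is determined by its restrictions to the summands; these form an element of a
direct sum because only finitely many summands are nonzero. -/
lemma dualSum_surjective (F : Finset κ) (hF : ∀ s, s ∉ F → Subsingleton (M s)) :
    Function.Surjective (dualSum (R := R) M) := by
  intro φ
  refine ⟨DirectSum.mk (fun s => Module.Dual R (M s)) F fun s => φ ∘ₗ DirectSum.lof R κ M s.1, ?_⟩
  refine DirectSum.linearMap_ext R fun s => LinearMap.ext fun y => ?_
  rw [LinearMap.comp_apply, dualSum_lof]
  by_cases hs : s ∈ F
  · rw [DirectSum.mk_apply_of_mem hs]
  · have := hF s hs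
    rw [Subsingleton.elim y 0, map_zero, map_zero]

/-- The dual of a sum with finitely many nonzero summands. -/
def dualSumEquiv (F : Finset κ) (hF : ∀ s, s ∉ F → Subsingleton (M s)) :
    (⨁ s, Module.Dual R (M s)) ≃ₗ[R] Module.Dual R (⨁ s, M s) :=
  LinearEquiv.ofBijective (dualSum M) ⟨dualSum_injective, dualSum_surjective F hF⟩

lemma dualSum_lmap (f : ∀ s, M s →ₗ[R] N s) (x : ⨁ s, Module.Dual R (N s)) :
    (DirectSum.lmap f).dualMap (dualSum N x) =
      dualSum M (DirectSum.lmap (fun s => (f s).dualMap) x) := by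
  refine DirectSum.linearMap_ext R fun s => LinearMap.ext fun y => ?_
  rw [LinearMap.comp_apply, LinearMap.comp_apply, LinearMap.dualMap_apply, DirectSum.lmap_lof,
    dualSum_lof, dualSum_lof]
  rfl

lemma IsHomologyOf.dual_directSum {A B C H : κ → Type*} [∀ s, AddCommGroup (A s)]
    [∀ s, AddCommGroup (B s)] [∀ s, AddCommGroup (C s)] [∀ s, AddCommGroup (H s)]
    [∀ s, Module R (A s)] [∀ s, Module R (B s)] [∀ s, Module R (C s)] [∀ s, Module R (H s)]
    {f : ∀ s, B s →ₗ[R] A s} {g : ∀ s, C s →ₗ[R] B s} (F : Finset κ)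
    (hF : ∀ s, s ∉ F → Subsingleton (A s) ∧ Subsingleton (B s) ∧ Subsingleton (C s))
    (h : ∀ s, IsHomologyOf (f s).dualMap (g s).dualMap (H s)) :
    IsHomologyOf (DirectSum.lmap f).dualMap (DirectSum.lmap g).dualMap (⨁ s, H s) :=
  (IsHomologyOf.directSum h).congr (dualSumEquiv F fun s hs => (hF s hs).1)
    (dualSumEquiv F fun s hs => (hF s hs).2.1) (dualSumEquiv F fun s hs => (hF s hs).2.2)
    (fun x => dualSum_lmap f x) (fun x => dualSum_lmap g x)

end DualSum

section DualTensor

variable (M M' N : Type*) [AddCommGroup M] [Module R M] [AddCommGroup N] [Module R N]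
  [AddCommGroup M'] [Module R M']

/-- The dual of a tensor product with a free module of finite rank. -/
def dualTensorEquiv [Module.Free R M] [Module.Finite R M] :
    (Module.Dual R M ⊗[R] Module.Dual R N) ≃ₗ[R] Module.Dual R (M ⊗[R] N) :=
  dualTensorHomEquiv R M (Module.Dual R N) ≪≫ₗ TensorProduct.lift.equiv (.id R) M N R

variable {M M'} in
lemma dualTensorEquiv_rTensor [Module.Free R M] [Module.Finite R M] [Module.Free R M']
    [Module.Finite R M'] (f : M →ₗ[R] M') (x : Module.Dual R M' ⊗[R] Module.Dual R N) :
    (f.rTensor N).dualMap (dualTensorEquiv M' N x) =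
      dualTensorEquiv M N (f.dualMap.rTensor (Module.Dual R N) x) := by
  induction x with
  | zero => simp only [map_zero]
  | add x y hx hy => simp only [map_add, hx, hy]
  | tmul t h =>
    refine TensorProduct.ext' fun a b => ?_
    simp [dualTensorEquiv]

variable {A B C H : Type*} [AddCommGroup A] [AddCommGroup B] [AddCommGroup C]
  [AddCommGroup H] [Module R A] [Module R B] [Module R C] [Module R H]
  [Module.Free R A] [Module.Free R B] [Module.Free R C]
  [Module.Finite R A] [Module.Finite R B] [Module.Finite R C]

/-- Only the complex has to be finite free for its duals to split off, without any finiteness of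
`N`. Homology then commutes with tensoring by the flat dual of `N`. -/
lemma IsHomologyOf.dual_rTensor {f : B →ₗ[R] A} {g : C →ₗ[R] B} (hfg : f ∘ₗ g = 0)
    (h : IsHomologyOf f.dualMap g.dualMap H) (N : Type*) [AddCommGroup N] [Module R N]
    [Module.Flat R (Module.Dual R N)] :
    IsHomologyOf (f.rTensor N).dualMap (g.rTensor N).dualMap (H ⊗[R] Module.Dual R N) := by
  refine (h.rTensor ?_ (Module.Dual R N)).congr (dualTensorEquiv A N) (dualTensorEquiv B N)
    (dualTensorEquiv C N) (fun x => dualTensorEquiv_rTensor N f x)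
    (fun x => dualTensorEquiv_rTensor N g x)
  rw [LinearMap.dualMap_comp_dualMap, hfg]
  exact LinearMap.ext fun φ => LinearMap.ext fun y => map_zero φ

end DualTensor

section TotalFinite

variable {m : ℕ} {S : Set XIdx}

instance (K : LowerSet (Finset (Fin m))) (s : Fin m → S) (n : ℤ) :
    Module.Finite R ((totalCx R S K s).X n) := by
  have e : polySub K (fun k (t : S) => unitIncl R t.1) ⊓ tensGr
    (modelF S fun _ : Fin m => unitFam R) {s} n = _ := polySub_unit_eq_span K {s} n
  have hf : {z | ∃ c, CellAdmissible K {s} n c ∧ z = tcell R c}.Finite :=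
    (Set.finite_range (tcell R)).subset (by rintro _ ⟨c, -, rfl⟩; exact ⟨c, rfl⟩)
  have : Module.Finite R (polySub K (fun k (t : S) => unitIncl R t.1) ⊓ tensGr
      (modelF S fun _ : Fin m => unitFam R) {s} n : Submodule R _) := by
    rw [e]
    exact Module.Finite.span_of_finite R hf
  exact this

instance free_unitGr [IsDomain R] [IsPrincipalIdealRing R] (n : ℤ) : Module.Free R (unitGr R n) :=
  inferInstanceAs (Module.Free R (if n = 0 then ⊤ else ⊥ : Submodule R R))

instance [IsDomain R] [IsPrincipalIdealRing R] (K : LowerSet (Finset (Fin m))) (s : Fin m → S)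
    (n : ℤ) : Module.Free R ((totalCx R S K s).X n) := by
  have h1 : ∀ p : Fin m → Cell S × ℤ, Module.Free R (⨂[R] k, (unitGr R (p k).2 : Type)) :=
    fun p => .of_basis (_root_.Basis.piTensorProduct fun k => Module.Free.chooseBasis R _)
  have h2 : Module.Free R (Tens (modelF S fun _ : Fin m => unitFam R)) :=
    .of_equiv (tensCoord (S := S) fun _ : Fin m => unitFam R).symm
  exact free_submodule (polySub K (fun k (t : S) => unitIncl R t.1) ⊓ tensGr
      (modelF S fun _ : Fin m => unitFam R) {s} n)

lemma cellDim_mem_Icc (c : Fin m → Cell S) : cellDim c ∈ Set.Icc (0 : ℤ) m := by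
  have h : ∀ b, 0 ≤ bdeg b ∧ bdeg b ≤ 1 := by decide
  refine ⟨Finset.sum_nonneg fun k _ => (h _).1, ?_⟩
  refine (Finset.sum_le_card_nsmul _ _ 1 fun k _ => (h (c k).1.2).2).trans ?_
  simp

lemma subsingleton_totalCx (K : LowerSet (Finset (Fin m))) (s : Fin m → S) (n : ℤ)
    (hn : n ∉ Set.Icc (0 : ℤ) m) : Subsingleton ((totalCx R S K s).X n) := by
  have e : (LinearMap.id : (totalCx R S K s).X n →ₗ[R] (totalCx R S K s).X n) = 0 :=
    totalCx_ext K fun c hc => absurd (hc.2.2 ▸ cellDim_mem_Icc c) hn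
  exact ⟨fun x y => (LinearMap.congr_fun e x).trans (LinearMap.congr_fun e y).symm⟩

lemma up_next {n k : ℤ} (h : n + 1 = k) : (ComplexShape.up ℤ).next n = k :=
  (ComplexShape.up ℤ).next_eq' h

lemma up_prev {n k : ℤ} (h : k + 1 = n) : (ComplexShape.up ℤ).prev n = k :=
  (ComplexShape.up ℤ).prev_eq' h

/-- Nothing is required of `H`: the dual of any module is torsion-free, hence flat over a principal
ideal domain. The total complex is finite free in each degree and bounded. -/
lemma isHomologyOf_dual_pairCx [IsDomain R] [IsPrincipalIdealRing R]
    (K : LowerSet (Finset (Fin m))) (s : Fin m → S) (H : Gr.{u} R) (n : ℤ) :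
    IsHomologyOf ((pairCx (totalCx R S K s) H).d n (n - 1)).hom.dualMap
      ((pairCx (totalCx R S K s) H).d (n + 1) n).hom.dualMap
      (pairGr (cohomologyGr (totalCx R S K s)) (dualGr H) n) := by
  -- The total complex lives in degrees `0` to `m`. The degrees `n - 1`, `n`, `n + 1` that determine
  -- cohomology in degree `n` thus involve only coefficient degrees from `n - 1 - m` to `n + 1`.
  refine IsHomologyOf.dual_directSum (κ := ℤ) (Finset.Icc (n - 1 - m) (n + 1)) (fun j hj => ?_)
    fun j => ?_
  · rw [Finset.mem_Icc] at hj
    have h := fun q (hq : n - 1 ≤ q ∧ q ≤ n + 1) =>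
      subsingleton_totalCx (R := R) K s (q - j) fun h => hj (by
        obtain ⟨h1, h2⟩ := h
        omega)
    have h' := fun q hq => haveI := h q hq
      (inferInstance : Subsingleton ((totalCx R S K s).X (q - j) ⊗[R] H j))
    exact ⟨h' _ (by omega), h' _ (by omega), h' _ (by omega)⟩
  · refine IsHomologyOf.dual_rTensor (by rw [← ModuleCat.hom_comp, (totalCx R S K s).d_comp_d]; rfl)
      ?_ (H j)
    exact isHomologyOf_homology (dualCx (totalCx R S K s)) (up_next (by omega)) (up_prev (by omega))

/-- The cohomology of the sum of the complexes `T^s ⊗ H^s`. -/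
theorem nonempty_cohomologyGr_split [IsDomain R] [IsPrincipalIdealRing R]
    (K : LowerSet (Finset (Fin m))) (H : (Fin m → S) → Gr.{u} R) (n : ℤ) :
    Nonempty (cohomologyGr (sumCx fun s : Fin m → S => pairCx (totalCx R S K s) (H s)) n ≃ₗ[R]
      sumGr (fun s => pairGr (cohomologyGr (totalCx R S K s)) (dualGr (H s))) n) := by
  have := Fintype.ofFinite (Fin m → S)
  refine (isHomologyOf_homology (dualCx (sumCx fun s : Fin m → S =>
    pairCx (totalCx R S K s) (H s))) (up_next rfl) (up_prev (sub_add_cancel n 1))).unique ?_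
  exact IsHomologyOf.dual_directSum Finset.univ (fun s hs => absurd (Finset.mem_univ s) hs)
    fun s => isHomologyOf_dual_pairCx K s (H s) n

end TotalFinite

end PolyProd

end

/-! ### Dual character groups, finite type, and epimorphisms -/

noncomputable section

namespace PolyProd

variable {R : Type} [CommRing R]

section Dual

variable {M N : Type*} [AddCommGroup M] [Module R M] [AddCommGroup N] [Module R N]

lemma exists_section_rangeRestrict (f : M →ₗ[R] N) (h : Module.Free R (LinearMap.range f)) :
    ∃ s : LinearMap.range f →ₗ[R] M, ∀ y, f (s y) = y := by
  obtain ⟨s, hs⟩ := Module.projective_lifting_property f.rangeRestrict LinearMap.id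
    f.surjective_rangeRestrict
  exact ⟨s, fun y => congrArg Subtype.val (LinearMap.congr_fun hs y)⟩

lemma exists_retraction (L : Submodule R N) (h : Module.Free R (N ⧸ L)) :
    ∃ r : N →ₗ[R] L, ∀ y : L, r y = y := by
  obtain ⟨s, hs⟩ := Module.projective_lifting_property L.mkQ LinearMap.id L.mkQ_surjective
  refine ⟨(LinearMap.id - s ∘ₗ L.mkQ).codRestrict L fun x => ?_, fun y => Subtype.ext ?_⟩
  · change (y : N) - s (L.mkQ y) = y
    rw [Submodule.mkQ_apply, (Submodule.Quotient.mk_eq_zero L).2 y.2, map_zero, sub_zero]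
  · rw [← Submodule.Quotient.mk_eq_zero]
    have := LinearMap.congr_fun hs (L.mkQ x)
    simp only [LinearMap.comp_apply, LinearMap.id_apply] at this
    change L.mkQ (x - s (L.mkQ x)) = 0
    rw [map_sub, this, sub_self]

/-- The image of the dual of a split homomorphism is the dual of the image. -/
lemma nonempty_range_dualMap_equiv (f : M →ₗ[R] N)
    (h : Module.Free R (N ⧸ LinearMap.range f)) :
    Nonempty (LinearMap.range f.dualMap ≃ₗ[R] Module.Dual R (LinearMap.range f)) := by
  obtain ⟨r, hr⟩ := exists_retraction _ h
  have hmem : ∀ g : Module.Dual R (LinearMap.range f),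
      f.rangeRestrict.dualMap g ∈ LinearMap.range f.dualMap := fun g =>
    ⟨g ∘ₗ r, LinearMap.ext fun x => congrArg g (hr (f.rangeRestrict x))⟩
  refine ⟨(LinearEquiv.ofBijective (f.rangeRestrict.dualMap.codRestrict _ hmem) ⟨?_, ?_⟩).symm⟩
  · intro g g' e
    exact LinearMap.dualMap_injective_of_surjective f.surjective_rangeRestrict
      (congrArg Subtype.val e)
  · rintro ⟨_, g, rfl⟩
    exact ⟨g ∘ₗ (LinearMap.range f).subtype, Subtype.ext rfl⟩

/-- The cokernel of the dual of a split homomorphism is the dual of the kernel. -/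
lemma nonempty_quot_dualMap_equiv (f : M →ₗ[R] N) (hi : Module.Free R (LinearMap.range f))
    (hc : Module.Free R (N ⧸ LinearMap.range f)) :
    Nonempty ((Module.Dual R M ⧸ LinearMap.range f.dualMap) ≃ₗ[R]
      Module.Dual R (LinearMap.ker f)) := by
  obtain ⟨r, hr⟩ := exists_retraction _ hc
  obtain ⟨s, hs⟩ := exists_section_rangeRestrict f hi
  have hk : LinearMap.range f.dualMap = LinearMap.ker (LinearMap.ker f).subtype.dualMap := by
    refine le_antisymm ?_ fun φ hφ => ?_
    · rintro _ ⟨g, rfl⟩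
      exact LinearMap.ext fun x => (congrArg g x.2).trans (map_zero g)
    -- A functional vanishing on the kernel factors through the image; the retraction `r` extends it
    -- from the image to `N`.
    · refine ⟨φ ∘ₗ s ∘ₗ r, LinearMap.ext fun x => ?_⟩
      have hx : x - s (f.rangeRestrict x) ∈ LinearMap.ker f := by
        rw [LinearMap.mem_ker, map_sub, hs]
        exact sub_self _
      have h0 : φ (x - s (f.rangeRestrict x)) = 0 := LinearMap.congr_fun hφ ⟨_, hx⟩
      rw [map_sub, sub_eq_zero] at h0
      exact (congrArg (fun y => φ (s y)) (hr (f.rangeRestrict x))).trans h0.symm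
  refine ⟨Submodule.quotEquivOfEq _ _ hk ≪≫ₗ LinearMap.quotKerEquivOfSurjective _ fun g => ?_⟩
  have hmem : ∀ x, (LinearMap.id - s ∘ₗ f.rangeRestrict : M →ₗ[R] M) x ∈ LinearMap.ker f := fun x => by
    change f (x - s (f.rangeRestrict x)) = 0
    rw [map_sub, hs]
    exact sub_self _
  refine ⟨g ∘ₗ (LinearMap.id - s ∘ₗ f.rangeRestrict : M →ₗ[R] M).codRestrict (LinearMap.ker f) hmem,
    LinearMap.ext fun x => congrArg g (Subtype.ext ?_)⟩
  change (x : M) - s (f.rangeRestrict x) = x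
  rw [show f.rangeRestrict x = 0 from Subtype.ext x.2, map_zero, sub_zero]

end Dual

section FiniteType

variable {U V : Gr.{u} R} {θ : ∀ n, U n ⟶ V n}

/-- The kernels, images and cokernels are free. -/
def IsSplitGr (θ : ∀ n, U n ⟶ V n) : Prop := ∀ s n, Module.Free R (charGroup θ s n)

lemma IsSplitHom.isSplitGr {Λ : Type v} {U V : Λ → Gr.{u} R} {θ : ∀ a n, U a n ⟶ V a n}
    (h : IsSplitHom θ) (a : Λ) : IsSplitGr (θ a)
  | .im, n => h.im_free a n
  | .ker, n => h.ker_free a n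
  | .coker, n => h.coker_free a n

/-- Dualizing exchanges kernel and cokernel, and the index convention is arranged for this. At
`coker` duality is automatic; the other two cases use that the image is a direct summand. -/
lemma nonempty_cocharGroup_equiv (h : IsSplitGr θ) :
    ∀ s n, Nonempty (cocharGroup θ s n ≃ₗ[R] Module.Dual R (charGroup θ s n))
  | .im, n => nonempty_range_dualMap_equiv (θ n).hom (h .coker n)
  | .ker, n => nonempty_quot_dualMap_equiv (θ n).hom (h .im n) (h .coker n)
  | .coker, n => ⟨LinearEquiv.ofEq _ _ (LinearMap.ker_dualMap_eq_dualAnnihilator_range (θ n).hom)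
      ≪≫ₗ (Submodule.dualQuotEquivDualAnnihilator _).symm⟩

lemma finite_charGroup [IsNoetherianRing R] (hU : IsFiniteType U) (hV : IsFiniteType V) :
    ∀ s n, Module.Finite R (charGroup θ s n) := by
  intro s n
  have := hU.1 n
  have := hV.1 n
  cases s
  · exact inferInstanceAs (Module.Finite R (LinearMap.range (θ n).hom))
  · exact inferInstanceAs (Module.Finite R (LinearMap.ker (θ n).hom))
  · exact inferInstanceAs (Module.Finite R (V n ⧸ LinearMap.range (θ n).hom))

lemma exists_subsingleton_charGroup (hU : IsFiniteType U) (hV : IsFiniteType V) :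
    ∃ b : ℤ, ∀ s, ∀ n < b, Subsingleton (charGroup θ s n) := by
  obtain ⟨b, hb⟩ := hU.2
  obtain ⟨c, hc⟩ := hV.2
  refine ⟨min b c, fun s n hn => ?_⟩
  have := hb n (lt_of_lt_of_le hn (min_le_left _ _))
  have := hc n (lt_of_lt_of_le hn (min_le_right _ _))
  cases s
  · exact inferInstanceAs (Subsingleton (LinearMap.range (θ n).hom))
  · exact inferInstanceAs (Subsingleton (LinearMap.ker (θ n).hom))
  · exact (Submodule.mkQ_surjective (LinearMap.range (θ n).hom)).subsingleton

lemma nonempty_dual_equiv (M : Type*) [AddCommGroup M] [Module R M] [Module.Free R M]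
    [Module.Finite R M] : Nonempty (Module.Dual R M ≃ₗ[R] M) := by
  classical
  exact ⟨(Module.Free.chooseBasis R M).toDualEquiv.symm⟩

lemma subsingleton_piTensorProduct {κ : Type*} {M : κ → Type*} [∀ k, AddCommGroup (M k)]
    [∀ k, Module R (M k)] (k : κ) (h : Subsingleton (M k)) : Subsingleton (⨂[R] k, M k) := by
  have e : (LinearMap.id : (⨂[R] k, M k) →ₗ[R] ⨂[R] k, M k) = 0 :=
    PiTensorProduct.ext (MultilinearMap.ext fun x =>
      (PiTensorProduct.tprod R).map_coord_zero k (Subsingleton.elim _ _))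
  exact ⟨fun x y => (LinearMap.congr_fun e x).trans (LinearMap.congr_fun e y).symm⟩

/-- A tensor product of graded groups of finite type is degreewise isomorphic to its dual. -/
lemma nonempty_dual_multiGr_equiv [IsDomain R] {m : ℕ} {G : Fin m → Gr.{u} R}
    (hfree : ∀ k n, Module.Free R (G k n))
    (hfin : ∀ k n, Module.Finite R (G k n)) (hb : ∀ k, ∃ b : ℤ, ∀ n < b, Subsingleton (G k n))
    (j : ℤ) : Nonempty (Module.Dual R (multiGr G j) ≃ₗ[R] multiGr G j) := by
  choose b hb using hb
  -- Lower bounds on all entries and a fixed sum bound each entry above, so only finitely many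
  -- multi-indices give nonzero summands. This is where vanishing below some degree is needed.
  have hF : {i : {i : Fin m → ℤ // ∑ k, i k = j} | ∀ k, b k ≤ i.1 k}.Finite := by
    refine ((Set.finite_Icc b fun k => j - ∑ l, b l + b k).preimage
      Subtype.val_injective.injOn).subset fun i hi => ⟨hi, fun k => ?_⟩
    have h1 : ∑ l ∈ Finset.univ.erase k, b l ≤ ∑ l ∈ Finset.univ.erase k, i.1 l :=
      Finset.sum_le_sum fun l _ => hi l
    have h2 := Finset.add_sum_erase Finset.univ b (Finset.mem_univ k)
    have h3 := Finset.add_sum_erase Finset.univ i.1 (Finset.mem_univ k)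
    have h4 := i.2
    change i.1 k ≤ j - ∑ l, b l + b k
    omega
  have hT : ∀ i : Fin m → ℤ, Nonempty (Module.Dual R (⨂[R] k, (G k (i k) : Type u)) ≃ₗ[R]
      ⨂[R] k, (G k (i k) : Type u)) := fun i => by
    have B := _root_.Basis.piTensorProduct fun k => Module.Free.chooseBasis R (G k (i k))
    have := Module.Free.of_basis B
    have := Module.Finite.of_basis B
    exact nonempty_dual_equiv _
  refine ⟨(dualSumEquiv hF.toFinset fun i hi => ?_).symm ≪≫ₗ
    DirectSum.congrLinearEquiv fun i => (hT i.1).some⟩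
  rw [Set.Finite.mem_toFinset] at hi
  have hi' : ¬∀ k, b k ≤ i.1 k := hi
  push Not at hi'
  obtain ⟨k, hk⟩ := hi'
  exact subsingleton_piTensorProduct k (hb k _ hk)

/-- All modules are free of finite rank, so each is noncanonically isomorphic to its dual: one
undoes the dual of the product and then passes to the duals in each factor. -/
theorem nonempty_dual_multiChar_equiv [IsDomain R] [IsPrincipalIdealRing R] {m : ℕ}
    {U V : Fin m → Gr.{u} R} {θ : ∀ k n, U k n ⟶ V k n} (hθ : ∀ k, IsSplitGr (θ k))
    (hf : ∀ k, IsFiniteType (U k) ∧ IsFiniteType (V k)) (s : Fin m → XIdx) (j : ℤ) :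
    Nonempty (Module.Dual R (multiChar θ s j) ≃ₗ[R] multiCochar θ s j) := by
  have hfin := fun k => finite_charGroup (θ := θ k) (hf k).1 (hf k).2
  have he : ∀ k n, Nonempty (charGroup (θ k) (s k) n ≃ₗ[R] cocharGroup (θ k) (s k) n) :=
    fun k n => by
      have := hfin k (s k) n
      have := hθ k (s k) n
      exact ⟨(nonempty_dual_equiv (charGroup (θ k) (s k) n)).some.symm ≪≫ₗ
        (nonempty_cocharGroup_equiv (hθ k) (s k) n).some.symm⟩
  obtain ⟨e⟩ := nonempty_dual_multiGr_equiv (G := fun k => charGroup (θ k) (s k))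
    (fun k => hθ k (s k)) (fun k => hfin k (s k))
    (fun k => (exists_subsingleton_charGroup (θ := θ k) (hf k).1 (hf k).2).imp
      fun b hb => hb (s k)) j
  exact ⟨e ≪≫ₗ DirectSum.congrLinearEquiv fun i =>
    PiTensorProduct.congr fun k => (he k (i.1 k)).some⟩

end FiniteType

section Source

variable {U V : Gr.{u} R} {θ : ∀ n, U n ⟶ V n}

theorem charIsSource (h : IsSplitGr θ) (hsurj : ∀ n, Function.Surjective (θ n).hom) :
    CharIsSource θ := by
  intro n
  refine ⟨?_, ?_⟩
  · exact Submodule.Quotient.subsingleton_iff.2 (LinearMap.range_eq_top.2 (hsurj n))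
  · obtain ⟨s, hs⟩ := exists_section_rangeRestrict (θ n).hom (h .im n)
    have hθ : ∀ x y, (θ n).hom (((LinearMap.ker (θ n).hom).subtype.coprod s) (x, y)) = y :=
      fun x y => by
        rw [LinearMap.coprod_apply, map_add, hs]
        exact (congrArg (· + (y : V n)) x.2).trans (zero_add _)
    refine ⟨LinearEquiv.ofBijective ((LinearMap.ker (θ n).hom).subtype.coprod s) ⟨?_, ?_⟩, ?_, hθ⟩
    · rw [← LinearMap.ker_eq_bot, LinearMap.ker_eq_bot']
      rintro ⟨x, y⟩ hxy
      have hy : y = 0 := Subtype.ext ((hθ x y).symm.trans ((congrArg _ hxy).trans (map_zero _)))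
      subst hy
      rw [LinearMap.coprod_apply, map_zero, add_zero] at hxy
      exact Prod.ext (Subtype.ext hxy) rfl
    · intro u
      refine ⟨(⟨u - s ((θ n).hom.rangeRestrict u), ?_⟩, (θ n).hom.rangeRestrict u), ?_⟩
      · rw [LinearMap.mem_ker, map_sub, hs]
        exact sub_self _
      · exact sub_add_cancel _ _
    · intro x
      change (x : U n) + s 0 = x
      rw [map_zero, add_zero]

theorem cocharIsSource (h : IsSplitGr θ) (hsurj : ∀ n, Function.Surjective (θ n).hom) :
    CocharIsSource θ := by
  intro n
  refine ⟨?_, ?_⟩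
  · have hk : LinearMap.ker (θ n).hom.dualMap = ⊥ :=
      LinearMap.ker_eq_bot.2 (LinearMap.dualMap_injective_of_surjective (hsurj n))
    exact Submodule.subsingleton_iff_eq_bot.2 hk
  · obtain ⟨s, hs⟩ := exists_section_rangeRestrict (θ n).hom (h .im n)
    -- The projection `f ↦ f ∘ s ∘ θ`, where surjectivity lets the section `s` be defined on all of
    -- `V`. It is the identity on the range of the dual map because `θ ∘ s = 1`.
    let ρ : Module.Dual R (U n) →ₗ[R] LinearMap.range (θ n).hom.dualMap :=
      (θ n).hom.dualMap.rangeRestrict ∘ₗ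
        (s ∘ₗ LinearMap.id.codRestrict (LinearMap.range (θ n).hom) fun x => hsurj n x).dualMap
    have hρ : ∀ y : LinearMap.range (θ n).hom.dualMap, ρ y = y := by
      rintro ⟨_, g, rfl⟩
      exact Subtype.ext (LinearMap.ext fun x => congrArg g (hs _))
    let e : Module.Dual R (U n) →ₗ[R]
        (Module.Dual R (U n) ⧸ LinearMap.range (θ n).hom.dualMap) ×
          LinearMap.range (θ n).hom.dualMap := (Submodule.mkQ _).prod ρ
    have he : ∀ y : LinearMap.range (θ n).hom.dualMap, e y = (0, y) := fun y =>
      Prod.ext ((Submodule.Quotient.mk_eq_zero _).2 y.2) (hρ y)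
    refine ⟨LinearEquiv.ofBijective e ⟨?_, ?_⟩, fun f => rfl, he⟩
    · refine (injective_iff_map_eq_zero e).2 fun f hf => ?_
      have hmem := (Submodule.Quotient.mk_eq_zero _).1 (congrArg Prod.fst hf)
      have h0 := congrArg Prod.snd ((he ⟨f, hmem⟩).symm.trans hf)
      exact congrArg Subtype.val h0
    · rintro ⟨q, y⟩
      obtain ⟨f, rfl⟩ := Submodule.mkQ_surjective _ q
      refine ⟨f - ρ f + y, ?_⟩
      rw [map_add, map_sub, he, he]
      refine Prod.ext ?_ ?_
      · change Submodule.mkQ _ f - 0 + 0 = _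
        rw [sub_zero, add_zero]
      · exact (congrArg (· + y) (sub_self (ρ f))).trans (zero_add y)

end Source

end PolyProd

end

/-! ### Assembly of the theorem -/

noncomputable section

namespace PolyProd

variable {R : Type} [CommRing R]

section Assembly

variable {m : ℕ} {S : Set XIdx} [IsDomain R]
  (K : LowerSet (Finset (Fin m))) {C : Cx.{u} R} {U V : Fin m → Gr.{u} R}
  {θ : ∀ k n, U k n ⟶ V k n}

/-- The splitting of the polyhedral product character complex. -/
def charIso (S : Set XIdx) (K : LowerSet (Finset (Fin m))) (θ : ∀ k n, U k n ⟶ V k n) :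
    charCx S K θ ≅
      sumCx fun s : Fin m → S => pairCx (totalCx R S K s) (multiChar θ fun k => (s k).1) :=
  splitIso (fun k => charGroup (θ k)) K

/-- Freeness of the character groups passes to their tensor products, which provides the flatness
needed to take homology. -/
theorem nonempty_homologyGr_iso (e : HomotopyEquiv C (charCx S K θ)) (hθ : ∀ k, IsSplitGr (θ k))
    (n : ℤ) : Nonempty (homologyGr C n ≅
      sumGr (fun s : Fin m → S => pairGr (homologyGr (totalCx R S K s))
        (multiChar θ fun k => (s k).1)) n) := by
  have hflat : ∀ (s : Fin m → S) n, Module.Flat R (multiChar θ (fun k => (s k).1) n) :=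
    fun s n => by
      have : Module.Free R (multiChar θ (fun k => (s k).1) n) := free_multiGr
        (G := fun k => charGroup (θ k) (s k).1) (fun k => hθ k (s k).1) n
      exact Module.Flat.of_free
  obtain ⟨f⟩ := nonempty_homologyGr_sum_pairCx (fun s : Fin m → S => totalCx R S K s)
    (fun s => multiChar θ fun k => (s k).1) hflat n
  exact ⟨e.toHomologyIso n ≪≫ HomologicalComplex.homologyMapIso (charIso S K θ) n ≪≫
    f.toModuleIso⟩

/-- The dual of a homotopy equivalence is a homotopy equivalence, so cohomology may be computed on
the split complex. -/
theorem nonempty_cohomologyGr_iso [IsPrincipalIdealRing R] (e : HomotopyEquiv C (charCx S K θ))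
    (n : ℤ) :
    Nonempty (cohomologyGr C n ≅
      sumGr (fun s : Fin m → S => pairGr (cohomologyGr (totalCx R S K s))
        (dualGr (multiChar θ fun k => (s k).1))) n) := by
  obtain ⟨f⟩ := nonempty_cohomologyGr_split (R := R) (S := S) K
    (fun s => multiChar θ fun k => (s k).1) n
  exact ⟨cohomologyIso (e.trans (HomotopyEquiv.ofIso (charIso S K θ))) n ≪≫ f.toModuleIso⟩

theorem nonempty_sumGr_cochar_iso [IsPrincipalIdealRing R]
    (hθ : ∀ k, IsSplitGr (θ k)) (hf : ∀ k, IsFiniteType (U k) ∧ IsFiniteType (V k)) (T : (Fin m → S) → Gr.{0} R) (n : ℤ) :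
    Nonempty (sumGr (fun s : Fin m → S => pairGr (T s)
        (dualGr (multiChar θ fun k => (s k).1))) n ≅
      sumGr (fun s : Fin m → S => pairGr (T s) (multiCochar θ fun k => (s k).1)) n) :=
  ⟨(DirectSum.congrLinearEquiv fun s => DirectSum.congrLinearEquiv fun j =>
    TensorProduct.congr (LinearEquiv.refl R (T s (n - j)))
      (nonempty_dual_multiChar_equiv hθ hf (fun k => (s k).1) j).some).toModuleIso⟩

end Assembly

end PolyProd

end

open PolyProd CategoryTheory in
theorem theorem3p7 {m : ℕ} (K : LowerSet (Finset (Fin m))) {Λ : Fin m → Type v}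
    {C D : ∀ k, Λ k → Cx.{u} ℤ} (ϑ : ∀ k a, C k a ⟶ D k a)
    (hϑ : ∀ k, IsSplitInclusion (ϑ k)) :
    (∀ S : Set XIdx,
      (S = Set.univ ∨
        S = rightIdx ∧ ∀ k a n, Function.Surjective (homologyHom (ϑ k a) n).hom) →
      ∀ a : ∀ k, Λ k,
        (∃ φ : HomotopyEquiv (inclCx K fun k => ϑ k (a k))
            (charCx S K fun k => homologyHom (ϑ k (a k))),
          ∀ n, Function.Surjective (φ.hom.f n).hom) ∧
        (∃ φ : charCx S K (fun k => homologyHom (ϑ k (a k))) ≅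
            sumCx fun s : Fin m → S => pairCx (totalCx ℤ S K s)
              (multiChar (fun k => homologyHom (ϑ k (a k))) fun k => (s k).1),
          ∀ s n, Submodule.map (φ.hom.f n).hom
              (charSummand S K (fun k => homologyHom (ϑ k (a k))) s n) =
            sumSummand _ s n) ∧
        (∀ n, Nonempty (homologyGr (inclCx K fun k => ϑ k (a k)) n ≅
          sumGr (fun s : Fin m → S => pairGr (homologyGr (totalCx ℤ S K s))
            (multiChar (fun k => homologyHom (ϑ k (a k))) fun k => (s k).1)) n)) ∧
        (∀ n, Nonempty (cohomologyGr (inclCx K fun k => ϑ k (a k)) n ≅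
          sumGr (fun s : Fin m → S => pairGr (cohomologyGr (totalCx ℤ S K s))
            (dualGr (multiChar (fun k => homologyHom (ϑ k (a k))) fun k => (s k).1))) n)) ∧
        ((∀ k, IsFiniteType (homologyGr (C k (a k))) ∧ IsFiniteType (homologyGr (D k (a k)))) →
          ∀ n, Nonempty (cohomologyGr (inclCx K fun k => ϑ k (a k)) n ≅
            sumGr (fun s : Fin m → S => pairGr (cohomologyGr (totalCx ℤ S K s))
              (multiCochar (fun k => homologyHom (ϑ k (a k))) fun k => (s k).1)) n))) ∧
    ((∀ k a n, Function.Surjective (homologyHom (ϑ k a) n).hom) →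
      ∀ k a, CharIsSource (homologyHom (ϑ k a)) ∧ CocharIsSource (homologyHom (ϑ k a))) := by
  refine ⟨fun S hS a => ?_, fun hsurj k a => ?_⟩
  · obtain ⟨φ, hφ⟩ := exists_inclCx_homotopyEquiv K ϑ hϑ S hS a
    have hθ : ∀ k, IsSplitGr (homologyHom (ϑ k (a k))) := fun k => (hϑ k).split.isSplitGr (a k)
    refine ⟨⟨φ, hφ⟩, ⟨charIso S K _, fun s n => map_splitIso_summand _ K s n⟩,
      nonempty_homologyGr_iso K φ hθ, nonempty_cohomologyGr_iso K φ, fun hf n => ?_⟩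
    obtain ⟨e⟩ := nonempty_cohomologyGr_iso K φ n
    obtain ⟨f⟩ := nonempty_sumGr_cochar_iso hθ hf (fun s => cohomologyGr (totalCx ℤ S K s)) n
    exact ⟨e ≪≫ f⟩
  · have hθ : IsSplitGr (homologyHom (ϑ k a)) := (hϑ k).split.isSplitGr a
    exact ⟨charIsSource hθ (hsurj k a), cocharIsSource hθ (hsurj k a)⟩
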